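/- **Setting.** Let $V=V_0\oplus V_1$ be a complex super vector space and let $QO(V)$ be the space of linear maps $V\to V((z))$, written $a(z)=\sum_{n\in\mathbb Z}a(n)z^{-n-1}$. The circle products $\circ_n$ ($n\in\mathbb Z$) are the bilinear operations given on homogeneous $a,b$ by $$a\circ_n b=\mathrm{Res}_z\,a(z)b(w)\,\iota_{|z|>|w|}(z-w)^n-(-1)^{|a||b|}\mathrm{Res}_z\,b(w)a(z)\,\iota_{|w|>|z|}(z-w)^n ,$$ where $\iota$ denotes expansion in the indicated region. Put $:\!ab\!:\,=a\circ_{-1}b$, and write $a(z)b(w)\sim\sum_{n\ge0}c_n(w)(z-w)^{-n-1}$ when $a\circ_nb=c_n$ for all $n\ge0$. Elements $a,b$ commute if their super bracket $[a(z),b(w)]$ vanishes, and quantum commute if $(z-w)^N[a(z),b(w)]=0$ for some $N\ge0$. A vertex algebra is a subspace of $QO(V)$ which contains $1$, is closed under all circle products, and whose elements pairwise quantum commute. A topological vertex algebra (TVA) is a vertex algebra with distinguished elements $L,F,J,G$ such that $L,F$ are even, $J,G$ are odd, $L$ is a Virasoro element of central charge zero, i.e. $L(z)L(w)\sim 2L(w)(z-w)^{-2}+\partial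 L(w)(z-w)^{-1}$, the elements $J$ and $G$ are primary with respect to $L$ of conformal weights $1$ and $2$, the element $F$ is a quasi-primary current of conformal weight one in the sense that $L(z)F(w)\sim k(z-w)^{-3}+F(w)(z-w)^{-2}+\partial F(w)(z-w)^{-1}$ for some scalar $k$, and $$J(z)J(w)\sim0,\quad G(z)G(w)\sim0,\quad J\circ_0G=L,\quad F\circ_0J=J,\quad F\circ_0G=-G.$$ Let $\mathfrak g$ be a finite-dimensional complex Lie algebra with a basis $\xi_1,\dots,\xi_n$ that is orthonormal for the Killing form (so $\mathfrak g$ is semisimple), and let $\xi_1',\dots,\xi_n'$ be the dual basis of $\mathfrak g^*$. Let $\mathcal W(\mathfrak g)$ be the $bc\beta\gamma$ system of $\mathfrak g$, i.e. the vertex algebra generated, on its Fock space, by odd fields $b^{\xi},c^{\xi'}$ and even fields $\beta^{\xi},\gamma^{\xi'}$, linear in $\xi\in\mathfrak g$, $\xi'\in\mathfrak g^*$, with $$b^{\xi}(z)c^{\xi'}(w)\sim\langle\xi',\xi\rangle(z-w)^{-1},\qquad \beta^{\xi}(z)\gamma^{\xi'}(w)\sim\langle\xi',\xi\rangle(z-w)^{-1},$$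 and all other OPEs among generators, apart from those with the two factors interchanged, trivial. Put $$\Theta_{\mathcal E}^{\xi}=\sum_i:\!b^{[\xi,\xi_i]}c^{\xi_i'}\!:,\qquad \Theta_{\mathcal S}^{\xi}=-\sum_i:\!\beta^{[\xi,\xi_i]}\gamma^{\xi_i'}\!:,\qquad \Theta_{\mathcal W}^{\xi}=\Theta_{\mathcal E}^{\xi}+\Theta_{\mathcal S}^{\xi},$$ and let $\mathcal W(\mathfrak g)^{\mathfrak g[t]}$ be the space of all $a\in\mathcal W(\mathfrak g)$ with $\Theta^{\xi}_{\mathcal W}\circ_m a=0$ for all $\xi\in\mathfrak g$ and $m\ge0$. **Theorem.** Define $$L=-\sum_i:\!\Theta^{\xi_i}_{\mathcal S}\Theta^{\xi_i}_{\mathcal S}\!:-\sum_i:\!\Theta^{\xi_i}_{\mathcal W}\Theta^{\xi_i}_{\mathcal W}\!:-\sum_i:\!b^{\xi_i}\partial c^{\xi_i'}\!:,\qquad J=\sum_i:\!\bigl(\Theta^{\xi_i}_{\mathcal S}+\tfrac12\Theta^{\xi_i}_{\mathcal E}\bigr)c^{\xi_i'}\!:,$$ $$G=-\sum_i:\!\bigl(2\Theta^{\xi_i}_{\mathcal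 S}+\Theta^{\xi_i}_{\mathcal E}\bigr)b^{\xi_i}\!:,\qquad F=-\sum_i:\!b^{\xi_i}c^{\xi_i'}\!:.$$ Then $L,J,G,F$ commute with $\Theta^{\xi}_{\mathcal W}$ for every $\xi\in\mathfrak g$, and $\mathcal W(\mathfrak g)^{\mathfrak g[t]}$ is a vertex algebra which contains $L,F,J,G$ and is a topological vertex algebra with these distinguished elements. -/

import Mathlib

open scoped TensorProduct

noncomputable section

/-! ### Super vector spaces and quantum operators -/

/-- A complex super vector space `V = V₀ ⊕ V₁`, recorded by its parity involution: `V₀` and `V₁`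
are the eigenspaces of `parity` with eigenvalues `1` and `-1`. -/
class SuperSpace (V : Type*) [AddCommGroup V] [Module ℂ V] where
  parity : V →ₗ[ℂ] V
  parity_parity : ∀ v, parity (parity v) = v

/-- The space `QO(V)` of all linear maps `V → V((z))`. -/
abbrev QO (V : Type*) [AddCommGroup V] [Module ℂ V] := VertexOperator ℂ V

namespace QO

section Basic

variable {V : Type*} [AddCommGroup V] [Module ℂ V]

/-- The Fourier mode `a(n)`, where `a(z) = ∑ a(n) z^{-n-1}`. -/
def mode (a : QO V) (n : ℤ) : Module.End ℂ V := VertexOperator.ncoeff a n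

theorem mode_add (a b : QO V) (n : ℤ) : mode (a + b) n = mode a n + mode b n := by
  simp [mode]

theorem mode_smul (r : ℂ) (a : QO V) (n : ℤ) : mode (r • a) n = r • mode a n := by
  simp [mode]

theorem mode_zero (n : ℤ) : mode (0 : QO V) n = 0 := by
  simp [mode]

theorem ext_mode {a b : QO V} (h : ∀ n, mode a n = mode b n) : a = b := by
  apply HVertexOperator.coeff_inj
  funext n
  have := h (-n - 1)
  simpa [mode] using this

/-- Every vector is killed by `a(n)` for all sufficiently large `n`. -/
theorem mode_truncated (a : QO V) (v : V) : ∃ N : ℤ, ∀ n ≥ N, mode a n v = 0 := by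
  refine ⟨-HahnSeries.order ((HahnModule.of ℂ).symm (a v)), fun n hn => ?_⟩
  exact VertexOperator.ncoeff_eq_zero_of_lt_order a n v (by lia)

/-- The element of `QO(V)` with prescribed Fourier modes. -/
def ofModes (f : ℤ → Module.End ℂ V) (hf : ∀ v, ∃ N : ℤ, ∀ n ≥ N, f n v = 0) : QO V :=
  VertexOperator.of_coeff (fun k => f (-k - 1)) (fun v => by
    obtain ⟨N, hN⟩ := hf v
    refine ⟨-N, fun k hk => ?_⟩
    by_contra h
    exact hk (hN _ (by lia)))

@[simp]
theorem mode_ofModes (f : ℤ → Module.End ℂ V) (hf : ∀ v, ∃ N : ℤ, ∀ n ≥ N, f n v = 0) (n : ℤ) :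
    mode (ofModes f hf) n = f n := by
  simp [mode, ofModes]

/-- The unit `1(z) = id`. -/
def one : QO V :=
  ofModes (fun n => if n = -1 then LinearMap.id else 0)
    (fun v => ⟨0, fun n hn => by rw [if_neg (by lia)]; rfl⟩)

/-- The formal derivative `∂a(z) = d/dz a(z)`, with modes `(∂a)(n) = -n a(n-1)`. -/
def deriv (a : QO V) : QO V :=
  ofModes (fun n => (-(n : ℂ)) • mode a (n - 1)) (fun v => by
    obtain ⟨N, hN⟩ := mode_truncated a v
    refine ⟨N + 1, fun n hn => ?_⟩
    rw [LinearMap.smul_apply, hN _ (by lia), smul_zero])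

/-- The sum of a sequence of operators which is finite on every vector. -/
def sumEnd (T : ℕ → Module.End ℂ V) (hT : ∀ v, (Function.support fun j => T j v).Finite) :
    Module.End ℂ V where
  toFun v := ∑ᶠ j, T j v
  map_add' u v := by
    simp only [map_add]
    exact finsum_add_distrib (hT u) (hT v)
  map_smul' r v := by
    simp only [map_smul, RingHom.id_apply]
    exact (smul_finsum' r (hT v)).symm

/-- The `j`-th summand in the mode `m` of
`Res_z a(z)b(w) ι_{|z|>|w|}(z-w)^n - ε Res_z b(w)a(z) ι_{|w|>|z|}(z-w)^n`:
expand `(z-w)^n` as `∑ⱼ (-1)^j (n choose j) z^{n-j} w^j` in the first term, and as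
`(-1)^n ∑ⱼ (-1)^j (n choose j) z^j w^{n-j}` in the second. -/
def circTerm (ε : ℂ) (n : ℤ) (a b : QO V) (m : ℤ) (j : ℕ) : Module.End ℂ V :=
  ((-1 : ℂ) ^ j * (Ring.choose n j : ℤ)) •
    (mode a (n - j) * mode b (m + j) - (ε * (-1 : ℂ) ^ n) • (mode b (m + n - j) * mode a j))

theorem circTerm_apply (ε : ℂ) (n : ℤ) (a b : QO V) (m : ℤ) (j : ℕ) (v : V) :
    circTerm ε n a b m j v = ((-1 : ℂ) ^ j * (Ring.choose n j : ℤ)) •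
      (mode a (n - j) (mode b (m + j) v)
        - (ε * (-1 : ℂ) ^ n) • mode b (m + n - j) (mode a j v)) := rfl

theorem circTerm_finite (ε : ℂ) (n : ℤ) (a b : QO V) (m : ℤ) (v : V) :
    (Function.support fun j => circTerm ε n a b m j v).Finite := by
  obtain ⟨N, hN⟩ := mode_truncated b v
  obtain ⟨M, hM⟩ := mode_truncated a v
  refine (Set.finite_Iio (max (N - m).toNat M.toNat)).subset fun j hj => ?_
  by_contra h
  simp only [Set.mem_Iio, not_lt, max_le_iff] at h
  refine hj ?_
  simp only [circTerm_apply]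
  rw [hN (m + j) (by lia), hM j (by lia)]
  simp

theorem circTerm_truncated (ε : ℂ) (n : ℤ) (a b : QO V) (v : V) :
    ∃ N : ℤ, ∀ m ≥ N, sumEnd (circTerm ε n a b m) (circTerm_finite ε n a b m) v = 0 := by
  obtain ⟨N, hN⟩ := mode_truncated b v
  obtain ⟨M, hM⟩ := mode_truncated a v
  choose B hB using fun j : ℕ => mode_truncated b (mode a j v)
  obtain ⟨C, hC⟩ := ((Finset.range M.toNat).image B).bddAbove
  refine ⟨max N (C - n + M.toNat), fun m hm => ?_⟩
  change ∑ᶠ j, circTerm ε n a b m j v = 0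
  refine finsum_eq_zero_of_forall_eq_zero fun j => ?_
  rw [circTerm_apply, hN (m + j) (by lia)]
  have : mode b (m + n - j) (mode a j v) = 0 := by
    by_cases hj : j < M.toNat
    · have := hC (Finset.mem_coe.2 (Finset.mem_image_of_mem B (Finset.mem_range.2 hj)))
      exact hB j _ (by lia)
    · rw [hM j (by lia), map_zero]
  rw [this]
  simp

/-- `Res_z a(z)b(w) ι_{|z|>|w|}(z-w)^n - ε Res_z b(w)a(z) ι_{|w|>|z|}(z-w)^n`. -/
def circAux (ε : ℂ) (n : ℤ) (a b : QO V) : QO V :=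
  ofModes (fun m => sumEnd (circTerm ε n a b m) (circTerm_finite ε n a b m))
    (circTerm_truncated ε n a b)

theorem mode_circAux_apply (ε : ℂ) (n : ℤ) (a b : QO V) (m : ℤ) (v : V) :
    mode (circAux ε n a b) m v = ∑ᶠ j, circTerm ε n a b m j v := by
  simp [circAux, sumEnd]

theorem circAux_add (ε : ℂ) (n : ℤ) (a b b' : QO V) :
    circAux ε n a (b + b') = circAux ε n a b + circAux ε n a b' := by
  refine ext_mode fun m => LinearMap.ext fun v => ?_
  rw [mode_add, LinearMap.add_apply, mode_circAux_apply, mode_circAux_apply, mode_circAux_apply,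
    ← finsum_add_distrib (circTerm_finite ε n a b m v) (circTerm_finite ε n a b' m v)]
  refine finsum_congr fun j => ?_
  simp only [circTerm_apply, mode_add, LinearMap.add_apply, map_add]
  module

theorem circAux_smul (ε : ℂ) (n : ℤ) (r : ℂ) (a b : QO V) :
    circAux ε n a (r • b) = r • circAux ε n a b := by
  refine ext_mode fun m => LinearMap.ext fun v => ?_
  rw [mode_smul, LinearMap.smul_apply, mode_circAux_apply, mode_circAux_apply,
    smul_finsum' r (circTerm_finite ε n a b m v)]
  refine finsum_congr fun j => ?_
  simp only [circTerm_apply, mode_smul, LinearMap.smul_apply, map_smul]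
  module

end Basic

section Super

variable {V : Type*} [AddCommGroup V] [Module ℂ V] [SuperSpace V]

/-- Conjugation of a quantum operator by the parity involution. -/
def conj (a : QO V) : QO V :=
  ofModes (fun n => SuperSpace.parity ∘ₗ mode a n ∘ₗ SuperSpace.parity) (fun v => by
    obtain ⟨N, hN⟩ := mode_truncated a (SuperSpace.parity v)
    refine ⟨N, fun n hn => ?_⟩
    rw [LinearMap.comp_apply, LinearMap.comp_apply, hN n hn, map_zero])

/-- `a` is even: it maps `V_j` to `V_j((z))`. -/
def IsEven (a : QO V) : Prop := conj a = a

/-- `a` is odd: it maps `V_j` to `V_{j+1}((z))`. -/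
def IsOdd (a : QO V) : Prop := conj a = -a

/-- The homogeneous components `a₀` and `a₁` in `a = a₀ + a₁`. -/
def part (i : Fin 2) (a : QO V) : QO V :=
  (1 / 2 : ℂ) • (a + (-1 : ℂ) ^ (i : ℕ) • conj a)

theorem conj_add (a b : QO V) : conj (a + b) = conj a + conj b := by
  refine ext_mode fun n => LinearMap.ext fun v => ?_
  simp [conj, mode_add]

theorem conj_smul (r : ℂ) (a : QO V) : conj (r • a) = r • conj a := by
  refine ext_mode fun n => LinearMap.ext fun v => ?_
  simp [conj, mode_smul]

theorem part_add (i : Fin 2) (a b : QO V) : part i (a + b) = part i a + part i b := by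
  simp only [part, conj_add]
  module

theorem part_smul (i : Fin 2) (r : ℂ) (a : QO V) : part i (r • a) = r • part i a := by
  simp only [part, conj_smul]
  module

/-- The `n`-th circle product `a ∘ₙ b`: the bilinear operation given on homogeneous `a`, `b` by
`Res_z a(z)b(w) ι_{|z|>|w|}(z-w)^n - (-1)^{|a||b|} Res_z b(w)a(z) ι_{|w|>|z|}(z-w)^n`. -/
def circ (n : ℤ) (a b : QO V) : QO V :=
  ∑ i : Fin 2, ∑ j : Fin 2, circAux ((-1 : ℂ) ^ ((i : ℕ) * (j : ℕ))) n (part i a) (part j b)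

theorem circ_add (n : ℤ) (a b b' : QO V) : circ n a (b + b') = circ n a b + circ n a b' := by
  simp only [circ, part_add, circAux_add, Finset.sum_add_distrib]

theorem circ_smul (n : ℤ) (r : ℂ) (a b : QO V) : circ n a (r • b) = r • circ n a b := by
  simp only [circ, part_smul, circAux_smul, Finset.smul_sum]

/-- The Wick product `:a b:`, which is the circle product `a ∘₋₁ b`. -/
def wick (a b : QO V) : QO V := circ (-1) a b

/-- The super bracket `[a(p), b(q)]` of two Fourier modes. -/
def bracket (a b : QO V) (p q : ℤ) : Module.End ℂ V :=
  ∑ i : Fin 2, ∑ j : Fin 2,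
    (mode (part i a) p * mode (part j b) q
      - ((-1 : ℂ) ^ ((i : ℕ) * (j : ℕ))) • (mode (part j b) q * mode (part i a) p))

/-- `a` and `b` commute: `[a(z), b(w)] = 0`. -/
def Commutes (a b : QO V) : Prop := ∀ p q : ℤ, bracket a b p q = 0

/-- `a` and `b` quantum commute: `(z-w)^N [a(z), b(w)] = 0` for some `N ≥ 0`. The sum below is the
coefficient of `z^{-p-1} w^{-q-1}`. -/
def QuantumCommutes (a b : QO V) : Prop :=
  ∃ N : ℕ, ∀ p q : ℤ, ∑ j ∈ Finset.range (N + 1),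
    ((-1 : ℂ) ^ j * (N.choose j : ℂ)) • bracket a b (p + N - j) (q + j) = 0

/-- A quantum operator algebra: a subspace of `QO(V)` which contains `1` and is closed under all
circle products. -/
structure IsQOA (A : Submodule ℂ (QO V)) : Prop where
  one_mem : one ∈ A
  circ_mem : ∀ a ∈ A, ∀ b ∈ A, ∀ n : ℤ, circ n a b ∈ A

/-- A vertex algebra: a commutative quantum operator algebra, that is, one whose elements pairwise
quantum commute. -/
structure IsVertexAlgebra (A : Submodule ℂ (QO V)) : Prop extends IsQOA A where
  quantumCommutes : ∀ a ∈ A, ∀ b ∈ A, QuantumCommutes a b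

/-- The quantum operator algebra generated by a subset of `QO(V)`. -/
def generated (S : Set (QO V)) : Submodule ℂ (QO V) := sInf {A | IsQOA A ∧ S ⊆ A}

/-! ### Topological vertex algebras

An operator product expansion `a(z)b(w) ∼ ∑ cₙ(w) (z-w)^{-n-1}` says that `a ∘ₙ b = cₙ` for all
`n ≥ 0`. -/

/-- `a(z)b(w) ∼ 0`. -/
def TrivialOPE (a b : QO V) : Prop := ∀ n : ℕ, circ n a b = 0

/-- `L` is a Virasoro element of central charge zero:
`L(z)L(w) ∼ 2L(w)(z-w)^{-2} + ∂L(w)(z-w)^{-1}`. -/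
structure IsVirasoroZero (L : QO V) : Prop where
  circ_zero : circ 0 L L = deriv L
  circ_one : circ 1 L L = (2 : ℂ) • L
  circ_ge : ∀ n : ℕ, 2 ≤ n → circ n L L = 0

/-- `a` is primary of conformal weight `Δ` with respect to `L`:
`L(z)a(w) ∼ Δ a(w)(z-w)^{-2} + ∂a(w)(z-w)^{-1}`. -/
structure IsPrimary (L : QO V) (Δ : ℂ) (a : QO V) : Prop where
  circ_zero : circ 0 L a = deriv a
  circ_one : circ 1 L a = Δ • a
  circ_ge : ∀ n : ℕ, 2 ≤ n → circ n L a = 0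

/-- `F` is a quasi-primary current of conformal weight one with respect to `L`, in the sense used
for ghost number currents, where a scalar anomaly `k` is allowed:
`L(z)F(w) ∼ k (z-w)^{-3} + F(w)(z-w)^{-2} + ∂F(w)(z-w)^{-1}`. -/
structure IsQuasiPrimaryCurrent (L F : QO V) : Prop where
  circ_zero : circ 0 L F = deriv F
  circ_one : circ 1 L F = F
  circ_two : ∃ k : ℂ, circ 2 L F = k • one
  circ_ge : ∀ n : ℕ, 3 ≤ n → circ n L F = 0

/-- The vertex algebra `A` with the distinguished elements `L`, `F`, `J`, `G` is a topological
vertex algebra. -/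
structure IsTVA (A : Submodule ℂ (QO V)) (L F J G : QO V) : Prop where
  vertexAlgebra : IsVertexAlgebra A
  L_mem : L ∈ A
  F_mem : F ∈ A
  J_mem : J ∈ A
  G_mem : G ∈ A
  L_even : IsEven L
  F_even : IsEven F
  J_odd : IsOdd J
  G_odd : IsOdd G
  L_virasoro : IsVirasoroZero L
  F_quasiPrimary : IsQuasiPrimaryCurrent L F
  J_primary : IsPrimary L 1 J
  G_primary : IsPrimary L 2 G
  J_J : TrivialOPE J J
  G_G : TrivialOPE G G
  J_G : circ 0 J G = L
  F_J : circ 0 F J = J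
  F_G : circ 0 F G = -G

end Super

end QO

/-! ### Derivations of a symmetric algebra -/

section SymDeriv

variable {M : Type*} [AddCommGroup M] [Module ℂ M]

/-- The algebra homomorphism `m ↦ m + d(m) ε` from `Sym M` to the dual numbers over `Sym M`. -/
def symDual (d : Module.Dual ℂ M) :
    SymmetricAlgebra ℂ M →ₐ[ℂ] TrivSqZeroExt (SymmetricAlgebra ℂ M) (SymmetricAlgebra ℂ M) :=
  SymmetricAlgebra.lift
    ((TrivSqZeroExt.inlAlgHom ℂ (SymmetricAlgebra ℂ M) (SymmetricAlgebra ℂ M)).toLinearMap ∘ₗ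
        SymmetricAlgebra.ι ℂ M +
      ((TrivSqZeroExt.inrHom (SymmetricAlgebra ℂ M) (SymmetricAlgebra ℂ M)).restrictScalars ℂ) ∘ₗ
        LinearMap.smulRight d (1 : SymmetricAlgebra ℂ M))

/-- The derivation of the symmetric algebra of `M` which extends a linear functional `d` on `M`,
as the `ε`-part of `symDual d`. -/
def symDeriv (d : Module.Dual ℂ M) : Module.End ℂ (SymmetricAlgebra ℂ M) :=
  ((TrivSqZeroExt.sndHom (SymmetricAlgebra ℂ M) (SymmetricAlgebra ℂ M)).restrictScalars ℂ) ∘ₗ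
    (symDual d).toLinearMap

theorem symDeriv_apply (d : Module.Dual ℂ M) (x : SymmetricAlgebra ℂ M) :
    symDeriv d x = (symDual d x).snd := rfl

theorem fst_symDual (d : Module.Dual ℂ M) (x : SymmetricAlgebra ℂ M) :
    (symDual d x).fst = x := by
  have h : (TrivSqZeroExt.fstHom ℂ (SymmetricAlgebra ℂ M) (SymmetricAlgebra ℂ M)).comp
      (symDual d) = AlgHom.id ℂ _ := by
    apply SymmetricAlgebra.algHom_ext
    ext m
    simp [symDual]
  exact congrArg (fun f : SymmetricAlgebra ℂ M →ₐ[ℂ] SymmetricAlgebra ℂ M => f x) h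

theorem symDeriv_ι (d : Module.Dual ℂ M) (m : M) :
    symDeriv d (SymmetricAlgebra.ι ℂ M m) = algebraMap ℂ _ (d m) := by
  simp [symDeriv_apply, symDual, Algebra.algebraMap_eq_smul_one]

theorem symDeriv_algebraMap (d : Module.Dual ℂ M) (r : ℂ) :
    symDeriv d (algebraMap ℂ _ r) = 0 := by
  rw [symDeriv_apply, AlgHom.commutes, TrivSqZeroExt.algebraMap_eq_inl']
  simp

theorem symDeriv_mul (d : Module.Dual ℂ M) (x y : SymmetricAlgebra ℂ M) :
    symDeriv d (x * y) = x * symDeriv d y + y * symDeriv d x := by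
  simp [symDeriv_apply, fst_symDual, mul_comm]

end SymDeriv

/-! ### The semi-infinite Weil algebra -/

namespace Weil

section Fock

variable (g : Type*) [LieRing g] [LieAlgebra ℂ g]

/-- The space `⨁_{k ≥ 0} (g ⊕ g*)` of creation modes: `Finsupp.single k (x, φ)` stands for the
modes with index `-k-1` of the generators attached to `x ∈ g` and `φ ∈ g*`. -/
abbrev Modes := ℕ →₀ (g × Module.Dual ℂ g)

/-- The Fock space of the `bcβγ` system: the exterior algebra on the creation modes of `b`, `c`
tensored with the symmetric algebra on the creation modes of `β`, `γ`. -/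
abbrev Fock := ExteriorAlgebra ℂ (Modes g) ⊗[ℂ] SymmetricAlgebra ℂ (Modes g)

/-- The parity on the Fock space is the parity of the exterior degree. -/
instance : SuperSpace (Fock g) where
  parity := LinearMap.rTensor _ (CliffordAlgebra.involute (Q := (0 : QuadraticForm ℂ (Modes g)))
    |>.toLinearMap)
  parity_parity v := by
    rw [← LinearMap.comp_apply, ← LinearMap.rTensor_comp]
    have : (CliffordAlgebra.involute (Q := (0 : QuadraticForm ℂ (Modes g)))).toLinearMap ∘ₗ
        (CliffordAlgebra.involute (Q := (0 : QuadraticForm ℂ (Modes g)))).toLinearMap =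
        LinearMap.id := by
      ext x
      simp
    rw [this]
    simp

variable {g}

/-- The functional on creation modes which pairs the component of index `k` with
`u ∈ g ⊕ g*` through `⟨(x, φ), (y, ψ)⟩ = ψ(x) + s φ(y)`. -/
def pairing (s : ℂ) (u : g × Module.Dual ℂ g) (k : ℕ) : Module.Dual ℂ (Modes g) where
  toFun m := (m k).2 u.1 + s * u.2 (m k).1
  map_add' m m' := by
    simp
    ring
  map_smul' r m := by
    simp
    ring

/-- The modes of the `βγ` generators on the symmetric algebra: a mode of index `-k-1 < 0`
multiplies by a creation mode, and a mode of index `k ≥ 0` differentiates. -/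
def modeS (u : g × Module.Dual ℂ g) : ℤ → Module.End ℂ (SymmetricAlgebra ℂ (Modes g))
  | Int.ofNat k => symDeriv (pairing (-1) u k)
  | Int.negSucc k => LinearMap.mulLeft ℂ (SymmetricAlgebra.ι ℂ (Modes g) (Finsupp.single k u))

/-- The modes of the `bc` generators on the exterior algebra: a mode of index `-k-1 < 0`
multiplies by a creation mode, and a mode of index `k ≥ 0` contracts. -/
def modeE (u : g × Module.Dual ℂ g) : ℤ → Module.End ℂ (ExteriorAlgebra ℂ (Modes g))
  | Int.ofNat k => CliffordAlgebra.contractLeft (pairing 1 u k)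
  | Int.negSucc k => LinearMap.mulLeft ℂ (ExteriorAlgebra.ι ℂ (Finsupp.single k u))

theorem pairing_eventually (s : ℂ) (u : g × Module.Dual ℂ g) (m : Modes g) :
    ∃ N : ℕ, ∀ k ≥ N, pairing s u k m = 0 := by
  obtain ⟨N, hN⟩ := m.support.bddAbove
  refine ⟨N + 1, fun k hk => ?_⟩
  have : m k = 0 := by
    by_contra h
    have := hN (Finset.mem_coe.2 (Finsupp.mem_support_iff.2 h))
    lia
  simp [pairing, this]

theorem modeS_eventually (u : g × Module.Dual ℂ g) (x : SymmetricAlgebra ℂ (Modes g)) :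
    ∃ N : ℕ, ∀ k ≥ N, symDeriv (pairing (-1) u k) x = 0 := by
  induction x using SymmetricAlgebra.induction with
  | algebraMap r => exact ⟨0, fun k _ => symDeriv_algebraMap _ r⟩
  | ι m =>
    obtain ⟨N, hN⟩ := pairing_eventually (-1) u m
    exact ⟨N, fun k hk => by rw [symDeriv_ι, hN k hk, map_zero]⟩
  | mul a b ha hb =>
    obtain ⟨N, hN⟩ := ha
    obtain ⟨M, hM⟩ := hb
    refine ⟨max N M, fun k hk => ?_⟩
    rw [symDeriv_mul, hN k (by lia), hM k (by lia)]
    simp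
  | add a b ha hb =>
    obtain ⟨N, hN⟩ := ha
    obtain ⟨M, hM⟩ := hb
    refine ⟨max N M, fun k hk => ?_⟩
    rw [map_add, hN k (by lia), hM k (by lia), add_zero]

theorem modeE_eventually (u : g × Module.Dual ℂ g) (x : ExteriorAlgebra ℂ (Modes g)) :
    ∃ N : ℕ, ∀ k ≥ N, CliffordAlgebra.contractLeft (pairing 1 u k) x = 0 := by
  induction x using CliffordAlgebra.left_induction with
  | algebraMap r => exact ⟨0, fun k _ => CliffordAlgebra.contractLeft_algebraMap _ _ r⟩
  | add a b ha hb =>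
    obtain ⟨N, hN⟩ := ha
    obtain ⟨M, hM⟩ := hb
    refine ⟨max N M, fun k hk => ?_⟩
    rw [map_add, hN k (by lia), hM k (by lia), add_zero]
  | ι_mul x m hx =>
    obtain ⟨N, hN⟩ := hx
    obtain ⟨M, hM⟩ := pairing_eventually 1 u m
    refine ⟨max N M, fun k hk => ?_⟩
    rw [CliffordAlgebra.contractLeft_ι_mul, hN k (by lia), hM k (by lia)]
    simp

/-- The even fields of the `βγ` system. -/
def fieldS (u : g × Module.Dual ℂ g) : QO (Fock g) :=
  QO.ofModes (fun n => LinearMap.lTensor _ (modeS u n)) (fun v => by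
    induction v using TensorProduct.induction_on with
    | zero => exact ⟨0, fun n _ => map_zero _⟩
    | tmul x y =>
      obtain ⟨N, hN⟩ := modeS_eventually u y
      refine ⟨N, fun n hn => ?_⟩
      obtain ⟨k, rfl⟩ := Int.eq_ofNat_of_zero_le (a := n) (by lia)
      rw [LinearMap.lTensor_tmul]
      change x ⊗ₜ[ℂ] symDeriv (pairing (-1) u k) y = 0
      rw [hN k (by lia), TensorProduct.tmul_zero]
    | add x y hx hy =>
      obtain ⟨N, hN⟩ := hx
      obtain ⟨M, hM⟩ := hy
      refine ⟨max N M, fun n hn => ?_⟩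
      rw [map_add, hN n (by lia), hM n (by lia), add_zero])

/-- The odd fields of the `bc` system. -/
def fieldE (u : g × Module.Dual ℂ g) : QO (Fock g) :=
  QO.ofModes (fun n => LinearMap.rTensor _ (modeE u n)) (fun v => by
    induction v using TensorProduct.induction_on with
    | zero => exact ⟨0, fun n _ => map_zero _⟩
    | tmul x y =>
      obtain ⟨N, hN⟩ := modeE_eventually u x
      refine ⟨N, fun n hn => ?_⟩
      obtain ⟨k, rfl⟩ := Int.eq_ofNat_of_zero_le (a := n) (by lia)
      rw [LinearMap.rTensor_tmul]
      change (CliffordAlgebra.contractLeft (pairing 1 u k) x) ⊗ₜ[ℂ] y = 0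
      rw [hN k (by lia), TensorProduct.zero_tmul]
    | add x y hx hy =>
      obtain ⟨N, hN⟩ := hx
      obtain ⟨M, hM⟩ := hy
      refine ⟨max N M, fun n hn => ?_⟩
      rw [map_add, hN n (by lia), hM n (by lia), add_zero])

/-- The odd generator `b^x`, `x ∈ g`. -/
def b (x : g) : QO (Fock g) := fieldE (x, 0)

/-- The odd generator `c^φ`, `φ ∈ g*`. -/
def c (φ : Module.Dual ℂ g) : QO (Fock g) := fieldE (0, φ)

/-- The even generator `β^x`, `x ∈ g`. -/
def β (x : g) : QO (Fock g) := fieldS (x, 0)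

/-- The even generator `γ^φ`, `φ ∈ g*`. -/
def γ (φ : Module.Dual ℂ g) : QO (Fock g) := fieldS (0, φ)

variable (g) in
/-- The semi-infinite Weil algebra `W(g) = E(g) ⊗ S(g)`, generated by `b^x`, `c^φ`, `β^x`, `γ^φ`. -/
def W : Submodule ℂ (QO (Fock g)) :=
  QO.generated (Set.range (b (g := g)) ∪ Set.range (c (g := g)) ∪
    Set.range (β (g := g)) ∪ Set.range (γ (g := g)))

end Fock

section Theta

variable {g : Type*} [LieRing g] [LieAlgebra ℂ g] {ι : Type*} [Fintype ι]
  (ξ : Module.Basis ι ℂ g)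

/-- `Θ_E^x = ∑ᵢ :b^{[x, ξᵢ]} c^{ξᵢ'}:`, where `ξᵢ'` is the dual basis of `ξᵢ`. -/
def ThetaE (x : g) : QO (Fock g) := ∑ i, QO.wick (b ⁅x, ξ i⁆) (c (ξ.coord i))

/-- `Θ_S^x = -∑ᵢ :β^{[x, ξᵢ]} γ^{ξᵢ'}:`. -/
def ThetaS (x : g) : QO (Fock g) := -∑ i, QO.wick (β ⁅x, ξ i⁆) (γ (ξ.coord i))

/-- `Θ_W^x = Θ_E^x + Θ_S^x`. -/
def ThetaW (x : g) : QO (Fock g) := ThetaE ξ x + ThetaS ξ x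

/-- The invariant subalgebra `W(g)^{g[t]}`, where `x tⁿ` acts on `W(g)` by `Θ_W^x ∘ₙ`, `n ≥ 0`. -/
def invariants : Submodule ℂ (QO (Fock g)) where
  carrier := {a | a ∈ W g ∧ ∀ (x : g) (n : ℕ), QO.circ n (ThetaW ξ x) a = 0}
  add_mem' ha ha' :=
    ⟨add_mem ha.1 ha'.1, fun x n => by rw [QO.circ_add, ha.2, ha'.2, add_zero]⟩
  zero_mem' := ⟨zero_mem _, fun x n => by
    simpa using QO.circ_smul n (0 : ℂ) (ThetaW ξ x) 0⟩
  smul_mem' r _ ha := ⟨Submodule.smul_mem _ r ha.1, fun x n => by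
    rw [QO.circ_smul, ha.2, smul_zero]⟩

/-- `L = -∑ᵢ :Θ_S^{ξᵢ} Θ_S^{ξᵢ}: - ∑ᵢ :Θ_W^{ξᵢ} Θ_W^{ξᵢ}: - ∑ᵢ :b^{ξᵢ} ∂c^{ξᵢ'}:`. -/
def L : QO (Fock g) :=
  -(∑ i, QO.wick (ThetaS ξ (ξ i)) (ThetaS ξ (ξ i)))
    - (∑ i, QO.wick (ThetaW ξ (ξ i)) (ThetaW ξ (ξ i)))
    - ∑ i, QO.wick (b (ξ i)) (QO.deriv (c (ξ.coord i)))

/-- `J = ∑ᵢ :(Θ_S^{ξᵢ} + ½ Θ_E^{ξᵢ}) c^{ξᵢ'}:`. -/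
def J : QO (Fock g) :=
  ∑ i, QO.wick (ThetaS ξ (ξ i) + (1 / 2 : ℂ) • ThetaE ξ (ξ i)) (c (ξ.coord i))

/-- `G = -∑ᵢ :(2 Θ_S^{ξᵢ} + Θ_E^{ξᵢ}) b^{ξᵢ}:`. -/
def G : QO (Fock g) :=
  -∑ i, QO.wick ((2 : ℂ) • ThetaS ξ (ξ i) + ThetaE ξ (ξ i)) (b (ξ i))

/-- `F = -∑ᵢ :b^{ξᵢ} c^{ξᵢ'}:`. -/
def F : QO (Fock g) := -∑ i, QO.wick (b (ξ i)) (c (ξ.coord i))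

end Theta

end Weil

end

/-! Why the theorem holds. The plan is to replace operators by vectors of the Fock space. For an
algebra generated by mutually local homogeneous fields that annihilate a vacuum with their
nonnegative modes, are covariant under a translation operator killing the vacuum, and generate the
whole space from the vacuum, an element `a` is determined by its state `a(-1) vac`
(`isStateSpace_generated`). Moreover `(a ∘ₙ b)(-1) vac = a(n) b(-1) vac` (`state_circ`), so an
operator product is computed by applying modes to one vector, and the commutator formula turns it
back into relations between modes. Dong's lemma (`isLocal_circAux`) gives locality of everything
generated.

The Killing form identifies `g*` with `g`, so that the dual basis becomes the basis itself and `b`,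
`c` enter symmetrically. The currents `S = Θ_S` and `E = Θ_E` are commuting affine currents of
levels `-1` and `1` with respect to the Killing form, the level being a trace of two adjoint
operators (`bilinear_current_comm`). Hence `W = E + S` has level `0`. These relations are collected
in `GhostSystem`, which is symmetric under exchange of `b` and `c`.

In these terms `2J = ∑ :(S + W) c:` and `-G = ∑ :(S + W) b:`, so every statement about `J` has a
mirror for `G`. Invariance under `W` (`W_brst`) is ad-invariance of `∑ ξᵢ ⊗ ξᵢ`, together with a
cancellation between the level `-1` of `S` and the eigenvalue `1` of the Casimir element on the
adjoint representation. That `J` has trivial operator product with itself (`K_brst_self`) uses the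
same Casimir identity and the Jacobi identity for the cubic ghost terms. The product of `J` with `G`
has `L`, `F` and the scalar `dim g` as its coefficients (`K_brst_swap`), and `F` measures the ghost
number, `1` on `J` and `-1` on `G` (`F_brst`).

All remaining axioms are formal consequences of these products (`isTVA_of_ope`), since `L(n)` is the
anticommutator of `J(0)` with `G(n)`, where `J` and `G` have anticommuting modes. The commutant of
the even currents `W` is a vertex algebra (`isVertexAlgebra_commutant`); it contains `J`, `G` and
`F` by direct computation, and `L` because `L = J ∘₀ G`. -/

noncomputable section

/-! ### Difference calculus in two and three integer variables -/

namespace Diff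

open Finset

variable {X Y : Type*} [AddCommGroup X] [Module ℂ X] [AddCommGroup Y] [Module ℂ Y]

/-- The operator on sequences of coefficients which corresponds to multiplication by `z - w`. -/
def D : Module.End ℂ (ℤ → ℤ → X) where
  toFun f p q := f (p + 1) q - f p (q + 1)
  map_add' f g := by
    funext p q
    simp only [Pi.add_apply]
    abel
  map_smul' r f := by
    funext p q
    simp [smul_sub]

theorem D_apply (f : ℤ → ℤ → X) (p q : ℤ) : D f p q = f (p + 1) q - f p (q + 1) := rfl

theorem D_pow_succ_apply (N : ℕ) (f : ℤ → ℤ → X) : (D ^ (N + 1)) f = D ((D ^ N) f) := by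
  rw [pow_succ', Module.End.mul_apply]

theorem D_pow_succ_apply' (N : ℕ) (f : ℤ → ℤ → X) : (D ^ (N + 1)) f = (D ^ N) (D f) := by
  rw [pow_succ, Module.End.mul_apply]

theorem D_pow_eq_zero_of_le {N M : ℕ} (h : N ≤ M) {f : ℤ → ℤ → X} (hf : (D ^ N) f = 0) :
    (D ^ M) f = 0 := by
  obtain ⟨k, rfl⟩ := Nat.exists_eq_add_of_le' h
  rw [pow_add, Module.End.mul_apply, hf, map_zero]

theorem D_pow_map (φ : X →ₗ[ℂ] Y) (α β : ℤ) (N : ℕ) (f : ℤ → ℤ → X) :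
    (D ^ N) (fun p q => φ (f (p + α) (q + β))) = fun p q => φ ((D ^ N) f (p + α) (q + β)) := by
  induction N with
  | zero => rfl
  | succ N ih =>
    rw [D_pow_succ_apply, ih, D_pow_succ_apply]
    funext p q
    simp only [D_apply, map_sub]
    rw [add_right_comm p 1 α, add_right_comm q 1 β]

theorem D_pow_apply (N : ℕ) (f : ℤ → ℤ → X) (p q : ℤ) :
    (D ^ N) f p q =
      ∑ j ∈ range (N + 1), ((-1 : ℂ) ^ j * (N.choose j : ℂ)) • f (p + N - j) (q + j) := by
  induction N generalizing p q with
  | zero => simp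
  | succ N ih =>
    rw [D_pow_succ_apply, D_apply, ih, ih, sum_range_succ' _ (N + 1), sum_range_succ' _ N,
      sum_range_succ _ (N : ℕ), sum_range_succ _ N]
    have key : ∀ j ∈ range N,
        ((-1 : ℂ) ^ (j + 1) * ((N + 1).choose (j + 1) : ℂ)) •
          f (p + (N + 1 : ℕ) - (j + 1 : ℕ)) (q + (j + 1 : ℕ)) =
        ((-1 : ℂ) ^ (j + 1) * (N.choose (j + 1) : ℂ)) •
          f (p + 1 + N - (j + 1 : ℕ)) (q + (j + 1 : ℕ)) -
        ((-1 : ℂ) ^ j * (N.choose j : ℂ)) • f (p + N - j) (q + 1 + j) := by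
      intro j _
      rw [Nat.choose_succ_succ]
      have h1 : p + 1 + (N : ℤ) - (j + 1 : ℕ) = p + N - j := by push_cast; ring
      have h2 : p + ((N + 1 : ℕ) : ℤ) - (j + 1 : ℕ) = p + N - j := by push_cast; ring
      have h3 : q + 1 + (j : ℤ) = q + (j + 1 : ℕ) := by push_cast; ring
      rw [h1, h2, h3]
      push_cast
      module
    rw [sum_congr rfl key, sum_sub_distrib]
    have h1 : p + ((N + 1 : ℕ) : ℤ) - (N + 1 : ℕ) = p + N - N := by push_cast; ring
    have h3 : q + 1 + (N : ℤ) = q + (N + 1 : ℕ) := by push_cast; ring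
    have h4 : p + 1 + (N : ℤ) - (0 : ℕ) = p + (N + 1 : ℕ) - (0 : ℕ) := by push_cast; ring
    rw [h1, h3, h4]
    simp only [Nat.choose_self, Nat.choose_zero_right]
    module

/-- A function killed by a power of `z - w` is determined by its values `(D ^ k) f 0`. -/
theorem taylor (N : ℕ) (f : ℤ → ℤ → X) (hf : (D ^ N) f = 0) (p q : ℤ) :
    f p q = ∑ k ∈ range N, ((Ring.choose p k : ℤ) : ℂ) • (D ^ k) f 0 (p + q - k) := by
  induction N generalizing f p q with
  | zero =>
    have h : f = 0 := by simpa using hf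
    simp [h]
  | succ N ih =>
    have hg := ih (D f) (by rw [← D_pow_succ_apply', hf])
    -- The error of the expansion. It vanishes at `p = 0`, because only the term `k = 0` survives
    -- there, and by Pascal's rule and the expansion of `D f` it is constant along `p + q = const`;
    -- hence it is zero.
    set h : ℤ → ℤ → X := fun p q => f p q -
      ∑ k ∈ range (N + 1), ((Ring.choose p k : ℤ) : ℂ) • (D ^ k) f 0 (p + q - k) with hh
    have h0 : ∀ q, h 0 q = 0 := by
      intro q
      simp only [hh]
      rw [sum_range_succ', sum_eq_zero]
      · simp
      · intro k _
        rw [Ring.choose_zero_succ]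
        simp
    have hs : ∀ p q, h (p + 1) q = h p (q + 1) := by
      intro p q
      have h1 := hg p q
      rw [D_apply] at h1
      rw [← sub_eq_zero]
      simp only [hh]
      rw [sub_sub_sub_comm, h1, ← sum_sub_distrib, sum_range_succ', sub_eq_zero]
      have e : p + 1 + q = p + (q + 1) := by ring
      have : ∀ k ∈ range N, ((Ring.choose p k : ℤ) : ℂ) • (D ^ k) (D f) 0 (p + q - k) =
          ((Ring.choose (p + 1) (k + 1) : ℤ) : ℂ) •
            (D ^ (k + 1)) f 0 (p + 1 + q - (k + 1 : ℕ)) -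
          ((Ring.choose p (k + 1) : ℤ) : ℂ) •
            (D ^ (k + 1)) f 0 (p + (q + 1) - (k + 1 : ℕ)) := by
        intro k _
        rw [Ring.choose_succ_succ, ← D_pow_succ_apply', e]
        have e2 : p + (q + 1) - ((k + 1 : ℕ) : ℤ) = p + q - k := by push_cast; ring
        rw [e2]
        push_cast
        module
      rw [sum_congr rfl this, e]
      simp
    have hz : ∀ p q, h p q = 0 := by
      intro p
      induction p using Int.induction_on with
      | zero => exact h0
      | succ i hi => intro q; rw [hs, hi]
      | pred i hi =>
        intro q
        have := hs (-i - 1) (q - 1)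
        rw [sub_add_cancel, sub_add_cancel, hi] at this
        exact this.symm
    exact sub_eq_zero.1 (hz p q)

/-- Multiplication by the difference of the last two of three variables. -/
def D23 : Module.End ℂ (ℤ → ℤ → ℤ → X) where
  toFun f p := D (f p)
  map_add' f g := by funext p; simp
  map_smul' r f := by funext p; simp

/-- Multiplication by the difference of the outer two of three variables. -/
def D13 : Module.End ℂ (ℤ → ℤ → ℤ → X) where
  toFun f p q r := D (fun p r => f p q r) p r
  map_add' f g := by
    funext p q r
    simp only [D_apply, Pi.add_apply]
    abel
  map_smul' r f := by
    funext p q r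
    simp [D_apply, smul_sub]

theorem D23_pow_apply (N : ℕ) (f : ℤ → ℤ → ℤ → X) (p : ℤ) : (D23 ^ N) f p = (D ^ N) (f p) := by
  induction N generalizing f with
  | zero => rfl
  | succ N ih => rw [pow_succ, Module.End.mul_apply, ih, D_pow_succ_apply']; rfl

theorem D13_pow_apply (N : ℕ) (f : ℤ → ℤ → ℤ → X) (p q r : ℤ) :
    (D13 ^ N) f p q r = (D ^ N) (fun p r => f p q r) p r := by
  induction N generalizing f with
  | zero => rfl
  | succ N ih => rw [pow_succ, Module.End.mul_apply, ih, D_pow_succ_apply']; rfl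

theorem D13_eq : (D13 : Module.End ℂ (ℤ → ℤ → ℤ → X)) = D (X := ℤ → X) + D23 := by
  ext f p q r
  change f (p + 1) q r - f p q (r + 1) =
    (f (p + 1) q r - f p (q + 1) r) + (f p (q + 1) r - f p q (r + 1))
  abel

theorem commute_D_D23 : Commute (D (X := ℤ → X)) D23 := by
  ext f p q r
  change (f (p + 1) (q + 1) r - f (p + 1) q (r + 1)) - (f p (q + 1 + 1) r - f p (q + 1) (r + 1)) =
    (f (p + 1) (q + 1) r - f p (q + 1 + 1) r) - (f (p + 1) q (r + 1) - f p (q + 1) (r + 1))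
  abel

/-- The algebraic core of Dong's lemma, with `x`, `y`, `x + y` in the roles of `z₁ - z₂`, `z₂ - z₃`,
`z₁ - z₃`. Writing `y = (x + y) - x` and expanding `y ^ (k + N)`, every term contains either `(x +
y) ^ N` or `x ^ k`, and each of these kills `y ^ N s`. -/
theorem exists_pow_apply_eq_zero {x y : Module.End ℂ X} (hxy : Commute x y) {s : X} {k N : ℕ}
    (h1 : (x ^ k) s = 0) (h2 : ((x + y) ^ N) ((y ^ N) s) = 0) : ∃ M, (y ^ M) s = 0 := by
  refine ⟨(k + N) + N, ?_⟩
  have hc : Commute (x + y) (-x) := ((Commute.refl x).add_left hxy.symm).neg_right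
  have hy : y = (x + y) + -x := by abel
  rw [pow_add, Module.End.mul_apply]
  nth_rewrite 1 [hy]
  rw [hc.add_pow, LinearMap.sum_apply]
  refine sum_eq_zero fun m _ => ?_
  rw [← (Nat.cast_commute ((k + N).choose m) _).eq, Module.End.mul_apply]
  suffices h : ((x + y) ^ m * (-x) ^ (k + N - m)) ((y ^ N) s) = 0 by rw [h, map_zero]
  by_cases hm : N ≤ m
  · rw [(hc.pow_pow _ _).eq, Module.End.mul_apply]
    obtain ⟨d, rfl⟩ := Nat.exists_eq_add_of_le' hm
    rw [pow_add, Module.End.mul_apply, h2, map_zero, map_zero]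
  · have : ∃ d, k + N - m = d + k := ⟨N - m, by lia⟩
    obtain ⟨d, hd⟩ := this
    rw [hd, Module.End.mul_apply, pow_add, Module.End.mul_apply]
    have h3 : ((-x) ^ k) ((y ^ N) s) = 0 := by
      rw [neg_pow, Module.End.mul_apply, ← Module.End.mul_apply (x ^ k), (hxy.pow_pow k N).eq,
        Module.End.mul_apply, h1, map_zero, map_zero]
    rw [h3, map_zero, map_zero]

variable {Z : Type*} [AddCommGroup Z] [Module ℂ Z]

-- A circle product is a limit of finite sums only in the sense that each coefficient on each vector
-- stabilises. Multiplication by a power of a difference of variables involves finitely many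
-- coefficients, so it respects such limits.
open Filter in
theorem D13_D23_eventually (N M : ℕ) (f : ℤ → ℤ → ℤ → Z →ₗ[ℂ] X) (F : ℕ → ℤ → ℤ → ℤ → Z →ₗ[ℂ] X)
    (h : ∀ p q r v, ∀ᶠ K in atTop, f p q r v = F K p q r v) (p q r : ℤ) (v : Z) :
    ∀ᶠ K in atTop, (D13 ^ N) ((D23 ^ M) f) p q r v = (D13 ^ N) ((D23 ^ M) (F K)) p q r v := by
  have h1 : ∀ (M : ℕ) p q r v,
      ∀ᶠ K in atTop, (D23 ^ M) f p q r v = (D23 ^ M) (F K) p q r v := by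
    intro M
    induction M with
    | zero => exact h
    | succ M ih =>
      intro p q r v
      filter_upwards [ih p (q + 1) r v, ih p q (r + 1) v] with K hK1 hK2
      simp only [pow_succ', Module.End.mul_apply]
      change ((D23 ^ M) f p (q + 1) r - (D23 ^ M) f p q (r + 1)) v =
        ((D23 ^ M) (F K) p (q + 1) r - (D23 ^ M) (F K) p q (r + 1)) v
      rw [LinearMap.sub_apply, LinearMap.sub_apply, hK1, hK2]
  induction N generalizing p q r v with
  | zero => exact h1 M p q r v
  | succ N ih =>
    filter_upwards [ih (p + 1) q r v, ih p q (r + 1) v] with K hK1 hK2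
    simp only [pow_succ', Module.End.mul_apply]
    change ((D13 ^ N) ((D23 ^ M) f) (p + 1) q r - (D13 ^ N) ((D23 ^ M) f) p q (r + 1)) v =
      ((D13 ^ N) ((D23 ^ M) (F K)) (p + 1) q r - (D13 ^ N) ((D23 ^ M) (F K)) p q (r + 1)) v
    rw [LinearMap.sub_apply, LinearMap.sub_apply, hK1, hK2]

end Diff

/-! ### Circle products: recursion, parity, commutators -/

namespace QO

open Finset Filter Diff

section Basic

variable {V : Type*} [AddCommGroup V] [Module ℂ V]

theorem mode_neg (a : QO V) (n : ℤ) : mode (-a) n = -mode a n := by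
  rw [← neg_one_smul ℂ, mode_smul, neg_one_smul]

theorem mode_sub (a b : QO V) (n : ℤ) : mode (a - b) n = mode a n - mode b n := by
  rw [sub_eq_add_neg, mode_add, mode_neg, sub_eq_add_neg]

theorem mode_sum {κ : Type*} (s : Finset κ) (a : κ → QO V) (n : ℤ) :
    mode (∑ i ∈ s, a i) n = ∑ i ∈ s, mode (a i) n := by
  induction s using Finset.cons_induction with
  | empty => exact mode_zero n
  | cons k s hk ih => rw [sum_cons, sum_cons, mode_add, ih]

theorem eq_zero_of_eq_neg {v : V} (h : v = -v) : v = 0 := by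
  have h2 : (2 : ℂ) • v = 0 := by
    rw [two_smul]
    nth_rewrite 1 [h]
    exact neg_add_cancel v
  exact (smul_eq_zero.1 h2).resolve_left two_ne_zero

/-- The operator `z^p a(z)`. -/
def shift (p : ℤ) (a : QO V) : QO V :=
  ofModes (fun n => mode a (n + p)) (fun v => by
    obtain ⟨N, hN⟩ := mode_truncated a v
    exact ⟨N - p, fun n hn => hN _ (by lia)⟩)

@[simp]
theorem mode_shift (p : ℤ) (a : QO V) (n : ℤ) : mode (shift p a) n = mode a (n + p) := by
  simp [shift]

theorem shift_zero (a : QO V) : shift 0 a = a := ext_mode fun n => by simp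

theorem shift_shift (p q : ℤ) (a : QO V) : shift p (shift q a) = shift (p + q) a :=
  ext_mode fun n => by simp [add_assoc]

theorem circAux_eventually (ε : ℂ) (n : ℤ) (a b : QO V) (m : ℤ) (v : V) :
    ∀ᶠ K in atTop, mode (circAux ε n a b) m v = ∑ j ∈ range K, circTerm ε n a b m j v := by
  obtain ⟨K, hK⟩ := (circTerm_finite ε n a b m v).bddAbove
  filter_upwards [eventually_ge_atTop (K + 1)] with M hM
  rw [mode_circAux_apply]
  refine finsum_eq_sum_of_support_subset _ fun j hj => ?_
  have := hK hj
  simp only [coe_range, Set.mem_Iio]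
  lia

theorem eventually_mode_eq_zero (a : QO V) (s : ℤ) (v : V) :
    ∀ᶠ K : ℕ in atTop, mode a (s + K) v = 0 := by
  obtain ⟨N, hN⟩ := mode_truncated a v
  filter_upwards [eventually_ge_atTop (N - s).toNat] with K hK
  exact hN _ (by lia)

/-- The recursion `(z-w)^{n+1} = z (z-w)^n - (z-w)^n w`. -/
theorem mode_circAux_succ (ε : ℂ) (n : ℤ) (a b : QO V) (m : ℤ) :
    mode (circAux ε (n + 1) a b) m =
      mode (circAux ε n (shift 1 a) b) m - mode (circAux ε n a b) (m + 1) := by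
  ext v
  obtain ⟨K, h1, h2, h3, h4, h5⟩ := ((circAux_eventually ε (n + 1) a b m v).and
    ((circAux_eventually ε n (shift 1 a) b m v).and
    ((circAux_eventually ε n a b (m + 1) v).and
    ((eventually_mode_eq_zero a 0 v).and (eventually_mode_eq_zero b m v))))).exists
  rw [LinearMap.sub_apply, h1, h2, h3, ← sub_eq_zero, ← sum_sub_distrib, ← sum_sub_distrib]
  set e : ℤ → ℕ → ℂ := fun n j => (-1 : ℂ) ^ j * (Ring.choose n j : ℤ) with he
  have hrec : ∀ j, e (n + 1) (j + 1) = e n (j + 1) - e n j := by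
    intro j
    simp only [he]
    rw [Ring.choose_succ_succ]
    push_cast
    ring
  let A : ℕ → V := fun j => mode a (n + 1 - j) (mode b (m + j) v)
  let B : ℕ → V := fun j => mode b (m + (n + 1) - j) (mode a j v)
  -- Summation by parts. By Pascal's rule the difference of the summands telescopes to `G (j + 1) -
  -- G j`. At `j = 0` the coefficient vanishes since both binomial coefficients are `1`, and at `j =
  -- K` both operator products vanish by truncation.
  let G : ℕ → V := fun j => (e n j - e (n + 1) j) • (A j + (ε * (-1 : ℂ) ^ n) • B j)
  have key : ∀ j ∈ range K, circTerm ε (n + 1) a b m j v -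
      (circTerm ε n (shift 1 a) b m j v - circTerm ε n a b (m + 1) j v) = G (j + 1) - G j := by
    intro j _
    simp only [circTerm_apply, mode_shift, G, A, B]
    change e (n + 1) j • _ - (e n j • _ - e n j • _) = _
    rw [hrec j]
    have i1 : n - (j : ℤ) + 1 = n + 1 - j := by ring
    have i2 : m + 1 + (j : ℤ) = m + (j + 1 : ℕ) := by push_cast; ring
    have i3 : n - (j : ℤ) = n + 1 - (j + 1 : ℕ) := by push_cast; ring
    have i4 : m + n - (j : ℤ) = m + (n + 1) - (j + 1 : ℕ) := by push_cast; ring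
    have i5 : m + 1 + n - (j : ℤ) = m + (n + 1) - j := by ring
    have i6 : (j : ℤ) + 1 = (j + 1 : ℕ) := by push_cast; ring
    have i7 : (-1 : ℂ) ^ (n + 1) = -(-1 : ℂ) ^ n := by
      rw [zpow_add₀ (by norm_num)]
      simp
    rw [i1, i2, i4, i5, i6, i3, i7]
    module
  rw [sum_congr rfl key, sum_range_sub]
  have hA : A K = 0 := by simp only [A]; rw [h5, map_zero]
  have hB : B K = 0 := by
    simp only [B]
    rw [zero_add] at h4
    rw [h4, map_zero]
  have h0 : e n 0 - e (n + 1) 0 = 0 := by simp [he]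
  simp only [G, hA, hB, h0]
  simp

/-- The coefficient of `z^{-p-1} w^{-q-1}` in
`a(z)b(w) ι_{|z|>|w|}(z-w)^n - ε b(w)a(z) ι_{|w|>|z|}(z-w)^n`. -/
def kern (ε : ℂ) (n : ℤ) (a b : QO V) (p q : ℤ) : Module.End ℂ V :=
  mode (circAux ε n (shift p a) b) q

theorem kern_zero_left (ε : ℂ) (n : ℤ) (a b : QO V) (q : ℤ) :
    kern ε n a b 0 q = mode (circAux ε n a b) q := by
  rw [kern, shift_zero]

/-- Multiplying the kernel by `z - w` raises the exponent `n` by one. Hence the iterated differences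
of the plain bracket, restricted to `p = 0`, are the modes of the nonnegative circle products, which
is what `taylor` needs to yield the commutator formula. -/
theorem D_kern (ε : ℂ) (n : ℤ) (a b : QO V) : D (kern ε n a b) = kern ε (n + 1) a b := by
  funext p q
  rw [D_apply]
  simp only [kern]
  rw [mode_circAux_succ, shift_shift, add_comm 1 p]

theorem D_pow_kern (ε : ℂ) (n : ℤ) (k : ℕ) (a b : QO V) :
    (D ^ k) (kern ε n a b) = kern ε (n + k) a b := by
  induction k with
  | zero => simp
  | succ k ih =>
    rw [D_pow_succ_apply, ih, D_kern]
    push_cast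
    rw [add_assoc]

theorem kern_order_zero (ε : ℂ) (a b : QO V) (p q : ℤ) :
    kern ε 0 a b p q = mode a p * mode b q - ε • (mode b q * mode a p) := by
  ext v
  rw [kern, mode_circAux_apply, finsum_eq_single _ 0]
  · simp [circTerm_apply]
  · intro j hj
    obtain ⟨k, rfl⟩ := Nat.exists_eq_succ_of_ne_zero hj
    rw [circTerm_apply, Ring.choose_zero_succ]
    simp

theorem circAux_smul_left (ε : ℂ) (n : ℤ) (r : ℂ) (a b : QO V) :
    circAux ε n (r • a) b = r • circAux ε n a b := by
  refine ext_mode fun m => LinearMap.ext fun v => ?_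
  rw [mode_smul, LinearMap.smul_apply, mode_circAux_apply, mode_circAux_apply,
    smul_finsum' r (circTerm_finite ε n a b m v)]
  refine finsum_congr fun j => ?_
  simp only [circTerm_apply, mode_smul, LinearMap.smul_apply, map_smul]
  module

theorem circAux_add_left (ε : ℂ) (n : ℤ) (a a' b : QO V) :
    circAux ε n (a + a') b = circAux ε n a b + circAux ε n a' b := by
  refine ext_mode fun m => LinearMap.ext fun v => ?_
  rw [mode_add, LinearMap.add_apply, mode_circAux_apply, mode_circAux_apply, mode_circAux_apply,
    ← finsum_add_distrib (circTerm_finite ε n a b m v) (circTerm_finite ε n a' b m v)]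
  refine finsum_congr fun j => ?_
  simp only [circTerm_apply, mode_add, LinearMap.add_apply, map_add]
  module

/-- If `v` is a vacuum vector for `a` and `b`, then it is one for `a ∘ₙ b`. -/
theorem circAux_vacuum {a b : QO V} {v : V} (ε : ℂ) (n : ℤ) (ha : ∀ k : ℕ, mode a k v = 0)
    (hb : ∀ k : ℕ, mode b k v = 0) (m : ℕ) : mode (circAux ε n a b) m v = 0 := by
  rw [mode_circAux_apply]
  refine finsum_eq_zero_of_forall_eq_zero fun j => ?_
  have h : mode b (m + j) v = 0 := by exact_mod_cast hb (m + j)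
  rw [circTerm_apply, ha, h]
  simp

/-- On a vacuum vector every summand with `j > 0` dies because `b(j - 1)` and `a(j)` annihilate it;
from `j = 0` only `a(n) b(-1)` is left. This is the bridge from circle products to vectors. -/
theorem circAux_state {a b : QO V} {v : V} (ε : ℂ) (n : ℤ) (ha : ∀ k : ℕ, mode a k v = 0)
    (hb : ∀ k : ℕ, mode b k v = 0) :
    mode (circAux ε n a b) (-1) v = mode a n (mode b (-1) v) := by
  rw [mode_circAux_apply, finsum_eq_single _ 0]
  · rw [circTerm_apply, ha]
    simp
  · intro j hj
    obtain ⟨k, rfl⟩ := Nat.exists_eq_succ_of_ne_zero hj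
    have h : mode b (-1 + (k + 1 : ℕ)) v = 0 := by
      have := hb k
      rwa [show (-1 + ((k + 1 : ℕ) : ℤ)) = k by push_cast; ring]
    rw [circTerm_apply, ha, h]
    simp

theorem mode_deriv (a : QO V) (n : ℤ) : mode (deriv a) n = (-(n : ℂ)) • mode a (n - 1) := by
  simp [deriv]

theorem mode_one (n : ℤ) : mode (one : QO V) n = if n = -1 then LinearMap.id else 0 := by
  simp [one]

theorem ring_choose_neg_two (j : ℕ) : (-1 : ℂ) ^ j * (Ring.choose (-2 : ℤ) j : ℤ) = j + 1 := by
  induction j with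
  | zero => simp
  | succ j ih =>
    have h1 : Ring.choose (-2 + 1 : ℤ) (j + 1) = Ring.choose (-2) j + Ring.choose (-2) (j + 1) :=
      Ring.choose_succ_succ (-2 : ℤ) j
    have h2 : ∀ k : ℕ, Ring.choose (-1 : ℤ) k = (-1) ^ k := by
      intro k
      induction k with
      | zero => simp
      | succ k ihk =>
        have h := Ring.choose_succ_succ (-1 : ℤ) k
        rw [show (-1 + 1 : ℤ) = 0 by norm_num, Ring.choose_zero_succ, ihk] at h
        rw [pow_succ]
        lia
    rw [show (-2 + 1 : ℤ) = -1 by norm_num, h2] at h1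
    have h3 : Ring.choose (-2 : ℤ) (j + 1) = (-1) ^ (j + 1) - Ring.choose (-2) j := by lia
    rw [h3]
    push_cast
    have h4 : ((-1 : ℂ) ^ (j + 1)) * (-1) ^ (j + 1) = 1 := by rw [← mul_pow]; norm_num
    rw [mul_sub, h4, ← ih, pow_succ]
    ring

/-- Cauchy's formula for the derivative. It makes every space that contains `1` and is closed under
circle products closed under `∂`. -/
theorem circAux_neg_two_one (a : QO V) : circAux 1 (-2) a one = deriv a := by
  refine ext_mode fun m => LinearMap.ext fun v => ?_
  rw [mode_circAux_apply, mode_deriv, LinearMap.smul_apply]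
  simp only [circTerm_apply, mode_one, ring_choose_neg_two]
  -- For `m < 0` only the first product contributes, at `j = -1 - m`; for `m > 0` only the second,
  -- at `j = m - 1`; for `m = 0` neither does, in agreement with the factor `-m` of the derivative.
  rcases lt_trichotomy m 0 with hm | rfl | hm
  · obtain ⟨k, rfl⟩ : ∃ k : ℕ, m = -1 - k := ⟨(-1 - m).toNat, by lia⟩
    rw [finsum_eq_single _ k]
    · rw [if_pos (by lia), if_neg (by lia)]
      rw [show (-2 - k : ℤ) = -1 - k - 1 by ring]
      simp
    · intro j hj
      rw [if_neg (by lia), if_neg (by lia)]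
      simp
  · rw [finsum_eq_zero_of_forall_eq_zero]
    · simp
    · intro j
      rw [if_neg (by lia), if_neg (by lia)]
      simp
  · obtain ⟨k, rfl⟩ : ∃ k : ℕ, m = k + 1 := ⟨(m - 1).toNat, by lia⟩
    rw [finsum_eq_single _ k]
    · rw [if_neg (by lia), if_pos (by lia)]
      simp
      module
    · intro j hj
      rw [if_neg (by lia), if_neg (by lia)]
      simp

/-- `T` is a translation operator for `a`: `[T, a(z)] = ∂a(z)`. -/
def Covariant (T : Module.End ℂ V) (a : QO V) : Prop :=
  ∀ n v, T (mode a n v) = mode a n (T v) - (n : ℂ) • mode a (n - 1) v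

theorem covariant_one (T : Module.End ℂ V) : Covariant T one := by
  intro n v
  rw [mode_one, mode_one]
  by_cases h : n = -1
  · subst h
    simp
  · by_cases h0 : n = 0
    · subst h0
      simp
    · rw [if_neg h, if_neg (by lia)]
      simp

/-- `T` acts on `a(z) b(w)` as `∂_z + ∂_w`, which annihilates `(z - w)^n`, and the residue of a
total `z`-derivative is zero. In modes the vanishing of that residue is the telescoping of the
sequence `G` below, based on `(j + 1) e_{j+1} = -(n - j) e_j` for the expansion coefficients. -/
theorem Covariant.circAux {T : Module.End ℂ V} {a b : QO V} (ha : Covariant T a)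
    (hb : Covariant T b) (ε : ℂ) (n : ℤ) : Covariant T (circAux ε n a b) := by
  intro m v
  obtain ⟨K, h1, h2, h3, h4, h5⟩ := ((circAux_eventually ε n a b m v).and
    ((circAux_eventually ε n a b m (T v)).and
    ((circAux_eventually ε n a b (m - 1) v).and
    ((eventually_mode_eq_zero a (-1) v).and (eventually_mode_eq_zero b (m - 1) v))))).exists
  rw [h1, h2, h3, map_sum, ← sub_eq_zero, smul_sum, ← sum_sub_distrib, ← sum_sub_distrib]
  set e : ℕ → ℂ := fun j => (-1 : ℂ) ^ j * (Ring.choose n j : ℤ) with he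
  have hrec : ∀ j : ℕ, (j + 1 : ℂ) * e (j + 1) = -((n : ℂ) - j) * e j := by
    intro j
    simp only [he]
    have h : ((j + 1 : ℕ) : ℤ) * Ring.choose n (j + 1) = (n - j) * Ring.choose n j := by
      have h6 := Ring.choose_smul_choose n (k := j) (n := j + 1) (by lia)
      rw [show j + 1 - j = 1 by lia, Ring.choose_one_right] at h6
      simp at h6
      push_cast
      linarith
    have h' : ((j : ℂ) + 1) * (Ring.choose n (j + 1) : ℤ) = (n - j) * (Ring.choose n j : ℤ) := by
      exact_mod_cast congrArg (Int.cast : ℤ → ℂ) h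
    rw [pow_succ]
    linear_combination (-(-1 : ℂ) ^ j) * h'
  let A : ℕ → V := fun j => mode a (n - j) (mode b (m - 1 + j) v)
  let B : ℕ → V := fun j => mode b (m + n - j) (mode a (-1 + j) v)
  let G : ℕ → V := fun j => (j * e j) • (A j - (ε * (-1 : ℂ) ^ n) • B j)
  have key : ∀ j ∈ range K, T (circTerm ε n a b m j v) -
      (circTerm ε n a b m j (T v) - (m : ℂ) • circTerm ε n a b (m - 1) j v) =
        G (j + 1) - G j := by
    intro j _
    simp only [circTerm_apply, map_smul, map_sub, ha _ _, hb _ _, G, A, B]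
    change e j • _ - (e j • _ - (m : ℂ) • (e j • _)) = _
    push_cast
    rw [hrec j]
    have i1 : m + (j : ℤ) - 1 = m - 1 + j := by ring
    have i2 : m - 1 + ((j : ℤ) + 1) = m + j := by ring
    have i3 : n - (j : ℤ) - 1 = n - (j + 1) := by ring
    have i4 : m + n - (j : ℤ) - 1 = m + n - (j + 1) := by ring
    have i5 : m - 1 + n - (j : ℤ) = m + n - (j + 1) := by ring
    have i6 : (j : ℤ) - 1 = -1 + j := by ring
    have i7 : -1 + ((j : ℤ) + 1) = j := by ring
    rw [i1, i2, i4, i5, i6, i3, i7]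
    module
  rw [sum_congr rfl key, sum_range_sub]
  have hA : A K = 0 := by simp only [A]; rw [h5, map_zero]
  have hB : B K = 0 := by simp only [B]; rw [h4, map_zero]
  simp only [G, hA, hB]
  simp

end Basic

end QO

/-! ### Locality: commutator formula and Dong's lemma -/

namespace QO

open Finset Filter Diff

section Local

variable {V : Type*} [AddCommGroup V] [Module ℂ V]

/-- `(z-w)^N (a(z)b(w) - ε b(w)a(z)) = 0` for some `N`. -/
def IsLocal (ε : ℂ) (a b : QO V) : Prop := ∃ N : ℕ, (D ^ N) (kern ε 0 a b) = 0

/-- As `ε² = 1`, exchanging the operators multiplies the bracket by `-ε` and transposes its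
arguments, while transposition turns `D` into `-D`. -/
theorem isLocal_symm {ε : ℂ} (hε : ε * ε = 1) {a b : QO V} (h : IsLocal ε a b) :
    IsLocal ε b a := by
  obtain ⟨N, hN⟩ := h
  refine ⟨N, ?_⟩
  have swap : ∀ (k : ℕ) (f : ℤ → ℤ → Module.End ℂ V) (p q : ℤ),
      (D ^ k) (fun p q => f q p) p q = (-1 : ℂ) ^ k • (D ^ k) f q p := by
    intro k
    induction k with
    | zero => simp
    | succ k ih =>
      intro f p q
      rw [D_pow_succ_apply, D_apply, ih f, ih f, D_pow_succ_apply, D_apply, pow_succ]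
      module
  have h1 : kern ε 0 b a = fun p q => (-ε • (LinearMap.id : _ →ₗ[ℂ] Module.End ℂ V))
      ((fun p q => kern ε 0 a b q p) (p + 0) (q + 0)) := by
    funext p q
    simp only [kern_order_zero, add_zero, LinearMap.smul_apply, LinearMap.id_apply, smul_sub,
      smul_smul]
    rw [neg_mul, hε]
    module
  rw [h1, D_pow_map (-ε • LinearMap.id) 0 0 N (fun p q => kern ε 0 a b q p)]
  funext p q
  rw [swap, hN]
  simp

theorem kern_eq_zero_of_le {ε : ℂ} {a b : QO V} {N : ℕ} (h : (D ^ N) (kern ε 0 a b) = 0) {n : ℤ}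
    (hn : N ≤ n) : kern ε n a b = 0 := by
  lift n to ℕ using by lia
  have := D_pow_eq_zero_of_le (by exact_mod_cast hn) h
  rwa [D_pow_kern, zero_add] at this

/-- The commutator formula for the Fourier modes of local operators. -/
theorem commutator {ε : ℂ} {a b : QO V} {N : ℕ} (h : (D ^ N) (kern ε 0 a b) = 0) (p q : ℤ) :
    mode a p * mode b q - ε • (mode b q * mode a p) =
      ∑ k ∈ range N, ((Ring.choose p k : ℤ) : ℂ) • mode (circAux ε k a b) (p + q - k) := by
  rw [← kern_order_zero, taylor N _ h]
  refine sum_congr rfl fun k _ => ?_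
  rw [D_pow_kern, kern_zero_left, zero_add]

/-- Dong's lemma. -/
theorem isLocal_circAux {ε δ δ' : ℂ} {a b c : QO V} (hab : IsLocal ε a b) (hac : IsLocal δ a c)
    (hbc : IsLocal δ' b c) (n : ℤ) : IsLocal (δ * δ') (circAux ε n a b) c := by
  obtain ⟨N, hN⟩ := hab
  obtain ⟨N₁, hN₁⟩ := hac
  obtain ⟨N₂, hN₂⟩ := hbc
  have h1 := D_pow_eq_zero_of_le (Nat.le_max_left N₁ N₂) hN₁
  have h2 := D_pow_eq_zero_of_le (Nat.le_max_right N₁ N₂) hN₂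
  set M := max N₁ N₂
  -- The bracket of the kernel of `a ∘ₙ b` with `c`, in three variables. Differences in the first
  -- two variables raise `n`. The slice `p = 0` is the bracket to be shown local.
  let S : ℤ → ℤ → ℤ → ℤ → Module.End ℂ V := fun n p q r =>
    kern ε n a b p q * mode c r - (δ * δ') • (mode c r * kern ε n a b p q)
  -- The brackets of the two orderings `a b` and `b a` with `c`, without any power of `z - w`; the
  -- shifts `α`, `β` account for the monomials in the expansion of `(z - w)^n`.
  let U : ℤ → ℤ → ℤ → ℤ → ℤ → Module.End ℂ V := fun α β p q r =>
    mode a (p + α) * mode b (q + β) * mode c r -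
      (δ * δ') • (mode c r * (mode a (p + α) * mode b (q + β)))
  let U' : ℤ → ℤ → ℤ → ℤ → ℤ → Module.End ℂ V := fun α β p q r =>
    mode b (q + β) * mode a (p + α) * mode c r -
      (δ * δ') • (mode c r * (mode b (q + β) * mode a (p + α)))
  have hSD : ∀ n, D (X := ℤ → Module.End ℂ V) (S n) = S (n + 1) := by
    intro n
    funext p q r
    change S n (p + 1) q r - S n p (q + 1) r = S (n + 1) p q r
    simp only [S]
    rw [← D_kern, D_apply]
    simp only [sub_mul, mul_sub, smul_sub]
    abel
  have hSD' : ∀ (k : ℕ), (D (X := ℤ → Module.End ℂ V) ^ k) (S n) = S (n + k) := by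
    intro k
    induction k with
    | zero => simp
    | succ k ih =>
      rw [D_pow_succ_apply, ih, hSD]
      push_cast
      rw [add_assoc]
  -- Once the exponent reaches `N` the kernel vanishes by locality of `a` and `b`. When `n ≥ N`
  -- already, the truncated power is zero and nothing has to be multiplied.
  have hS0 : (D (X := ℤ → Module.End ℂ V) ^ (N - n).toNat) (S n) = 0 := by
    rw [hSD']
    funext p q r
    simp only [S]
    rw [kern_eq_zero_of_le hN (by lia)]
    simp
  have hR23 : ∀ (F : ℤ → Module.End ℂ V →ₗ[ℂ] Module.End ℂ V) (β : ℤ),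
      (D23 ^ M) (fun p q r => F p (kern δ' 0 b c (q + β) r)) = 0 := by
    intro F β
    funext p
    rw [D23_pow_apply]
    have := D_pow_map (F p) β 0 M (kern δ' 0 b c)
    simp only [add_zero] at this
    rw [this, h2]
    simp
    rfl
  have hR13 : ∀ (F : ℤ → Module.End ℂ V →ₗ[ℂ] Module.End ℂ V) (α : ℤ),
      (D13 ^ M) (fun p q r => F q (kern δ 0 a c (p + α) r)) = 0 := by
    intro F α
    funext p q r
    rw [D13_pow_apply]
    have := D_pow_map (F q) α 0 M (kern δ 0 a c)
    simp only [add_zero] at this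
    rw [this, h1]
    simp
  have hcomm : Commute (D13 ^ M : Module.End ℂ (ℤ → ℤ → ℤ → Module.End ℂ V)) (D23 ^ M) := by
    rw [D13_eq]
    exact (commute_D_D23.add_left (Commute.refl _)).pow_pow _ _
  -- The Leibniz rule writes the bracket of a product with `c` as one term containing the bracket of
  -- `b` with `c` and one containing that of `a` with `c`. The first is killed by `D23 ^ M`, the
  -- second by `D13 ^ M`.
  have hzero : ∀ (F F' : ℤ → Module.End ℂ V →ₗ[ℂ] Module.End ℂ V) (α β : ℤ),
      (D13 ^ M) ((D23 ^ M) ((fun p q r => F p (kern δ' 0 b c (q + β) r)) +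
        (fun p q r => F' q (kern δ 0 a c (p + α) r)))) = 0 := by
    intro F F' α β
    rw [map_add, map_add, hR23, map_zero, zero_add, ← Module.End.mul_apply, hcomm.eq,
      Module.End.mul_apply, hR13, map_zero]
  have hU : ∀ α β, (D13 ^ M) ((D23 ^ M) (U α β)) = 0 := by
    intro α β
    rw [← hzero (fun p => LinearMap.mulLeft ℂ (mode a (p + α)))
      (fun q => δ' • LinearMap.mulRight ℂ (mode b (q + β))) α β]
    congr 2
    funext p q r
    simp only [U, Pi.add_apply, kern_order_zero, LinearMap.mulLeft_apply, LinearMap.smul_apply,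
      LinearMap.mulRight_apply, mul_sub, sub_mul, smul_sub, mul_smul_comm, smul_mul_assoc,
      ← mul_assoc, smul_smul]
    rw [mul_comm δ δ']
    abel
  have hU' : ∀ α β, (D13 ^ M) ((D23 ^ M) (U' α β)) = 0 := by
    intro α β
    rw [← hzero (fun p => δ • LinearMap.mulRight ℂ (mode a (p + α)))
      (fun q => LinearMap.mulLeft ℂ (mode b (q + β))) α β]
    congr 2
    funext p q r
    simp only [U', Pi.add_apply, kern_order_zero, LinearMap.mulLeft_apply, LinearMap.smul_apply,
      LinearMap.mulRight_apply, mul_sub, sub_mul, smul_sub, mul_smul_comm, smul_mul_assoc,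
      ← mul_assoc, smul_smul]
    abel
  -- Partial sums of the expansion of `S n`. The number of terms needed depends on the vector and on
  -- the indices, so the vanishing is shown for each `K` and then transferred coefficientwise.
  let F : ℕ → ℤ → ℤ → ℤ → Module.End ℂ V := fun K => ∑ j ∈ range K,
    ((-1 : ℂ) ^ j * (Ring.choose n j : ℤ)) •
      (U (n - j) j - (ε * (-1 : ℂ) ^ n) • U' j (n - j))
  have hF : ∀ K, (D13 ^ M) ((D23 ^ M) (F K)) = 0 := by
    intro K
    simp only [F, map_sum, map_smul, map_sub, hU, hU']
    simp
  have hev : ∀ p q r v, ∀ᶠ K in atTop, S n p q r v = F K p q r v := by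
    intro p q r v
    filter_upwards [circAux_eventually ε n (shift p a) b q v,
      circAux_eventually ε n (shift p a) b q (mode c r v)] with K h3 h4
    simp only [S, LinearMap.sub_apply, LinearMap.smul_apply, Module.End.mul_apply, kern]
    rw [h3, h4, map_sum, smul_sum, ← sum_sub_distrib]
    simp only [F, Finset.sum_apply, LinearMap.sum_apply]
    refine sum_congr rfl fun j _ => ?_
    simp only [circTerm_apply, mode_shift, U, U', Pi.smul_apply, Pi.sub_apply,
      LinearMap.sub_apply, LinearMap.smul_apply, Module.End.mul_apply, map_smul, map_sub]
    have i1 : n - (j : ℤ) + p = p + (n - j) := by ring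
    have i2 : q + n - (j : ℤ) = q + (n - j) := by ring
    have i3 : (j : ℤ) + p = p + j := by ring
    rw [i1, i2, i3]
    module
  have hfin : (D13 ^ M) ((D23 ^ M) (S n)) = 0 := by
    funext p q r
    ext v
    obtain ⟨K, hK⟩ := (D13_D23_eventually M M (S n) F hev p q r v).exists
    rw [hK, hF]
  rw [D13_eq] at hfin
  obtain ⟨K, hK⟩ := exists_pow_apply_eq_zero commute_D_D23 hS0 hfin
  refine ⟨K, ?_⟩
  have h5 := congrFun hK 0
  rw [D23_pow_apply] at h5
  have h6 : kern (δ * δ') 0 (circAux ε n a b) c = S n 0 := by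
    funext q r
    simp only [S]
    rw [kern_order_zero, kern_zero_left]
  rw [h6, h5]
  rfl

/-- The vectors killed by all modes of a local operator form a stable subspace. -/
theorem mode_mode_eq_zero {ε : ℂ} {a b : QO V} (h : IsLocal ε a b) {v : V}
    (hv : ∀ n, mode a n v = 0) (m n : ℤ) : mode a n (mode b m v) = 0 := by
  obtain ⟨N, hN⟩ := h
  obtain ⟨B, hB⟩ := mode_truncated b v
  have key : ∀ p q, ∑ j ∈ range (N + 1), ((-1 : ℂ) ^ j * (N.choose j : ℂ)) •
      mode a (p + N - j) (mode b (q + j) v) = 0 := by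
    intro p q
    have h1 := congrArg (fun A : Module.End ℂ V => A v) ((D_pow_apply N _ p q).symm.trans
      (congrFun (congrFun hN p) q))
    simp only [LinearMap.sum_apply, LinearMap.smul_apply, kern_order_zero, LinearMap.sub_apply,
      Module.End.mul_apply, hv, map_zero, smul_zero, sub_zero] at h1
    simpa using h1
  -- Downward induction on the index of `b`, starting from where `b(q) v = 0`. In the relation `key`
  -- all terms but `j = 0` involve a larger index of `b`.
  suffices H : ∀ k : ℕ, ∀ q : ℤ, B ≤ q + k → ∀ n, mode a n (mode b q v) = 0 from
    H (B - m).toNat m (by lia) n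
  intro k
  induction k with
  | zero => intro q hq n; rw [hB q (by lia), map_zero]
  | succ k ih =>
    intro q hq n
    have h1 := key (n - N) q
    rw [sum_range_succ', sum_eq_zero] at h1
    · simpa using h1
    · intro j _
      rw [ih _ (by push_cast; push_cast at hq; linarith), smul_zero]

theorem isLocal_one_right (a : QO V) : IsLocal 1 a one := by
  refine ⟨0, ?_⟩
  funext p q
  simp only [pow_zero, Module.End.one_apply, kern_order_zero, mode_one]
  split_ifs
  · ext v
    simp
  · simp

theorem isLocal_one_left (a : QO V) : IsLocal 1 one a :=
  isLocal_symm (by norm_num) (isLocal_one_right a)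

end Local

/-! ### Homogeneous operators and super signs -/

section Super

variable {V : Type*} [AddCommGroup V] [Module ℂ V] [SuperSpace V]

/-- `a` is homogeneous of parity `k` modulo `2`. -/
def IsHom (k : ℕ) (a : QO V) : Prop := conj a = (-1 : ℂ) ^ k • a

theorem mode_conj (a : QO V) (n : ℤ) (v : V) :
    mode (conj a) n v = SuperSpace.parity (mode a n (SuperSpace.parity v)) := by
  simp [conj]

theorem conj_conj (a : QO V) : conj (conj a) = a :=
  ext_mode fun n => LinearMap.ext fun v => by
    simp only [mode_conj, SuperSpace.parity_parity]

theorem conj_one : conj (one : QO V) = one :=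
  ext_mode fun n => LinearMap.ext fun v => by
    rw [mode_conj, mode_one]
    split_ifs
    · simp [SuperSpace.parity_parity]
    · simp

theorem conj_circAux (ε : ℂ) (n : ℤ) (a b : QO V) :
    conj (circAux ε n a b) = circAux ε n (conj a) (conj b) := by
  refine ext_mode fun m => LinearMap.ext fun v => ?_
  obtain ⟨K, h1, h2⟩ := ((circAux_eventually ε n a b m (SuperSpace.parity v)).and
    (circAux_eventually ε n (conj a) (conj b) m v)).exists
  rw [mode_conj, h1, h2, map_sum]
  refine sum_congr rfl fun j _ => ?_
  simp only [circTerm_apply, mode_conj, SuperSpace.parity_parity, map_smul, map_sub]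

theorem isHom_one : IsHom 0 (one : QO V) := by simp [IsHom, conj_one]

theorem IsHom.add {k : ℕ} {a b : QO V} (ha : IsHom k a) (hb : IsHom k b) : IsHom k (a + b) := by
  rw [IsHom] at *
  rw [conj_add, ha, hb, smul_add]

theorem IsHom.smul {k : ℕ} {a : QO V} (ha : IsHom k a) (r : ℂ) : IsHom k (r • a) := by
  rw [IsHom] at *
  rw [conj_smul, ha, smul_comm]

theorem IsHom.neg {k : ℕ} {a : QO V} (ha : IsHom k a) : IsHom k (-a) := by
  rw [← neg_one_smul ℂ a]
  exact ha.smul (-1)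

theorem IsHom.sub {k : ℕ} {a b : QO V} (ha : IsHom k a) (hb : IsHom k b) : IsHom k (a - b) := by
  rw [sub_eq_add_neg]
  exact ha.add hb.neg

theorem isHom_zero (k : ℕ) : IsHom k (0 : QO V) := by
  have := conj_smul 0 (0 : QO V)
  rw [zero_smul, zero_smul] at this
  rw [IsHom, this, smul_zero]

theorem IsHom.sum {κ : Type*} {k : ℕ} {s : Finset κ} {a : κ → QO V}
    (ha : ∀ i ∈ s, IsHom k (a i)) : IsHom k (∑ i ∈ s, a i) :=
  Finset.sum_induction _ (IsHom k) (fun _ _ => IsHom.add) (isHom_zero k) ha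

theorem IsHom.circAux {k l : ℕ} {a b : QO V} (ha : IsHom k a) (hb : IsHom l b) (ε : ℂ) (n : ℤ) :
    IsHom (k + l) (circAux ε n a b) := by
  rw [IsHom] at *
  rw [conj_circAux, ha, hb, circAux_smul_left, circAux_smul, smul_smul, pow_add]

theorem part_of_isHom {k : ℕ} {a : QO V} (ha : IsHom k a) (i : Fin 2) :
    part i a = ((1 + (-1 : ℂ) ^ ((i : ℕ) + k)) / 2) • a := by
  rw [part, ha, smul_smul, ← pow_add]
  module

theorem circ_of_isHom {k l : ℕ} {a b : QO V} (ha : IsHom k a) (hb : IsHom l b) (n : ℤ) :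
    circ n a b = circAux ((-1 : ℂ) ^ (k * l)) n a b := by
  simp only [circ, part_of_isHom ha, part_of_isHom hb, Fin.sum_univ_two, circAux_smul_left,
    circAux_smul]
  rcases Nat.even_or_odd k with hk | hk <;> rcases Nat.even_or_odd l with hl | hl <;>
    simp [pow_add, pow_mul, hk.neg_one_pow, hl.neg_one_pow]

theorem IsHom.circ {k l : ℕ} {a b : QO V} (ha : IsHom k a) (hb : IsHom l b) (n : ℤ) :
    IsHom (k + l) (circ n a b) := by
  rw [circ_of_isHom ha hb]
  exact ha.circAux hb _ _

theorem bracket_of_isHom {k l : ℕ} {a b : QO V} (ha : IsHom k a) (hb : IsHom l b) (p q : ℤ) :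
    bracket a b p q = kern ((-1 : ℂ) ^ (k * l)) 0 a b p q := by
  rw [kern_order_zero]
  simp only [bracket, part_of_isHom ha, part_of_isHom hb, Fin.sum_univ_two, mode_smul]
  rcases Nat.even_or_odd k with hk | hk <;> rcases Nat.even_or_odd l with hl | hl <;>
    simp [pow_add, pow_mul, hk.neg_one_pow, hl.neg_one_pow]

theorem part_add_part (a : QO V) : part 0 a + part 1 a = a := by
  simp only [part]
  simp
  module

theorem isHom_part (i : Fin 2) (a : QO V) : IsHom i (part i a) := by
  rw [IsHom, part, conj_smul, conj_add, conj_smul, conj_conj]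
  fin_cases i
  · simp
    module
  · simp
    module

theorem circ_add_left (n : ℤ) (a a' b : QO V) : circ n (a + a') b = circ n a b + circ n a' b := by
  simp only [circ, part_add, circAux_add_left, Finset.sum_add_distrib]

theorem circ_smul_left (n : ℤ) (r : ℂ) (a b : QO V) : circ n (r • a) b = r • circ n a b := by
  simp only [circ, part_smul, circAux_smul_left, Finset.smul_sum]

/-- The circle products as bilinear maps. -/
def circL (n : ℤ) : QO V →ₗ[ℂ] QO V →ₗ[ℂ] QO V :=
  LinearMap.mk₂ ℂ (circ n) (circ_add_left n) (circ_smul_left n) (circ_add n) (circ_smul n)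

/-- The super bracket of two operators as a bilinear map to functions on `ℤ × ℤ`. -/
def bracketL : QO V →ₗ[ℂ] QO V →ₗ[ℂ] (ℤ → ℤ → Module.End ℂ V) :=
  LinearMap.mk₂ ℂ bracket
    (fun a a' b => by
      funext p q
      simp only [bracket, part_add, mode_add, Pi.add_apply, add_mul, mul_add,
        ← Finset.sum_add_distrib, smul_add, add_sub_add_comm])
    (fun r a b => by
      funext p q
      simp only [bracket, part_smul, mode_smul, Pi.smul_apply, Finset.smul_sum, smul_mul_assoc,
        mul_smul_comm, smul_sub, smul_comm r])
    (fun a b b' => by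
      funext p q
      simp only [bracket, part_add, mode_add, Pi.add_apply, add_mul, mul_add,
        ← Finset.sum_add_distrib, smul_add, add_sub_add_comm])
    (fun r a b => by
      funext p q
      simp only [bracket, part_smul, mode_smul, Pi.smul_apply, Finset.smul_sum, smul_mul_assoc,
        mul_smul_comm, smul_sub, smul_comm r])

theorem quantumCommutes_iff (a b : QO V) :
    QuantumCommutes a b ↔ ∃ N : ℕ, (D ^ N) (bracketL a b) = 0 := by
  refine exists_congr fun N => ⟨fun h => ?_, fun h p q => ?_⟩
  · funext p q
    rw [D_pow_apply]
    exact h p q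
  · have := congrFun (congrFun h p) q
    rwa [D_pow_apply] at this

theorem quantumCommutes_of_isLocal {k l : ℕ} {a b : QO V} (ha : IsHom k a) (hb : IsHom l b)
    (h : IsLocal ((-1 : ℂ) ^ (k * l)) a b) : QuantumCommutes a b := by
  rw [quantumCommutes_iff]
  obtain ⟨N, hN⟩ := h
  refine ⟨N, ?_⟩
  rwa [show bracketL a b = kern ((-1 : ℂ) ^ (k * l)) 0 a b from
    funext fun p => funext fun q => bracket_of_isHom ha hb p q]

theorem isLocal_of_quantumCommutes {k l : ℕ} {a b : QO V} (ha : IsHom k a) (hb : IsHom l b)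
    (h : QuantumCommutes a b) : IsLocal ((-1 : ℂ) ^ (k * l)) a b := by
  rw [quantumCommutes_iff] at h
  obtain ⟨N, hN⟩ := h
  refine ⟨N, ?_⟩
  rwa [show bracketL a b = kern ((-1 : ℂ) ^ (k * l)) 0 a b from
    funext fun p => funext fun q => bracket_of_isHom ha hb p q] at hN

theorem quantumCommutes_span {H : Set (QO V)} (h : ∀ a ∈ H, ∀ b ∈ H, QuantumCommutes a b)
    {a b : QO V} (ha : a ∈ Submodule.span ℂ H) (hb : b ∈ Submodule.span ℂ H) :
    QuantumCommutes a b := by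
  rw [quantumCommutes_iff]
  induction ha, hb using Submodule.span_induction₂ with
  | mem_mem x y hx hy => exact (quantumCommutes_iff _ _).1 (h x hx y hy)
  | zero_left y hy => exact ⟨0, by simp⟩
  | zero_right x hx => exact ⟨0, by simp⟩
  | add_left x y z _ _ _ h1 h2 =>
    obtain ⟨N, hN⟩ := h1
    obtain ⟨M, hM⟩ := h2
    refine ⟨max N M, ?_⟩
    rw [map_add, LinearMap.add_apply, map_add, D_pow_eq_zero_of_le (le_max_left _ _) hN,
      D_pow_eq_zero_of_le (le_max_right _ _) hM, add_zero]
  | add_right x y z _ _ _ h1 h2 =>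
    obtain ⟨N, hN⟩ := h1
    obtain ⟨M, hM⟩ := h2
    refine ⟨max N M, ?_⟩
    rw [map_add, map_add, D_pow_eq_zero_of_le (le_max_left _ _) hN,
      D_pow_eq_zero_of_le (le_max_right _ _) hM, add_zero]
  | smul_left r x y _ _ h =>
    obtain ⟨N, hN⟩ := h
    exact ⟨N, by rw [map_smul, LinearMap.smul_apply, map_smul, hN, smul_zero]⟩
  | smul_right r x y _ _ h =>
    obtain ⟨N, hN⟩ := h
    exact ⟨N, by rw [map_smul, map_smul, hN, smul_zero]⟩

/-! ### The algebra generated by homogeneous local operators -/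

/-- The elements obtained from `S` and `1` by `n` rounds of circle products, with their
parities. -/
inductive Gen (S : ℕ → Set (QO V)) : ℕ → ℕ → QO V → Prop
  | base {i a} : a ∈ S i → Gen S 0 i a
  | one : Gen S 0 0 one
  | lift {k i a} : Gen S k i a → Gen S (k + 1) i a
  | circ {k i j a b} (n : ℤ) : Gen S k i a → Gen S k j b → Gen S (k + 1) (i + j) (QO.circ n a b)

theorem Gen.le {S : ℕ → Set (QO V)} {k l i : ℕ} {a : QO V} (h : k ≤ l) (ha : Gen S k i a) :
    Gen S l i a := by
  induction h with
  | refl => exact ha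
  | step _ ih => exact ih.lift

theorem Gen.isHom {S : ℕ → Set (QO V)} (hS : ∀ i, ∀ a ∈ S i, IsHom i a) {k i : ℕ} {a : QO V}
    (ha : Gen S k i a) : IsHom i a := by
  induction ha with
  | base h => exact hS _ _ h
  | one => exact isHom_one
  | lift _ ih => exact ih
  | circ n _ _ ih₁ ih₂ => exact ih₁.circ ih₂ n

theorem sign_mul_self (k : ℕ) : (-1 : ℂ) ^ k * (-1 : ℂ) ^ k = 1 := by
  rw [← mul_pow]
  norm_num

/-- Dong's lemma extends one argument at a time: first a new product against elements of the
previous round, and then, by symmetry of locality, against a new product. The round number `k`,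
common to both arguments, makes this a single induction. -/
theorem Gen.isLocal {S : ℕ → Set (QO V)} (hS : ∀ i, ∀ a ∈ S i, IsHom i a)
    (hloc : ∀ i j, ∀ a ∈ S i, ∀ b ∈ S j, IsLocal ((-1 : ℂ) ^ (i * j)) a b) (k : ℕ) :
    ∀ i j a b, Gen S k i a → Gen S k j b → IsLocal ((-1 : ℂ) ^ (i * j)) a b := by
  induction k with
  | zero =>
    intro i j a b ha hb
    cases ha with
    | base ha =>
      cases hb with
      | base hb => exact hloc _ _ _ ha _ hb
      | one => simpa using isLocal_one_right a
    | one => simpa using isLocal_one_left b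
  | succ k ih =>
    have h1 : ∀ i j a b, Gen S (k + 1) i a → Gen S k j b → IsLocal ((-1 : ℂ) ^ (i * j)) a b := by
      intro i j a b ha hb
      cases ha with
      | lift ha => exact ih _ _ _ _ ha hb
      | circ n ha ha' =>
        rw [circ_of_isHom (ha.isHom hS) (ha'.isHom hS), add_mul, pow_add]
        exact isLocal_circAux (ih _ _ _ _ ha ha') (ih _ _ _ _ ha hb) (ih _ _ _ _ ha' hb) n
    intro i j a b ha hb
    cases hb with
    | lift hb => exact h1 _ _ _ _ ha hb
    | @circ _ i₁ j₁ b₁ b₂ n hb hb' =>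
      refine isLocal_symm (sign_mul_self _) ?_
      rw [circ_of_isHom (hb.isHom hS) (hb'.isHom hS), mul_comm, add_mul, pow_add]
      refine isLocal_circAux (ih _ _ _ _ hb hb') ?_ ?_ n
      · rw [mul_comm]
        exact isLocal_symm (sign_mul_self _) (h1 _ _ _ _ ha hb)
      · rw [mul_comm]
        exact isLocal_symm (sign_mul_self _) (h1 _ _ _ _ ha hb')

/-- The union of all the rounds of circle products. -/
def genSet (S : ℕ → Set (QO V)) : Set (QO V) := {a | ∃ k i, Gen S k i a}

theorem isQOA_generated (S : Set (QO V)) : IsQOA (generated S) where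
  one_mem := by
    simp only [generated, Submodule.mem_sInf]
    exact fun A hA => hA.1.one_mem
  circ_mem a ha b hb n := by
    simp only [generated, Submodule.mem_sInf] at *
    exact fun A hA => hA.1.circ_mem a (ha A hA) b (hb A hA) n

theorem subset_generated (S : Set (QO V)) : S ⊆ generated S := by
  intro a ha
  simp only [generated, SetLike.mem_coe, Submodule.mem_sInf]
  exact fun A hA => hA.2 ha

/-- The infimum defining `generated` admits no direct induction. Bilinearity of the circle products
identifies it with the span of iterated products of homogeneous generators, on which properties can
be propagated one product at a time. -/
theorem generated_eq_span (S : ℕ → Set (QO V)) :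
    generated (⋃ i, S i) = Submodule.span ℂ (genSet S) := by
  refine le_antisymm ?_ ?_
  · refine sInf_le ⟨⟨Submodule.subset_span ⟨0, 0, Gen.one⟩, ?_⟩, ?_⟩
    · intro a ha b hb n
      change circL n a b ∈ _
      induction ha, hb using Submodule.span_induction₂ with
      | mem_mem x y hx hy =>
        obtain ⟨k, i, hx⟩ := hx
        obtain ⟨l, j, hy⟩ := hy
        exact Submodule.subset_span ⟨max k l + 1, i + j, Gen.circ n (hx.le (le_max_left _ _))
          (hy.le (le_max_right _ _))⟩
      | zero_left y hy => simp
      | zero_right x hx => simp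
      | add_left x y z _ _ _ h1 h2 =>
        rw [map_add]
        exact add_mem h1 h2
      | add_right x y z _ _ _ h1 h2 =>
        rw [map_add]
        exact add_mem h1 h2
      | smul_left r x y _ _ h =>
        rw [map_smul]
        exact Submodule.smul_mem _ _ h
      | smul_right r x y _ _ h =>
        rw [map_smul]
        exact Submodule.smul_mem _ _ h
    · intro a ha
      obtain ⟨i, hi⟩ := Set.mem_iUnion.1 ha
      exact Submodule.subset_span ⟨0, i, Gen.base hi⟩
  · rw [Submodule.span_le]
    rintro a ⟨k, i, ha⟩
    induction ha with
    | base h => exact subset_generated _ (Set.mem_iUnion.2 ⟨_, h⟩)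
    | one => exact (isQOA_generated _).one_mem
    | lift _ ih => exact ih
    | circ n _ _ ih₁ ih₂ => exact (isQOA_generated _).circ_mem _ ih₁ _ ih₂ n

theorem isVertexAlgebra_generated {S : ℕ → Set (QO V)} (hS : ∀ i, ∀ a ∈ S i, IsHom i a)
    (hloc : ∀ i j, ∀ a ∈ S i, ∀ b ∈ S j, IsLocal ((-1 : ℂ) ^ (i * j)) a b) :
    IsVertexAlgebra (generated (⋃ i, S i)) where
  toIsQOA := isQOA_generated _
  quantumCommutes a ha b hb := by
    rw [generated_eq_span] at ha hb
    refine quantumCommutes_span ?_ ha hb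
    rintro x ⟨k, i, hx⟩ y ⟨l, j, hy⟩
    exact quantumCommutes_of_isLocal (hx.isHom hS) (hy.isHom hS)
      (Gen.isLocal hS hloc (max k l) _ _ _ _ (hx.le (le_max_left _ _)) (hy.le (le_max_right _ _)))

/-! ### State spaces -/

/-- A vertex algebra `A` of operators which is graded by parity, with a vector `vac` such that every
`a ∈ A` is regular on `vac` and determined by the state `a(-1) vac`. -/
structure IsStateSpace (A : Submodule ℂ (QO V)) (vac : V) : Prop
    extends IsVertexAlgebra A where
  part_mem : ∀ a ∈ A, ∀ i, part i a ∈ A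
  vacuum : ∀ a ∈ A, ∀ n : ℕ, mode a n vac = 0
  eq_zero : ∀ a ∈ A, mode a (-1) vac = 0 → a = 0

/-- Goddard's uniqueness argument. Translation covariance spreads the vanishing of `a(-1) vac` to
all modes on the vacuum, locality spreads it to everything generated from the vacuum, and `hgen`
says that this is the whole space. -/
theorem isStateSpace_generated {S : ℕ → Set (QO V)} (hS : ∀ i, ∀ a ∈ S i, IsHom i a)
    (hloc : ∀ i j, ∀ a ∈ S i, ∀ b ∈ S j, IsLocal ((-1 : ℂ) ^ (i * j)) a b) {vac : V}
    (hvac : ∀ i, ∀ a ∈ S i, ∀ n : ℕ, mode a n vac = 0) (hpar : SuperSpace.parity vac = vac)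
    {T : Module.End ℂ V} (hTvac : T vac = 0) (hT : ∀ i, ∀ a ∈ S i, Covariant T a)
    (hgen : ∀ K : Submodule ℂ V, vac ∈ K →
      (∀ i, ∀ a ∈ S i, ∀ n, ∀ v ∈ K, mode a n v ∈ K) → K = ⊤) :
    IsStateSpace (generated (⋃ i, S i)) vac := by
  have hva := isVertexAlgebra_generated hS hloc
  have hpart : ∀ a ∈ generated (⋃ i, S i), ∀ i, part i a ∈ generated (⋃ i, S i) := by
    intro a ha i
    rw [generated_eq_span] at ha ⊢
    induction ha using Submodule.span_induction with
    | mem x hx =>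
      obtain ⟨k, j, hx⟩ := hx
      rw [part_of_isHom (hx.isHom hS)]
      exact Submodule.smul_mem _ _ (Submodule.subset_span ⟨k, j, hx⟩)
    | zero => rw [show part i (0 : QO V) = 0 by simpa using part_smul i 0 (0 : QO V)]; simp
    | add x y _ _ h1 h2 => rw [part_add]; exact add_mem h1 h2
    | smul r x _ h => rw [part_smul]; exact Submodule.smul_mem _ _ h
  have hvac' : ∀ a ∈ generated (⋃ i, S i), ∀ n : ℕ, mode a n vac = 0 := by
    intro a ha
    rw [generated_eq_span] at ha
    induction ha using Submodule.span_induction with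
    | mem x hx =>
      obtain ⟨k, j, hx⟩ := hx
      induction hx with
      | base h => exact hvac _ _ h
      | one =>
        intro n
        rw [mode_one, if_neg (by lia)]
        rfl
      | lift _ ih => exact ih
      | circ n h₁ h₂ ih₁ ih₂ =>
        rw [circ_of_isHom (h₁.isHom hS) (h₂.isHom hS)]
        exact circAux_vacuum _ _ ih₁ ih₂
    | zero => simp [mode_zero]
    | add x y _ _ h1 h2 => intro n; rw [mode_add, LinearMap.add_apply, h1, h2, add_zero]
    | smul r x _ h => intro n; rw [mode_smul, LinearMap.smul_apply, h, smul_zero]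
  have hT' : ∀ a ∈ generated (⋃ i, S i), Covariant T a := by
    intro a ha
    rw [generated_eq_span] at ha
    induction ha using Submodule.span_induction with
    | mem x hx =>
      obtain ⟨k, j, hx⟩ := hx
      induction hx with
      | base h => exact hT _ _ h
      | one => exact covariant_one T
      | lift _ ih => exact ih
      | circ n h₁ h₂ ih₁ ih₂ =>
        rw [circ_of_isHom (h₁.isHom hS) (h₂.isHom hS)]
        exact ih₁.circAux ih₂ _ _
    | zero => intro n v; simp [mode_zero]
    | add x y _ _ h1 h2 =>
      intro n v
      simp only [mode_add, LinearMap.add_apply, map_add, h1 n v, h2 n v]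
      module
    | smul r x _ h =>
      intro n v
      simp only [mode_smul, LinearMap.smul_apply, map_smul, h n v]
      module
  have hhom : ∀ k a, a ∈ generated (⋃ i, S i) → IsHom k a → mode a (-1) vac = 0 → a = 0 := by
    intro k a ha hk h0
    -- Since `T vac = 0`, covariance reads `T (a(n) vac) = -n a(n-1) vac`, and the factor is nonzero
    -- for negative `n`.
    have hneg : ∀ n : ℕ, mode a (-1 - n) vac = 0 := by
      intro n
      induction n with
      | zero => simpa using h0
      | succ n ih =>
        have h1 := hT' a ha (-1 - n) vac
        rw [ih, hTvac, map_zero, map_zero, zero_sub, eq_comm, neg_eq_zero, smul_eq_zero] at h1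
        rcases h1 with h1 | h1
        · have : (-1 - (n : ℤ)) = 0 := by exact_mod_cast h1
          lia
        · rwa [show (-1 - ((n + 1 : ℕ) : ℤ)) = -1 - n - 1 by push_cast; ring]
    have hall : ∀ n : ℤ, mode a n vac = 0 := by
      intro n
      rcases le_or_gt 0 n with h | h
      · lift n to ℕ using h
        exact hvac' a ha n
      · have := hneg (-1 - n).toNat
        rwa [show (-1 - ((-1 - n).toNat : ℤ)) = n by lia] at this
    let K : Submodule ℂ V :=
      { carrier := {v | ∀ n, mode a n v = 0}
        add_mem' := fun hx hy n => by rw [map_add, hx n, hy n, add_zero]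
        zero_mem' := fun n => map_zero _
        smul_mem' := fun r x hx n => by rw [map_smul, hx n, smul_zero] }
    have hK : K = ⊤ := by
      refine hgen K hall fun j b hb m v hv n => ?_
      refine mode_mode_eq_zero (isLocal_of_quantumCommutes hk (hS j b hb) ?_) hv m n
      exact hva.quantumCommutes _ ha _ (subset_generated _ (Set.mem_iUnion.2 ⟨j, hb⟩))
    refine ext_mode fun n => LinearMap.ext fun v => ?_
    have hv : v ∈ K := hK ▸ Submodule.mem_top
    rw [hv n, mode_zero]
    rfl
  refine ⟨hva, hpart, hvac', fun a ha h0 => ?_⟩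
  -- The vacuum is even, so the state of each parity component is a combination of the state of `a`
  -- and its parity image; both vanish.
  have hp : ∀ i, part i a = 0 := by
    intro i
    refine hhom i _ (hpart a ha i) (isHom_part i a) ?_
    rw [part, mode_smul, mode_add, mode_smul, LinearMap.smul_apply, LinearMap.add_apply,
      LinearMap.smul_apply, mode_conj, hpar, h0]
    simp
  rw [← part_add_part a, hp, hp, add_zero]

end Super

end QO

/-! ### Derivations of the exterior and symmetric algebras -/

section Derivations

variable {M : Type*} [AddCommGroup M] [Module ℂ M]

/-- The derivation of the exterior algebra which extends a linear endomorphism of `M`. -/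
def extDerivation (δ : M →ₗ[ℂ] M) : Module.End ℂ (ExteriorAlgebra ℂ M) :=
  CliffordAlgebra.foldr' (0 : QuadraticForm ℂ M)
    (((LinearMap.mul ℂ (ExteriorAlgebra ℂ M)) ∘ₗ ExteriorAlgebra.ι ℂ ∘ₗ δ).compl₂
        (LinearMap.fst ℂ (ExteriorAlgebra ℂ M) (ExteriorAlgebra ℂ M)) +
      ((LinearMap.mul ℂ (ExteriorAlgebra ℂ M)) ∘ₗ ExteriorAlgebra.ι ℂ).compl₂
        (LinearMap.snd ℂ (ExteriorAlgebra ℂ M) (ExteriorAlgebra ℂ M)))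
    -- In the fold, `x` is the element built so far and `y` its image. Well-definedness amounts to
    -- applying the rule for `m` twice and getting zero, which follows from `m² = 0` and from the
    -- anticommutation of `m` with `δ m`.
    (fun m x y => by
      have h1 := ExteriorAlgebra.ι_add_mul_swap (R := ℂ) (δ m) m
      have h2 := ExteriorAlgebra.ι_sq_zero (R := ℂ) m
      change ExteriorAlgebra.ι ℂ (δ m) * (ExteriorAlgebra.ι ℂ m * x) +
        ExteriorAlgebra.ι ℂ m * (ExteriorAlgebra.ι ℂ (δ m) * x + ExteriorAlgebra.ι ℂ m * y) =
          (0 : ℂ) • y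
      rw [mul_add, ← mul_assoc, ← mul_assoc, ← mul_assoc, h2, ← add_assoc, ← add_mul, h1]
      simp) 0

theorem extDerivation_algebraMap (δ : M →ₗ[ℂ] M) (r : ℂ) :
    extDerivation δ (algebraMap ℂ _ r) = 0 :=
  (CliffordAlgebra.foldr'_algebraMap _ _ _ _ r).trans (smul_zero r)

theorem extDerivation_ι_mul (δ : M →ₗ[ℂ] M) (m : M) (x : ExteriorAlgebra ℂ M) :
    extDerivation δ (ExteriorAlgebra.ι ℂ m * x) =
      ExteriorAlgebra.ι ℂ (δ m) * x + ExteriorAlgebra.ι ℂ m * extDerivation δ x :=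
  CliffordAlgebra.foldr'_ι_mul _ _ _ _ m x

/-- The commutator of a derivation with an antiderivation is an antiderivation, hence fixed by its
values on generators, here `m ↦ -d (δ m)`. This gives the covariance of the annihilation modes. -/
theorem extDerivation_contractLeft (δ : M →ₗ[ℂ] M) (d : Module.Dual ℂ M)
    (x : ExteriorAlgebra ℂ M) :
    extDerivation δ (CliffordAlgebra.contractLeft d x) =
      CliffordAlgebra.contractLeft d (extDerivation δ x) -
        CliffordAlgebra.contractLeft (d ∘ₗ δ) x := by
  induction x using CliffordAlgebra.left_induction with
  | algebraMap r =>
    rw [CliffordAlgebra.contractLeft_algebraMap, CliffordAlgebra.contractLeft_algebraMap]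
    have := extDerivation_algebraMap δ r
    simp only [ExteriorAlgebra] at this
    rw [this]
    simp
  | add a b ha hb =>
    simp only [map_add, ha, hb]
    abel
  | ι_mul x m hx =>
    have h1 : ∀ y : ExteriorAlgebra ℂ M, extDerivation δ (CliffordAlgebra.ι 0 m * y) =
      CliffordAlgebra.ι 0 (δ m) * y + CliffordAlgebra.ι 0 m * extDerivation δ y :=
      extDerivation_ι_mul δ m
    rw [CliffordAlgebra.contractLeft_ι_mul, CliffordAlgebra.contractLeft_ι_mul, map_sub, map_smul,
      h1, h1, map_add, CliffordAlgebra.contractLeft_ι_mul, CliffordAlgebra.contractLeft_ι_mul, hx,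
      mul_sub, LinearMap.comp_apply]
    abel

theorem involute_contractLeft (d : Module.Dual ℂ M) (x : ExteriorAlgebra ℂ M) :
    CliffordAlgebra.involute (CliffordAlgebra.contractLeft d (CliffordAlgebra.involute x)) =
      -CliffordAlgebra.contractLeft d x := by
  induction x using CliffordAlgebra.left_induction with
  | algebraMap r => simp
  | add a b ha hb =>
    simp only [map_add, ha, hb]
    abel
  | ι_mul x m hx =>
    simp only [map_mul, CliffordAlgebra.involute_ι, neg_mul, map_neg,
      CliffordAlgebra.contractLeft_ι_mul, map_sub, map_smul, hx, CliffordAlgebra.involute_involute,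
      mul_neg, neg_neg]

/-- The algebra homomorphism `m ↦ m + δ(m) ε`. -/
def symDualEnd (δ : M →ₗ[ℂ] M) :
    SymmetricAlgebra ℂ M →ₐ[ℂ] TrivSqZeroExt (SymmetricAlgebra ℂ M) (SymmetricAlgebra ℂ M) :=
  SymmetricAlgebra.lift
    ((TrivSqZeroExt.inlAlgHom ℂ (SymmetricAlgebra ℂ M) (SymmetricAlgebra ℂ M)).toLinearMap ∘ₗ
        SymmetricAlgebra.ι ℂ M +
      ((TrivSqZeroExt.inrHom (SymmetricAlgebra ℂ M) (SymmetricAlgebra ℂ M)).restrictScalars ℂ) ∘ₗ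
        SymmetricAlgebra.ι ℂ M ∘ₗ δ)

/-- The derivation of the symmetric algebra which extends a linear endomorphism of `M`. -/
def symDerivation (δ : M →ₗ[ℂ] M) : Module.End ℂ (SymmetricAlgebra ℂ M) :=
  ((TrivSqZeroExt.sndHom (SymmetricAlgebra ℂ M) (SymmetricAlgebra ℂ M)).restrictScalars ℂ) ∘ₗ
    (symDualEnd δ).toLinearMap

theorem symDerivation_apply (δ : M →ₗ[ℂ] M) (x : SymmetricAlgebra ℂ M) :
    symDerivation δ x = (symDualEnd δ x).snd := rfl

theorem fst_symDualEnd (δ : M →ₗ[ℂ] M) (x : SymmetricAlgebra ℂ M) :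
    (symDualEnd δ x).fst = x := by
  have h : (TrivSqZeroExt.fstHom ℂ (SymmetricAlgebra ℂ M) (SymmetricAlgebra ℂ M)).comp
      (symDualEnd δ) = AlgHom.id ℂ _ := by
    apply SymmetricAlgebra.algHom_ext
    ext m
    simp [symDualEnd]
  exact congrArg (fun f : SymmetricAlgebra ℂ M →ₐ[ℂ] SymmetricAlgebra ℂ M => f x) h

theorem symDerivation_ι (δ : M →ₗ[ℂ] M) (m : M) :
    symDerivation δ (SymmetricAlgebra.ι ℂ M m) = SymmetricAlgebra.ι ℂ M (δ m) := by
  simp [symDerivation_apply, symDualEnd]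

theorem symDerivation_algebraMap (δ : M →ₗ[ℂ] M) (r : ℂ) :
    symDerivation δ (algebraMap ℂ _ r) = 0 := by
  rw [symDerivation_apply, AlgHom.commutes, TrivSqZeroExt.algebraMap_eq_inl']
  simp

theorem symDerivation_mul (δ : M →ₗ[ℂ] M) (x y : SymmetricAlgebra ℂ M) :
    symDerivation δ (x * y) = x * symDerivation δ y + y * symDerivation δ x := by
  simp [symDerivation_apply, fst_symDualEnd, mul_comm]

theorem symDerivation_symDeriv (δ : M →ₗ[ℂ] M) (d : Module.Dual ℂ M) (x : SymmetricAlgebra ℂ M) :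
    symDerivation δ (symDeriv d x) =
      symDeriv d (symDerivation δ x) - symDeriv (d ∘ₗ δ) x := by
  induction x using SymmetricAlgebra.induction with
  | algebraMap r => simp [symDeriv_algebraMap, symDerivation_algebraMap]
  | ι m => simp [symDeriv_ι, symDerivation_ι, symDerivation_algebraMap]
  | mul a b ha hb =>
    simp only [symDeriv_mul, symDerivation_mul, map_add, ha, hb]
    ring
  | add a b ha hb =>
    simp only [map_add, ha, hb]
    abel

theorem symDeriv_smul (r : ℂ) (d : Module.Dual ℂ M) (x : SymmetricAlgebra ℂ M) :
    symDeriv (r • d) x = r • symDeriv d x := by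
  induction x using SymmetricAlgebra.induction with
  | algebraMap s => simp [symDeriv_algebraMap]
  | ι m => simp [symDeriv_ι, Algebra.smul_def]
  | mul a b ha hb => simp only [symDeriv_mul, ha, hb, smul_add, mul_smul_comm]
  | add a b ha hb => simp only [map_add, ha, hb, smul_add]

theorem symDeriv_comm (d d' : Module.Dual ℂ M) (x : SymmetricAlgebra ℂ M) :
    symDeriv d (symDeriv d' x) = symDeriv d' (symDeriv d x) := by
  induction x using SymmetricAlgebra.induction with
  | algebraMap r => simp [symDeriv_algebraMap]
  | ι m => simp [symDeriv_ι, symDeriv_algebraMap]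
  | mul a b ha hb =>
    simp only [symDeriv_mul, map_add, ha, hb]
    ring
  | add a b ha hb => simp only [map_add, ha, hb]

end Derivations

/-! ### Fock space: translation, canonical relations and cyclic vacuum -/

namespace Weil

open QO

variable {g : Type*} [LieRing g] [LieAlgebra ℂ g]

/-- The translation `e_k ↦ (k + 1) e_{k+1}` of creation modes. -/
def translate : Modes g →ₗ[ℂ] Modes g :=
  Finsupp.lsum ℂ fun k => ((k : ℂ) + 1) • Finsupp.lsingle (k + 1)

theorem translate_single (k : ℕ) (u : g × Module.Dual ℂ g) :
    translate (Finsupp.single k u) = ((k : ℂ) + 1) • Finsupp.single (k + 1) u := by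
  simp [translate]

theorem pairing_single (s : ℂ) (u u' : g × Module.Dual ℂ g) (k l : ℕ) :
    pairing s u k (Finsupp.single l u') = if l = k then u'.2 u.1 + s * u.2 u'.1 else 0 := by
  by_cases h : l = k
  · subst h
    simp [pairing]
  · simp [pairing, h]

theorem pairing_translate_zero (s : ℂ) (u : g × Module.Dual ℂ g) :
    pairing s u 0 ∘ₗ translate = 0 := by
  refine Finsupp.lhom_ext fun l u' => ?_
  rw [LinearMap.comp_apply, translate_single, map_smul, pairing_single, if_neg (by lia)]
  simp

theorem pairing_translate_succ (s : ℂ) (u : g × Module.Dual ℂ g) (k : ℕ) :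
    pairing s u (k + 1) ∘ₗ translate = ((k : ℂ) + 1) • pairing s u k := by
  refine Finsupp.lhom_ext fun l u' => ?_
  rw [LinearMap.comp_apply, translate_single, map_smul, LinearMap.smul_apply, pairing_single,
    pairing_single]
  by_cases h : l = k
  · subst h
    simp
  · simp [h]

/-- Creation modes are moved by `translate` itself and annihilation modes by its transpose. At the
border `n = 0` the mode `n - 1` is a creation mode, but its coefficient is `0`, matching
`pairing_translate_zero`. -/
theorem modeE_covariant (u : g × Module.Dual ℂ g) (n : ℤ) (x : ExteriorAlgebra ℂ (Modes g)) :
    extDerivation translate (modeE u n x) =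
      modeE u n (extDerivation translate x) - (n : ℂ) • modeE u (n - 1) x := by
  match n with
  | Int.ofNat 0 =>
    change extDerivation translate (CliffordAlgebra.contractLeft (pairing 1 u 0) x) =
      CliffordAlgebra.contractLeft (pairing 1 u 0) (extDerivation translate x) -
        ((Int.ofNat 0 : ℤ) : ℂ) • _
    rw [extDerivation_contractLeft, pairing_translate_zero]
    simp
  | Int.ofNat (k + 1) =>
    rw [show Int.ofNat (k + 1) - 1 = Int.ofNat k by simp]
    change extDerivation translate (CliffordAlgebra.contractLeft (pairing 1 u (k + 1)) x) =
      CliffordAlgebra.contractLeft (pairing 1 u (k + 1)) (extDerivation translate x) -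
        ((Int.ofNat (k + 1) : ℤ) : ℂ) • CliffordAlgebra.contractLeft (pairing 1 u k) x
    rw [extDerivation_contractLeft, pairing_translate_succ, map_smul]
    simp
  | Int.negSucc k =>
    rw [show Int.negSucc k - 1 = Int.negSucc (k + 1) by lia]
    change extDerivation translate (ExteriorAlgebra.ι ℂ (Finsupp.single k u) * x) =
      ExteriorAlgebra.ι ℂ (Finsupp.single k u) * extDerivation translate x -
        ((Int.negSucc k : ℤ) : ℂ) • (ExteriorAlgebra.ι ℂ (Finsupp.single (k + 1) u) * x)
    rw [extDerivation_ι_mul, translate_single, map_smul, smul_mul_assoc, Int.cast_negSucc]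
    push_cast
    module

theorem modeS_covariant (u : g × Module.Dual ℂ g) (n : ℤ) (x : SymmetricAlgebra ℂ (Modes g)) :
    symDerivation translate (modeS u n x) =
      modeS u n (symDerivation translate x) - (n : ℂ) • modeS u (n - 1) x := by
  match n with
  | Int.ofNat 0 =>
    change symDerivation translate (symDeriv (pairing (-1) u 0) x) =
      symDeriv (pairing (-1) u 0) (symDerivation translate x) - ((Int.ofNat 0 : ℤ) : ℂ) • _
    rw [symDerivation_symDeriv, pairing_translate_zero]
    have := symDeriv_smul 0 (0 : Module.Dual ℂ (Modes g)) x
    rw [zero_smul, zero_smul] at this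
    simp [this]
  | Int.ofNat (k + 1) =>
    rw [show Int.ofNat (k + 1) - 1 = Int.ofNat k by simp]
    change symDerivation translate (symDeriv (pairing (-1) u (k + 1)) x) =
      symDeriv (pairing (-1) u (k + 1)) (symDerivation translate x) -
        ((Int.ofNat (k + 1) : ℤ) : ℂ) • symDeriv (pairing (-1) u k) x
    rw [symDerivation_symDeriv, pairing_translate_succ, symDeriv_smul]
    simp
  | Int.negSucc k =>
    rw [show Int.negSucc k - 1 = Int.negSucc (k + 1) by lia]
    change symDerivation translate (SymmetricAlgebra.ι ℂ _ (Finsupp.single k u) * x) =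
      SymmetricAlgebra.ι ℂ _ (Finsupp.single k u) * symDerivation translate x -
        ((Int.negSucc k : ℤ) : ℂ) • (SymmetricAlgebra.ι ℂ _ (Finsupp.single (k + 1) u) * x)
    rw [symDerivation_mul, symDerivation_ι, translate_single, map_smul, Int.cast_negSucc,
      mul_smul_comm, mul_comm x]
    push_cast
    module

/-- Two creation modes anticommute, as do two contractions; the only scalar comes from contracting a
creation mode of matching index, and the indices `k` and `-k-1` add up to `-1`. -/
theorem modeE_modeE (u u' : g × Module.Dual ℂ g) (p q : ℤ) (x : ExteriorAlgebra ℂ (Modes g)) :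
    modeE u p (modeE u' q x) + modeE u' q (modeE u p x) =
      if p + q = -1 then (u'.2 u.1 + u.2 u'.1) • x else 0 := by
  have mixed : ∀ (v v' : g × Module.Dual ℂ g) (k l : ℕ),
      modeE v (Int.ofNat k) (modeE v' (Int.negSucc l) x) +
        modeE v' (Int.negSucc l) (modeE v (Int.ofNat k) x) =
      if l = k then (v'.2 v.1 + v.2 v'.1) • x else 0 := by
    intro v v' k l
    change CliffordAlgebra.contractLeft (pairing 1 v k)
        (CliffordAlgebra.ι 0 (Finsupp.single l v') * x) +
      CliffordAlgebra.ι 0 (Finsupp.single l v') *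
        CliffordAlgebra.contractLeft (pairing 1 v k) x = _
    rw [CliffordAlgebra.contractLeft_ι_mul, sub_add_cancel, pairing_single]
    split_ifs <;> simp
  match p, q with
  | Int.ofNat k, Int.ofNat l =>
    rw [if_neg (by simp only [Int.ofNat_eq_natCast]; lia)]
    change CliffordAlgebra.contractLeft _ (CliffordAlgebra.contractLeft _ x) +
      CliffordAlgebra.contractLeft _ (CliffordAlgebra.contractLeft _ x) = 0
    rw [CliffordAlgebra.contractLeft_comm, neg_add_cancel]
  | Int.negSucc k, Int.negSucc l =>
    rw [if_neg (by lia)]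
    change ExteriorAlgebra.ι ℂ _ * (ExteriorAlgebra.ι ℂ _ * x) +
      ExteriorAlgebra.ι ℂ _ * (ExteriorAlgebra.ι ℂ _ * x) = 0
    rw [← mul_assoc, ← mul_assoc, ← add_mul, ExteriorAlgebra.ι_add_mul_swap, zero_mul]
  | Int.ofNat k, Int.negSucc l =>
    rw [mixed]
    exact if_congr (by simp only [Int.ofNat_eq_natCast]; lia) rfl rfl
  | Int.negSucc k, Int.ofNat l =>
    rw [add_comm, mixed, add_comm (u.2 u'.1)]
    exact if_congr (by simp only [Int.ofNat_eq_natCast]; lia) rfl rfl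

theorem modeS_modeS (u u' : g × Module.Dual ℂ g) (p q : ℤ) (x : SymmetricAlgebra ℂ (Modes g)) :
    modeS u p (modeS u' q x) - modeS u' q (modeS u p x) =
      if p + q = -1 then (u'.2 u.1 - u.2 u'.1) • x else 0 := by
  have mixed : ∀ (v v' : g × Module.Dual ℂ g) (k l : ℕ),
      modeS v (Int.ofNat k) (modeS v' (Int.negSucc l) x) -
        modeS v' (Int.negSucc l) (modeS v (Int.ofNat k) x) =
      if l = k then (v'.2 v.1 - v.2 v'.1) • x else 0 := by
    intro v v' k l
    change symDeriv (pairing (-1) v k) (SymmetricAlgebra.ι ℂ _ (Finsupp.single l v') * x) -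
      SymmetricAlgebra.ι ℂ _ (Finsupp.single l v') * symDeriv (pairing (-1) v k) x = _
    rw [symDeriv_mul, add_sub_cancel_left, symDeriv_ι, pairing_single, mul_comm,
      ← Algebra.smul_def]
    split_ifs
    · congr 1
      ring
    · simp
  match p, q with
  | Int.ofNat k, Int.ofNat l =>
    rw [if_neg (by simp only [Int.ofNat_eq_natCast]; lia), sub_eq_zero]
    exact symDeriv_comm _ _ _
  | Int.negSucc k, Int.negSucc l =>
    rw [if_neg (by lia), sub_eq_zero]
    exact mul_left_comm _ _ _
  | Int.ofNat k, Int.negSucc l =>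
    rw [mixed]
    exact if_congr (by simp only [Int.ofNat_eq_natCast]; lia) rfl rfl
  | Int.negSucc k, Int.ofNat l =>
    rw [← neg_sub, mixed, ← neg_sub (u.2 u'.1)]
    by_cases h : k = l
    · rw [if_pos h, if_pos (by simp only [Int.ofNat_eq_natCast]; lia), neg_smul]
    · rw [if_neg h, if_neg (by simp only [Int.ofNat_eq_natCast]; lia), neg_zero]

theorem mode_fieldE_tmul (u : g × Module.Dual ℂ g) (n : ℤ) (x : ExteriorAlgebra ℂ (Modes g))
    (y : SymmetricAlgebra ℂ (Modes g)) :
    mode (fieldE u) n (x ⊗ₜ[ℂ] y) = modeE u n x ⊗ₜ[ℂ] y := by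
  simp [fieldE]

theorem mode_fieldS_tmul (u : g × Module.Dual ℂ g) (n : ℤ) (x : ExteriorAlgebra ℂ (Modes g))
    (y : SymmetricAlgebra ℂ (Modes g)) :
    mode (fieldS u) n (x ⊗ₜ[ℂ] y) = x ⊗ₜ[ℂ] modeS u n y := by
  simp [fieldS]

theorem mode_fieldE_fieldE (u u' : g × Module.Dual ℂ g) (p q : ℤ) (v : Fock g) :
    mode (fieldE u) p (mode (fieldE u') q v) + mode (fieldE u') q (mode (fieldE u) p v) =
      if p + q = -1 then (u'.2 u.1 + u.2 u'.1) • v else 0 := by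
  induction v using TensorProduct.induction_on with
  | zero => simp
  | tmul x y =>
    simp only [mode_fieldE_tmul]
    rw [← TensorProduct.add_tmul, modeE_modeE]
    split_ifs
    · rw [TensorProduct.smul_tmul']
    · rw [TensorProduct.zero_tmul]
  | add x y hx hy =>
    simp only [map_add]
    rw [add_add_add_comm, hx, hy]
    split_ifs
    · rw [smul_add]
    · rw [add_zero]

theorem mode_fieldS_fieldS (u u' : g × Module.Dual ℂ g) (p q : ℤ) (v : Fock g) :
    mode (fieldS u) p (mode (fieldS u') q v) - mode (fieldS u') q (mode (fieldS u) p v) =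
      if p + q = -1 then (u'.2 u.1 - u.2 u'.1) • v else 0 := by
  induction v using TensorProduct.induction_on with
  | zero => simp
  | tmul x y =>
    simp only [mode_fieldS_tmul]
    rw [← TensorProduct.tmul_sub, modeS_modeS]
    split_ifs
    · rw [TensorProduct.tmul_smul]
    · rw [TensorProduct.tmul_zero]
  | add x y hx hy =>
    simp only [map_add]
    rw [add_sub_add_comm, hx, hy]
    split_ifs
    · rw [smul_add]
    · rw [add_zero]

theorem mode_fieldE_fieldS (u u' : g × Module.Dual ℂ g) (p q : ℤ) (v : Fock g) :
    mode (fieldE u) p (mode (fieldS u') q v) = mode (fieldS u') q (mode (fieldE u) p v) := by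
  induction v using TensorProduct.induction_on with
  | zero => simp
  | tmul x y => simp only [mode_fieldE_tmul, mode_fieldS_tmul]
  | add x y hx hy => simp only [map_add, hx, hy]

variable (g) in
/-- The vacuum vector of the Fock space. -/
def vac : Fock g := 1 ⊗ₜ[ℂ] 1

variable (g) in
/-- The translation operator of the Fock space. -/
def translation : Module.End ℂ (Fock g) :=
  LinearMap.rTensor _ (extDerivation translate) + LinearMap.lTensor _ (symDerivation translate)

theorem translation_vac : translation g (vac g) = 0 := by
  have h1 := extDerivation_algebraMap (translate (g := g)) 1
  have h2 := symDerivation_algebraMap (translate (g := g)) 1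
  rw [map_one] at h1 h2
  simp [translation, vac, h1, h2]

theorem covariant_fieldE (u : g × Module.Dual ℂ g) : Covariant (translation g) (fieldE u) := by
  intro n v
  induction v using TensorProduct.induction_on with
  | zero => simp
  | tmul x y =>
    simp only [translation, LinearMap.add_apply, LinearMap.rTensor_tmul, LinearMap.lTensor_tmul,
      mode_fieldE_tmul, map_add, modeE_covariant, TensorProduct.sub_tmul, TensorProduct.smul_tmul']
    abel
  | add x y hx hy =>
    simp only [map_add, hx, hy]
    module

theorem covariant_fieldS (u : g × Module.Dual ℂ g) : Covariant (translation g) (fieldS u) := by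
  intro n v
  induction v using TensorProduct.induction_on with
  | zero => simp
  | tmul x y =>
    simp only [translation, LinearMap.add_apply, LinearMap.rTensor_tmul, LinearMap.lTensor_tmul,
      mode_fieldS_tmul, map_add, modeS_covariant, TensorProduct.tmul_sub, TensorProduct.tmul_smul]
    abel
  | add x y hx hy =>
    simp only [map_add, hx, hy]
    module

theorem parity_tmul (x : ExteriorAlgebra ℂ (Modes g)) (y : SymmetricAlgebra ℂ (Modes g)) :
    SuperSpace.parity (V := Fock g) (x ⊗ₜ[ℂ] y) = CliffordAlgebra.involute x ⊗ₜ[ℂ] y := rfl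

theorem parity_vac : SuperSpace.parity (vac g) = vac g := by
  rw [vac, parity_tmul, map_one]

theorem isHom_fieldE (u : g × Module.Dual ℂ g) : IsHom 1 (fieldE u) := by
  refine ext_mode fun n => LinearMap.ext fun v => ?_
  rw [mode_conj, mode_smul, LinearMap.smul_apply, pow_one, neg_one_smul]
  induction v using TensorProduct.induction_on with
  | zero => simp
  | tmul x y =>
    rw [parity_tmul, mode_fieldE_tmul, parity_tmul, mode_fieldE_tmul, ← TensorProduct.neg_tmul]
    congr 1
    match n with
    | Int.ofNat k => exact involute_contractLeft _ _
    | Int.negSucc k =>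
      change CliffordAlgebra.involute (CliffordAlgebra.ι 0 (Finsupp.single k u) *
        CliffordAlgebra.involute x) = -(CliffordAlgebra.ι 0 (Finsupp.single k u) * x)
      simp
  | add x y hx hy =>
    simp only [map_add, hx, hy]
    abel

theorem isHom_fieldS (u : g × Module.Dual ℂ g) : IsHom 0 (fieldS u) := by
  refine ext_mode fun n => LinearMap.ext fun v => ?_
  rw [mode_conj, mode_smul, LinearMap.smul_apply, pow_zero, one_smul]
  induction v using TensorProduct.induction_on with
  | zero => simp
  | tmul x y =>
    rw [parity_tmul, mode_fieldS_tmul, parity_tmul, mode_fieldS_tmul,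
      CliffordAlgebra.involute_involute]
  | add x y hx hy => simp only [map_add, hx, hy]

theorem mode_fieldE_vac (u : g × Module.Dual ℂ g) (n : ℕ) : mode (fieldE u) n (vac g) = 0 := by
  rw [vac, mode_fieldE_tmul]
  change CliffordAlgebra.contractLeft _ (1 : CliffordAlgebra _) ⊗ₜ[ℂ] _ = _
  rw [CliffordAlgebra.contractLeft_one, TensorProduct.zero_tmul]

theorem mode_fieldS_vac (u : g × Module.Dual ℂ g) (n : ℕ) : mode (fieldS u) n (vac g) = 0 := by
  have h := symDeriv_algebraMap (pairing (-1) u n) 1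
  rw [map_one] at h
  rw [vac, mode_fieldS_tmul]
  change _ ⊗ₜ[ℂ] symDeriv _ 1 = _
  rw [h, TensorProduct.tmul_zero]

/-- The creation modes are the multiplications by generators of the two algebras. Starting from `1 ⊗
1` they first produce all of the exterior factor over `1`, and then every symmetric factor over a
fixed exterior one. -/
theorem eq_top_of_vac_mem (K : Submodule ℂ (Fock g)) (h0 : vac g ∈ K)
    (hE : ∀ u n, ∀ v ∈ K, mode (fieldE u) n v ∈ K)
    (hS : ∀ u n, ∀ v ∈ K, mode (fieldS u) n v ∈ K) : K = ⊤ := by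
  have hιE : ∀ (m : Modes g), ∀ v ∈ K,
      LinearMap.rTensor _ (LinearMap.mulLeft ℂ (ExteriorAlgebra.ι ℂ m)) v ∈ K := by
    intro m
    induction m using Finsupp.induction_linear with
    | zero => intro v _; simp
    | add a b ha hb =>
      intro v hv
      have : LinearMap.mulLeft ℂ (ExteriorAlgebra.ι ℂ (a + b)) =
          LinearMap.mulLeft ℂ (ExteriorAlgebra.ι ℂ a) +
            LinearMap.mulLeft ℂ (ExteriorAlgebra.ι ℂ b) := by
        refine LinearMap.ext fun x => ?_
        simp [add_mul]
      rw [this, LinearMap.rTensor_add, LinearMap.add_apply]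
      exact add_mem (ha v hv) (hb v hv)
    | single k u =>
      intro v hv
      have := hE u (Int.negSucc k) v hv
      simpa [fieldE, modeE] using this
  have hιS : ∀ (m : Modes g), ∀ v ∈ K,
      LinearMap.lTensor _ (LinearMap.mulLeft ℂ (SymmetricAlgebra.ι ℂ _ m)) v ∈ K := by
    intro m
    induction m using Finsupp.induction_linear with
    | zero => intro v _; simp
    | add a b ha hb =>
      intro v hv
      have : LinearMap.mulLeft ℂ (SymmetricAlgebra.ι ℂ _ (a + b)) =
          LinearMap.mulLeft ℂ (SymmetricAlgebra.ι ℂ _ a) +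
            LinearMap.mulLeft ℂ (SymmetricAlgebra.ι ℂ _ b) := by
        refine LinearMap.ext fun x => ?_
        simp [add_mul]
      rw [this, LinearMap.lTensor_add, LinearMap.add_apply]
      exact add_mem (ha v hv) (hb v hv)
    | single k u =>
      intro v hv
      have := hS u (Int.negSucc k) v hv
      simpa [fieldS, modeS] using this
  have h1 : ∀ x : ExteriorAlgebra ℂ (Modes g), x ⊗ₜ[ℂ] (1 : SymmetricAlgebra ℂ (Modes g)) ∈ K := by
    intro x
    induction x using CliffordAlgebra.left_induction with
    | algebraMap r =>
      rw [Algebra.algebraMap_eq_smul_one, ← TensorProduct.smul_tmul']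
      exact K.smul_mem r h0
    | add a b ha hb =>
      rw [TensorProduct.add_tmul]
      exact add_mem ha hb
    | ι_mul x m hx => exact hιE m _ hx
  have h2 : ∀ (y z : SymmetricAlgebra ℂ (Modes g)) (x : ExteriorAlgebra ℂ (Modes g)),
      x ⊗ₜ[ℂ] z ∈ K → x ⊗ₜ[ℂ] (y * z) ∈ K := by
    intro y
    induction y using SymmetricAlgebra.induction with
    | algebraMap r =>
      intro z x h
      rw [← Algebra.smul_def, TensorProduct.tmul_smul]
      exact K.smul_mem r h
    | ι m => intro z x h; exact hιS m _ h
    | mul a b ha hb =>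
      intro z x h
      rw [mul_assoc]
      exact ha _ _ (hb _ _ h)
    | add a b ha hb =>
      intro z x h
      rw [add_mul, TensorProduct.tmul_add]
      exact add_mem (ha _ _ h) (hb _ _ h)
  rw [eq_top_iff]
  intro v _
  induction v using TensorProduct.induction_on with
  | zero => exact K.zero_mem
  | tmul x y => simpa using h2 y 1 x (h1 x)
  | add x y hx hy => exact K.add_mem (hx trivial) (hy trivial)

/-- The generators of `W(g)`, sorted by parity. -/
def generators : ℕ → Set (QO (Fock g))
  | 0 => Set.range β ∪ Set.range γ
  | 1 => Set.range b ∪ Set.range c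
  | _ => ∅

theorem W_eq_generated : W g = generated (⋃ i, generators i) := by
  rw [W]
  congr 1
  ext a
  simp only [Set.mem_iUnion]
  constructor
  · rintro (((h | h) | h) | h)
    · exact ⟨1, Or.inl h⟩
    · exact ⟨1, Or.inr h⟩
    · exact ⟨0, Or.inl h⟩
    · exact ⟨0, Or.inr h⟩
  · rintro ⟨i, h⟩
    match i, h with
    | 0, Or.inl h => exact Or.inl (Or.inr h)
    | 0, Or.inr h => exact Or.inr h
    | 1, Or.inl h => exact Or.inl (Or.inl (Or.inl h))
    | 1, Or.inr h => exact Or.inl (Or.inl (Or.inr h))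

theorem exists_field_of_mem_generators {i : ℕ} {a : QO (Fock g)} (h : a ∈ generators i) :
    (i = 0 ∧ ∃ u, a = fieldS u) ∨ (i = 1 ∧ ∃ u, a = fieldE u) := by
  match i, h with
  | 0, Or.inl ⟨x, h⟩ => exact Or.inl ⟨rfl, _, h.symm⟩
  | 0, Or.inr ⟨x, h⟩ => exact Or.inl ⟨rfl, _, h.symm⟩
  | 1, Or.inl ⟨x, h⟩ => exact Or.inr ⟨rfl, _, h.symm⟩
  | 1, Or.inr ⟨x, h⟩ => exact Or.inr ⟨rfl, _, h.symm⟩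

/-- The bracket is a scalar multiple of the formal delta function, whose coefficients depend only on
`p + q`; one factor `z - w` kills it. -/
theorem isLocal_of_delta {V : Type*} [AddCommGroup V] [Module ℂ V] {a b : QO V} {ε r : ℂ}
    (h : ∀ p q v, mode a p (mode b q v) - ε • mode b q (mode a p v) =
      if p + q = -1 then r • v else 0) : IsLocal ε a b := by
  refine ⟨1, ?_⟩
  funext p q
  ext v
  rw [pow_one, Diff.D_apply, kern_order_zero, kern_order_zero, LinearMap.sub_apply,
    LinearMap.sub_apply, LinearMap.sub_apply, LinearMap.smul_apply, LinearMap.smul_apply]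
  simp only [Module.End.mul_apply]
  rw [h, h, show p + 1 + q = p + (q + 1) by ring, sub_self]
  rfl

end Weil

/-! ### Linearity of the free fields; `W(g)` as a state space -/

theorem symDeriv_add {M : Type*} [AddCommGroup M] [Module ℂ M] (d d' : Module.Dual ℂ M)
    (x : SymmetricAlgebra ℂ M) : symDeriv (d + d') x = symDeriv d x + symDeriv d' x := by
  induction x using SymmetricAlgebra.induction with
  | algebraMap s => simp [symDeriv_algebraMap]
  | ι m => simp [symDeriv_ι]
  | mul a b ha hb =>
    simp only [symDeriv_mul, ha, hb]
    ring
  | add a b ha hb =>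
    simp only [map_add, ha, hb]
    abel

namespace Weil

open QO

variable {g : Type*} [LieRing g] [LieAlgebra ℂ g]

theorem pairing_add (s : ℂ) (u u' : g × Module.Dual ℂ g) (k : ℕ) :
    pairing s (u + u') k = pairing s u k + pairing s u' k := by
  ext m <;> simp [pairing] <;> ring

theorem pairing_smul (s r : ℂ) (u : g × Module.Dual ℂ g) (k : ℕ) :
    pairing s (r • u) k = r • pairing s u k := by
  ext m <;> simp [pairing] <;> ring

theorem modeE_add (u u' : g × Module.Dual ℂ g) (n : ℤ) (x : ExteriorAlgebra ℂ (Modes g)) :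
    modeE (u + u') n x = modeE u n x + modeE u' n x := by
  match n with
  | Int.ofNat k =>
    change CliffordAlgebra.contractLeft (pairing 1 (u + u') k) x = _
    rw [pairing_add, map_add]
    rfl
  | Int.negSucc k =>
    change ExteriorAlgebra.ι ℂ (Finsupp.single k (u + u')) * x = _
    rw [Finsupp.single_add, map_add, add_mul]
    rfl

theorem modeE_smul (r : ℂ) (u : g × Module.Dual ℂ g) (n : ℤ) (x : ExteriorAlgebra ℂ (Modes g)) :
    modeE (r • u) n x = r • modeE u n x := by
  match n with
  | Int.ofNat k =>
    change CliffordAlgebra.contractLeft (pairing 1 (r • u) k) x = _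
    rw [pairing_smul, map_smul]
    rfl
  | Int.negSucc k =>
    change ExteriorAlgebra.ι ℂ (Finsupp.single k (r • u)) * x = _
    rw [← Finsupp.smul_single, map_smul, smul_mul_assoc]
    rfl

theorem modeS_add (u u' : g × Module.Dual ℂ g) (n : ℤ) (x : SymmetricAlgebra ℂ (Modes g)) :
    modeS (u + u') n x = modeS u n x + modeS u' n x := by
  match n with
  | Int.ofNat k =>
    change symDeriv (pairing (-1) (u + u') k) x = _
    rw [pairing_add, symDeriv_add]
    rfl
  | Int.negSucc k =>
    change SymmetricAlgebra.ι ℂ _ (Finsupp.single k (u + u')) * x = _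
    rw [Finsupp.single_add, map_add, add_mul]
    rfl

theorem modeS_smul (r : ℂ) (u : g × Module.Dual ℂ g) (n : ℤ) (x : SymmetricAlgebra ℂ (Modes g)) :
    modeS (r • u) n x = r • modeS u n x := by
  match n with
  | Int.ofNat k =>
    change symDeriv (pairing (-1) (r • u) k) x = _
    rw [pairing_smul, symDeriv_smul]
    rfl
  | Int.negSucc k =>
    change SymmetricAlgebra.ι ℂ _ (Finsupp.single k (r • u)) * x = _
    rw [← Finsupp.smul_single, map_smul, smul_mul_assoc]
    rfl

theorem fieldE_add (u u' : g × Module.Dual ℂ g) : fieldE (u + u') = fieldE u + fieldE u' := by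
  refine ext_mode fun n => TensorProduct.ext' fun x y => ?_
  rw [mode_add, LinearMap.add_apply]
  simp only [mode_fieldE_tmul, modeE_add, TensorProduct.add_tmul]

theorem fieldE_smul (r : ℂ) (u : g × Module.Dual ℂ g) : fieldE (r • u) = r • fieldE u := by
  refine ext_mode fun n => TensorProduct.ext' fun x y => ?_
  rw [mode_smul, LinearMap.smul_apply]
  simp only [mode_fieldE_tmul, modeE_smul, TensorProduct.smul_tmul']

theorem fieldS_add (u u' : g × Module.Dual ℂ g) : fieldS (u + u') = fieldS u + fieldS u' := by
  refine ext_mode fun n => TensorProduct.ext' fun x y => ?_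
  rw [mode_add, LinearMap.add_apply]
  simp only [mode_fieldS_tmul, modeS_add, TensorProduct.tmul_add]

theorem fieldS_smul (r : ℂ) (u : g × Module.Dual ℂ g) : fieldS (r • u) = r • fieldS u := by
  refine ext_mode fun n => TensorProduct.ext' fun x y => ?_
  rw [mode_smul, LinearMap.smul_apply]
  simp only [mode_fieldS_tmul, modeS_smul, TensorProduct.tmul_smul]

/-- The odd fields as a linear map. -/
def fieldEL : (g × Module.Dual ℂ g) →ₗ[ℂ] QO (Fock g) where
  toFun := fieldE
  map_add' := fieldE_add
  map_smul' := fieldE_smul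

/-- The even fields as a linear map. -/
def fieldSL : (g × Module.Dual ℂ g) →ₗ[ℂ] QO (Fock g) where
  toFun := fieldS
  map_add' := fieldS_add
  map_smul' := fieldS_smul

theorem isStateSpace_W : IsStateSpace (W g) (vac g) := by
  rw [W_eq_generated]
  refine isStateSpace_generated ?_ ?_ ?_ parity_vac translation_vac ?_ ?_
  · intro i a ha
    obtain ⟨rfl, u, rfl⟩ | ⟨rfl, u, rfl⟩ := exists_field_of_mem_generators ha
    exacts [isHom_fieldS u, isHom_fieldE u]
  · intro i j a ha b hb
    obtain ⟨rfl, u, rfl⟩ | ⟨rfl, u, rfl⟩ := exists_field_of_mem_generators ha <;>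
      obtain ⟨rfl, u', rfl⟩ | ⟨rfl, u', rfl⟩ := exists_field_of_mem_generators hb
    · refine isLocal_of_delta (r := u'.2 u.1 - u.2 u'.1) fun p q v => ?_
      rw [← mode_fieldS_fieldS]
      simp
    · refine isLocal_of_delta (r := 0) fun p q v => ?_
      simp [mode_fieldE_fieldS]
    · refine isLocal_of_delta (r := 0) fun p q v => ?_
      simp [mode_fieldE_fieldS]
    · refine isLocal_of_delta (r := u'.2 u.1 + u.2 u'.1) fun p q v => ?_
      rw [← mode_fieldE_fieldE]
      simp
  · intro i a ha n
    obtain ⟨rfl, u, rfl⟩ | ⟨rfl, u, rfl⟩ := exists_field_of_mem_generators ha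
    exacts [mode_fieldS_vac u n, mode_fieldE_vac u n]
  · intro i a ha
    obtain ⟨rfl, u, rfl⟩ | ⟨rfl, u, rfl⟩ := exists_field_of_mem_generators ha
    exacts [covariant_fieldS u, covariant_fieldE u]
  · intro K h0 hK
    refine eq_top_of_vac_mem K h0 (fun u n v hv => ?_) fun u n v hv => ?_
    · rw [show u = (u.1, 0) + (0, u.2) by simp, fieldE_add, mode_add, LinearMap.add_apply]
      exact add_mem (hK 1 _ (Or.inl ⟨u.1, rfl⟩) n v hv) (hK 1 _ (Or.inr ⟨u.2, rfl⟩) n v hv)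
    · rw [show u = (u.1, 0) + (0, u.2) by simp, fieldS_add, mode_add, LinearMap.add_apply]
      exact add_mem (hK 0 _ (Or.inl ⟨u.1, rfl⟩) n v hv) (hK 0 _ (Or.inr ⟨u.2, rfl⟩) n v hv)

end Weil

/-! ### Even operators and mode calculus in a state space -/

namespace QO

open Finset Diff

section Even

variable {V : Type*} [AddCommGroup V] [Module ℂ V] [SuperSpace V]

/-- Parities are recorded as natural numbers that add up under products, so a product of two odd
fields comes out with parity `2` and has to be reduced. -/
theorem IsHom.of_add_self {k : ℕ} {a : QO V} (ha : IsHom (k + k) a) : IsHom 0 a := by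
  rw [IsHom] at *
  rw [ha, pow_add, sign_mul_self, pow_zero]

theorem IsHom.isOdd {a : QO V} (ha : IsHom 1 a) : IsOdd a := by
  refine ext_mode fun n => ?_
  rw [ha, mode_smul, mode_neg, pow_one, neg_one_smul]

theorem IsHom.isEven {a : QO V} (ha : IsHom 0 a) : IsEven a := by
  refine ext_mode fun n => ?_
  rw [ha, mode_smul, pow_zero, one_smul]

/-- No sign arises when one factor is even, so `b` need not be homogeneous. Invariants of the even
currents are arbitrary elements, which is where this matters. -/
theorem circ_of_even {a : QO V} (ha : IsHom 0 a) (n : ℤ) (b : QO V) :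
    circ n a b = circAux 1 n a b := by
  rw [← part_add_part b, circ_add, circAux_add, circ_of_isHom ha (isHom_part 0 b),
    circ_of_isHom ha (isHom_part 1 b)]
  simp

theorem bracket_of_even {a : QO V} (ha : IsHom 0 a) (b : QO V) :
    bracketL a b = kern 1 0 a b := by
  rw [← part_add_part b, map_add]
  funext p q
  have h0 := bracket_of_isHom ha (isHom_part 0 b) p q
  have h1 := bracket_of_isHom ha (isHom_part 1 b) p q
  rw [zero_mul, pow_zero] at h0 h1
  change bracket a (part 0 b) p q + bracket a (part 1 b) p q = _
  rw [h0, h1, kern, kern, kern, circAux_add, mode_add]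

omit [SuperSpace V] in
theorem deriv_add (a b : QO V) : deriv (a + b) = deriv a + deriv b :=
  ext_mode fun n => by simp only [mode_deriv, mode_add, smul_add]

theorem circ_neg_two_one (a : QO V) : circ (-2) a one = deriv a := by
  have h : ∀ i : Fin 2, circ (-2) (part i a) one = deriv (part i a) := by
    intro i
    rw [circ_of_isHom (isHom_part i a) isHom_one, mul_zero, pow_zero, circAux_neg_two_one]
  rw [← part_add_part a, circ_add_left, h, h, deriv_add]

theorem IsHom.deriv {k : ℕ} {a : QO V} (ha : IsHom k a) : IsHom k (deriv a) := by
  rw [← circ_neg_two_one]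
  exact ha.circ isHom_one (-2)

end Even

theorem ring_choose_two (p : ℤ) : ((Ring.choose p 2 : ℤ) : ℂ) = p * (p - 1) / 2 := by
  have h : ∀ p : ℤ, Ring.choose (p + 1) 2 = p + Ring.choose p 2 := by
    intro p
    rw [Ring.choose_succ_succ p 1, Ring.choose_one_right]
  induction p using Int.induction_on with
  | zero => rw [Ring.choose_zero_succ]; simp
  | succ i hi =>
    rw [h]
    push_cast at *
    rw [hi]
    ring
  | pred i hi =>
    have h1 := h (-i - 1)
    rw [sub_add_cancel] at h1
    rw [h1] at hi
    push_cast at *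
    linear_combination hi

namespace IsStateSpace

variable {V : Type*} [AddCommGroup V] [Module ℂ V] [SuperSpace V]
  {A : Submodule ℂ (QO V)} {vac : V} (hA : IsStateSpace A vac)

include hA

theorem ext_state {a b : QO V} (ha : a ∈ A) (hb : b ∈ A)
    (h : mode a (-1) vac = mode b (-1) vac) : a = b := by
  refine sub_eq_zero.1 (hA.eq_zero _ (sub_mem ha hb) ?_)
  rw [sub_eq_add_neg, ← neg_one_smul ℂ b, mode_add, mode_smul, LinearMap.add_apply,
    LinearMap.smul_apply, h]
  simp

/-- Splitting into parity components reduces to `circAux_state`. With `ext_state` it turns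
identities of circle products into identities of vectors. -/
theorem state_circ {a b : QO V} (ha : a ∈ A) (hb : b ∈ A) (n : ℤ) :
    mode (circ n a b) (-1) vac = mode a n (mode b (-1) vac) := by
  have h : ∀ i j : Fin 2, mode (circ n (part i a) (part j b)) (-1) vac =
      mode (part i a) n (mode (part j b) (-1) vac) := by
    intro i j
    rw [circ_of_isHom (isHom_part i a) (isHom_part j b)]
    exact circAux_state _ _ (hA.vacuum _ (hA.part_mem a ha i)) (hA.vacuum _ (hA.part_mem b hb j))
  conv_lhs => rw [← part_add_part a, ← part_add_part b]
  conv_rhs => rw [← part_add_part a, ← part_add_part b]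
  simp only [circ_add, circ_add_left, mode_add, LinearMap.add_apply, map_add, h]

theorem deriv_mem {a : QO V} (ha : a ∈ A) : deriv a ∈ A := by
  rw [← circ_neg_two_one]
  exact hA.circ_mem a ha _ hA.one_mem _

omit hA [SuperSpace V] in
theorem state_deriv (a : QO V) (v : V) : mode (deriv a) (-1) v = mode a (-2) v := by
  rw [mode_deriv]
  simp

omit hA [SuperSpace V] in
theorem state_one (v : V) : mode (one : QO V) (-1) v = v := by
  rw [mode_one]
  simp

/-- The commutator formula for homogeneous elements, in terms of the states `a(j) b(-1) vac`. -/
theorem comm {k l : ℕ} {a b : QO V} (ha : a ∈ A) (hb : b ∈ A) (hka : IsHom k a) (hlb : IsHom l b)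
    {N : ℕ} (f : ℕ → QO V) (hf : ∀ j, f j ∈ A) (hN : ∀ j, N ≤ j → f j = 0)
    (h : ∀ j : ℕ, mode a j (mode b (-1) vac) = mode (f j) (-1) vac) (p q : ℤ) (v : V) :
    mode a p (mode b q v) = (-1 : ℂ) ^ (k * l) • mode b q (mode a p v) +
      ∑ j ∈ range N, ((Ring.choose p j : ℤ) : ℂ) • mode (f j) (p + q - j) v := by
  have hc : ∀ j : ℕ, circAux ((-1 : ℂ) ^ (k * l)) j a b = f j := by
    intro j
    rw [← circ_of_isHom hka hlb]
    refine hA.ext_state (hA.circ_mem a ha b hb j) (hf j) ?_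
    rw [hA.state_circ ha hb, h]
  obtain ⟨M, hM⟩ := isLocal_of_quantumCommutes hka hlb (hA.quantumCommutes a ha b hb)
  -- The order `M` of locality is not known to be at most `N`. The formula is used with `max N M`,
  -- and the surplus terms drop out because `f j = 0` from `N` on.
  have h1 := commutator (D_pow_eq_zero_of_le (le_max_right N M) hM) p q
  have h2 := congrArg (fun T : Module.End ℂ V => T v) h1
  simp only [LinearMap.sub_apply, LinearMap.smul_apply, Module.End.mul_apply,
    LinearMap.sum_apply, hc] at h2
  rw [← sub_eq_iff_eq_add', h2]
  refine (sum_subset (range_mono (le_max_left N M)) fun j _ hj => ?_).symm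
  rw [hN j (by simpa using hj), mode_zero]
  simp

theorem comm_zero {k l : ℕ} {a b : QO V} (ha : a ∈ A) (hb : b ∈ A) (hka : IsHom k a)
    (hlb : IsHom l b) (h : ∀ j : ℕ, mode a j (mode b (-1) vac) = 0) (p q : ℤ) (v : V) :
    mode a p (mode b q v) = (-1 : ℂ) ^ (k * l) • mode b q (mode a p v) := by
  simpa using hA.comm ha hb hka hlb (N := 0) (fun _ => 0) (fun _ => A.zero_mem) (fun _ _ => rfl)
    (fun j => by rw [h, mode_zero]; rfl) p q v

theorem comm_three {k l : ℕ} {a b c₀ c₁ c₂ : QO V} (ha : a ∈ A) (hb : b ∈ A) (hka : IsHom k a)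
    (hlb : IsHom l b) (hc₀ : c₀ ∈ A) (hc₁ : c₁ ∈ A) (hc₂ : c₂ ∈ A)
    (h0 : mode a 0 (mode b (-1) vac) = mode c₀ (-1) vac)
    (h1 : mode a 1 (mode b (-1) vac) = mode c₁ (-1) vac)
    (h2 : mode a 2 (mode b (-1) vac) = mode c₂ (-1) vac)
    (h3 : ∀ j : ℕ, 3 ≤ j → mode a j (mode b (-1) vac) = 0) (p q : ℤ) (v : V) :
    mode a p (mode b q v) = (-1 : ℂ) ^ (k * l) • mode b q (mode a p v) +
      (mode c₀ (p + q) v + (p : ℂ) • mode c₁ (p + q - 1) v +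
        ((p : ℂ) * (p - 1) / 2) • mode c₂ (p + q - 2) v) := by
  let f : ℕ → QO V := fun j => match j with
    | 0 => c₀
    | 1 => c₁
    | 2 => c₂
    | _ => 0
  have := hA.comm ha hb hka hlb (N := 3) f
    (fun j => match j with
      | 0 => hc₀
      | 1 => hc₁
      | 2 => hc₂
      | _ + 3 => A.zero_mem)
    (fun j hj => match j, hj with
      | _ + 3, _ => rfl)
    (fun j => match j with
      | 0 => h0
      | 1 => h1
      | 2 => h2
      | j + 3 => by
        rw [h3 (j + 3) (by lia)]
        change _ = mode (0 : QO V) (-1) vac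
        rw [mode_zero]
        rfl) p q v
  rw [this]
  simp only [sum_range_succ, range_zero, sum_empty, zero_add, f, Ring.choose_zero_right,
    Ring.choose_one_right, ring_choose_two]
  simp

theorem comm_two {k l : ℕ} {a b c₀ c₁ : QO V} (ha : a ∈ A) (hb : b ∈ A) (hka : IsHom k a)
    (hlb : IsHom l b) (hc₀ : c₀ ∈ A) (hc₁ : c₁ ∈ A)
    (h0 : mode a 0 (mode b (-1) vac) = mode c₀ (-1) vac)
    (h1 : mode a 1 (mode b (-1) vac) = mode c₁ (-1) vac)
    (h2 : ∀ j : ℕ, 2 ≤ j → mode a j (mode b (-1) vac) = 0) (p q : ℤ) (v : V) :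
    mode a p (mode b q v) = (-1 : ℂ) ^ (k * l) • mode b q (mode a p v) +
      (mode c₀ (p + q) v + (p : ℂ) • mode c₁ (p + q - 1) v) := by
  have := hA.comm_three ha hb hka hlb hc₀ hc₁ A.zero_mem h0 h1
    (by rw [mode_zero]; exact h2 2 le_rfl) (fun j hj => h2 j (by lia)) p q v
  simpa [mode_zero] using this

theorem comm_one {k l : ℕ} {a b c₀ : QO V} (ha : a ∈ A) (hb : b ∈ A) (hka : IsHom k a)
    (hlb : IsHom l b) (hc₀ : c₀ ∈ A)
    (h0 : mode a 0 (mode b (-1) vac) = mode c₀ (-1) vac)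
    (h1 : ∀ j : ℕ, 1 ≤ j → mode a j (mode b (-1) vac) = 0) (p q : ℤ) (v : V) :
    mode a p (mode b q v) = (-1 : ℂ) ^ (k * l) • mode b q (mode a p v) + mode c₀ (p + q) v := by
  have := hA.comm_two ha hb hka hlb hc₀ A.zero_mem h0
    (by rw [mode_zero]; exact h1 1 le_rfl) (fun j hj => h1 j (by lia)) p q v
  simpa [mode_zero] using this

theorem circ_eq_zero {a b : QO V} (ha : a ∈ A) (hb : b ∈ A) {n : ℤ}
    (h : mode a n (mode b (-1) vac) = 0) : circ n a b = 0 :=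
  hA.eq_zero _ (hA.circ_mem a ha b hb n) (by rw [hA.state_circ ha hb, h])

theorem circ_eq {a b c : QO V} (ha : a ∈ A) (hb : b ∈ A) (hc : c ∈ A) {n : ℤ}
    (h : mode a n (mode b (-1) vac) = mode c (-1) vac) : circ n a b = c :=
  hA.ext_state (hA.circ_mem a ha b hb n) hc (by rw [hA.state_circ ha hb, h])

/-- By the commutator formula all brackets of modes are combinations of modes of the nonnegative
circle products. -/
theorem commutes_of_even {a b : QO V} (ha : a ∈ A) (hb : b ∈ A) (h0 : IsHom 0 a)
    (h : ∀ n : ℕ, circ n a b = 0) : Commutes a b := by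
  obtain ⟨N, hN⟩ := (quantumCommutes_iff a b).1 (hA.quantumCommutes a ha b hb)
  rw [bracket_of_even h0] at hN
  intro p q
  change bracketL a b p q = 0
  rw [bracket_of_even h0, kern_order_zero, commutator hN]
  refine sum_eq_zero fun k _ => ?_
  rw [← circ_of_even h0, h, mode_zero]
  simp

theorem mode_comm_of_even {a b : QO V} (ha : a ∈ A) (hb : b ∈ A) (h0 : IsHom 0 a)
    (h : ∀ n : ℕ, circ n a b = 0) (p q : ℤ) (v : V) :
    mode a p (mode b q v) = mode b q (mode a p v) := by
  have h1 : bracketL a b p q = 0 := hA.commutes_of_even ha hb h0 h p q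
  rw [bracket_of_even h0, kern_order_zero] at h1
  have h2 := congrArg (fun T : Module.End ℂ V => T v) h1
  simp only [LinearMap.sub_apply, Module.End.mul_apply, one_smul] at h2
  exact sub_eq_zero.1 h2

/-- The commutant of a family of even elements is a vertex algebra. -/
theorem isVertexAlgebra_commutant {κ : Type*} {Θ : κ → QO V} (hΘ : ∀ x, Θ x ∈ A)
    (hΘ0 : ∀ x, IsHom 0 (Θ x)) {B : Submodule ℂ (QO V)}
    (hB : ∀ a, a ∈ B ↔ a ∈ A ∧ ∀ (x : κ) (n : ℕ), circ n (Θ x) a = 0) : IsVertexAlgebra B where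
  one_mem := (hB _).2 ⟨hA.one_mem, fun x n => hA.circ_eq_zero (hΘ x) hA.one_mem (by
    rw [state_one]
    exact hA.vacuum _ (hΘ x) n)⟩
  circ_mem a ha b hb m := by
    obtain ⟨ha, ha'⟩ := (hB a).1 ha
    obtain ⟨hb, hb'⟩ := (hB b).1 hb
    refine (hB _).2 ⟨hA.circ_mem a ha b hb m, fun x n =>
      hA.circ_eq_zero (hΘ x) (hA.circ_mem a ha b hb m) ?_⟩
    -- The modes of `Θ x` commute with those of `a`, so they pass to the state of `b`, which they
    -- annihilate.
    rw [hA.state_circ ha hb, hA.mode_comm_of_even (hΘ x) ha (hΘ0 x) (ha' x),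
      ← hA.state_circ (hΘ x) hb, hb', mode_zero]
    simp
  quantumCommutes a ha b hb := hA.quantumCommutes a ((hB a).1 ha).1 b ((hB b).1 hb).1

set_option maxHeartbeats 800000 in
/-- The topological vertex algebra axioms follow from the operator products of `J`, `G` and `F`
with `J` and `G`. -/
theorem isTVA_of_ope {B : Submodule ℂ (QO V)} (hB : IsVertexAlgebra B) (hBA : B ≤ A)
    {L F J G : QO V} (hL : L ∈ B) (hF : F ∈ B) (hJ : J ∈ B) (hG : G ∈ B) (hL0 : IsHom 0 L)
    (hF0 : IsHom 0 F) (hJ1 : IsHom 1 J) (hG1 : IsHom 1 G) (d : ℂ)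
    (hJJ : ∀ n : ℕ, mode J n (mode J (-1) vac) = 0)
    (hGG : ∀ n : ℕ, mode G n (mode G (-1) vac) = 0)
    (hFJ : ∀ n : ℕ, mode F n (mode J (-1) vac) = if n = 0 then mode J (-1) vac else 0)
    (hFG : ∀ n : ℕ, mode F n (mode G (-1) vac) = if n = 0 then -mode G (-1) vac else 0)
    (hJG0 : mode J 0 (mode G (-1) vac) = mode L (-1) vac)
    (hJG1 : mode J 1 (mode G (-1) vac) = mode F (-1) vac)
    (hJG2 : mode J 2 (mode G (-1) vac) = d • vac)
    (hJG3 : ∀ n : ℕ, 3 ≤ n → mode J n (mode G (-1) vac) = 0) : IsTVA B L F J G := by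
  have hLA := hBA hL
  have hFA := hBA hF
  have hJA := hBA hJ
  have hGA := hBA hG
  have JJ : ∀ p q v, mode J p (mode J q v) = -mode J q (mode J p v) := by
    intro p q v
    simpa using hA.comm_zero hJA hJA hJ1 hJ1 hJJ p q v
  have GG : ∀ p q v, mode G p (mode G q v) = -mode G q (mode G p v) := by
    intro p q v
    simpa using hA.comm_zero hGA hGA hG1 hG1 hGG p q v
  have JJ' : ∀ p v, mode J p (mode J p v) = 0 := fun p v => eq_zero_of_eq_neg (JJ p p v)
  have GG' : ∀ p v, mode G p (mode G p v) = 0 := fun p v => eq_zero_of_eq_neg (GG p p v)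
  have FJ : ∀ p q v, mode F p (mode J q v) = mode J q (mode F p v) + mode J (p + q) v := by
    intro p q v
    simpa using hA.comm_one hFA hJA hF0 hJ1 hJA (by simpa using hFJ 0)
      (fun j hj => by rw [hFJ, if_neg (by lia)]) p q v
  have FG : ∀ p q v, mode F p (mode G q v) = mode G q (mode F p v) - mode G (p + q) v := by
    intro p q v
    have := hA.comm_one hFA hGA hF0 hG1 (A.smul_mem (-1) hGA)
      (by simpa [mode_smul, mode_neg] using hFG 0) (fun j hj => by rw [hFG, if_neg (by lia)]) p q v
    simpa [mode_smul, mode_neg, sub_eq_add_neg] using this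
  have JG : ∀ p q v, mode J p (mode G q v) = -mode G q (mode J p v) +
      (mode L (p + q) v + (p : ℂ) • mode F (p + q - 1) v +
        ((p : ℂ) * (p - 1) / 2) • mode (d • one) (p + q - 2) v) := by
    intro p q v
    have := hA.comm_three hJA hGA hJ1 hG1 hLA hFA (A.smul_mem d hA.one_mem) hJG0 hJG1
      (by rw [hJG2, mode_smul, LinearMap.smul_apply, state_one]) hJG3 p q v
    simpa using this
  have hvac : ∀ {a : QO V}, a ∈ A → ∀ n : ℤ, 0 ≤ n → mode a n vac = 0 := by
    intro a ha n hn
    lift n to ℕ using hn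
    exact hA.vacuum a ha n
  have LJG : ∀ n v, mode L n v = mode J 0 (mode G n v) + mode G n (mode J 0 v) := by
    intro n v
    rw [JG]
    simp
  have LG : ∀ p q v, mode L p (mode G q v) = mode G q (mode L p v) +
      ((p - q : ℤ) : ℂ) • mode G (p + q - 1) v := by
    intro p q v
    -- The bracket of `J(p-q)` and `G(q)` contains `L(p)`, while `G(q)² = 0`. Applying it after
    -- `G(q)` and before `G(q)` and comparing eliminates `J` and leaves the commutator of `L(p)`
    -- with `G(q)`, up to that of `F(p-1)` with `G(q)`, which is known.
    have h1 := JG (p - q) q (mode G q v)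
    have h2 := congrArg (mode G q) (JG (p - q) q v)
    rw [GG', map_zero] at h1
    rw [map_add, map_neg, GG', neg_zero, zero_add, map_add, map_add, map_smul, map_smul] at h2
    rw [h2] at h1
    rw [sub_add_cancel, FG, mode_smul, mode_one] at h1
    have h3 : p - 1 + q = p + q - 1 := by ring
    rw [h3] at h1
    rw [← sub_eq_zero]
    refine Eq.trans ?_ h1.symm
    split_ifs
    · simp only [LinearMap.smul_apply, LinearMap.id_apply, map_smul]
      module
    · simp
      module
  -- `L(n)` is the anticommutator of `J(0)` and `G(n)`, and `J(0)² = 0`.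
  have LJ0 : ∀ n v, mode L n (mode J 0 v) = mode J 0 (mode L n v) := by
    intro n v
    rw [LJG, LJG, JJ', map_zero, map_add, JJ', add_zero, zero_add]
  have LG' : ∀ n : ℕ, mode L n (mode G (-1) vac) = ((n + 1 : ℤ) : ℂ) • mode G (n - 2) vac := by
    intro n
    rw [LG, hvac hLA n (by lia), map_zero, zero_add, show (n : ℤ) - -1 = n + 1 by ring,
      show (n : ℤ) + -1 - 1 = n - 2 by ring]
  -- The state of `L` is `J(0)` applied to the state of `G`. As `L(n)` commutes with `J(0)`, the
  -- action on `L` is the image under `J(0)` of the action on `G`; no central term can appear.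
  have LL' : ∀ n : ℕ, mode L n (mode L (-1) vac) = ((n + 1 : ℤ) : ℂ) • mode L (n - 2) vac := by
    intro n
    rw [← hJG0, LJ0, LG', map_smul, LJG (n - 2) vac, hvac hJA 0 le_rfl, map_zero, add_zero]
  have JF : ∀ n : ℕ, mode J n (mode F (-1) vac) = if n = 0 then -mode J (-1) vac else 0 := by
    intro n
    have h := FJ (-1) n vac
    rw [hvac hJA n (by lia), map_zero] at h
    rw [eq_neg_of_add_eq_zero_left h.symm]
    split_ifs with h0
    · simp [h0]
    · rw [hvac hJA (-1 + n) (by lia), neg_zero]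
  have GF : ∀ n : ℕ, mode G n (mode F (-1) vac) = if n = 0 then mode G (-1) vac else 0 := by
    intro n
    have h := FG (-1) n vac
    rw [hvac hGA n (by lia), map_zero] at h
    rw [sub_eq_zero.1 h.symm]
    split_ifs with h0
    · simp [h0]
    · rw [hvac hGA (-1 + n) (by lia)]
  have GJ : ∀ n : ℕ, mode G n (mode J (-1) vac) =
      mode L (n - 1) vac - mode F (n - 2) vac + mode (d • one) (n - 3) vac := by
    intro n
    -- The operator product in the opposite order, read off on the vacuum; at `p = -1` the
    -- coefficients `p` and `p (p - 1) / 2` are `-1` and `1`.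
    have h := JG (-1) n vac
    rw [hvac hGA n (by lia), map_zero] at h
    rw [show -1 + (n : ℤ) = n - 1 by ring,
      show (n : ℤ) - 1 - 1 = n - 2 by ring, show (n : ℤ) - 1 - 2 = n - 3 by ring] at h
    rw [eq_neg_add_iff_add_eq, add_zero] at h
    rw [h]
    push_cast
    module
  have JFn : ∀ n, mode J 0 (mode F n vac) = -mode J n vac := by
    intro n
    have h := FJ n 0 vac
    rw [hvac hJA 0 le_rfl, map_zero, add_zero] at h
    exact eq_neg_of_add_eq_zero_left h.symm
  have JLn : ∀ n, mode J 0 (mode L n vac) = 0 := by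
    intro n
    rw [← LJ0, hvac hJA 0 le_rfl, map_zero]
  have one' : ∀ n : ℤ, 0 ≤ n → mode (d • one : QO V) n vac = 0 := fun n hn =>
    hvac (A.smul_mem d hA.one_mem) n hn
  have J_one : ∀ n, mode J 0 (mode (d • one : QO V) n vac) = 0 := by
    intro n
    rw [mode_smul, mode_one]
    split_ifs
    · simp only [LinearMap.smul_apply, LinearMap.id_apply, map_smul, hvac hJA 0 le_rfl, smul_zero]
    · simp
  have LJ' : ∀ n : ℕ, mode L n (mode J (-1) vac) = mode J (n - 2) vac := by
    intro n
    rw [LJG, JJ 0, hvac hJA 0 le_rfl, map_zero, neg_zero, map_zero, add_zero, GJ, map_add, map_sub,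
      JLn, JFn, J_one]
    simp
  -- Expanding `L(n)` as an anticommutator requires only the action of `J` and `G` on `F` and of `G`
  -- on `J`; the product of `F` with itself does not enter.
  have LF' : ∀ n : ℕ, mode L n (mode F (-1) vac) =
      mode F (n - 2) vac - mode (d • one) (n - 3) vac := by
    intro n
    have h0 := JF 0
    rw [if_pos rfl, Nat.cast_zero] at h0
    rw [LJG, GF, h0, map_neg, GJ]
    split_ifs with h
    · subst h
      rw [hJG0]
      simp only [Nat.cast_zero, zero_sub]
      abel
    · rw [map_zero, hvac hLA (n - 1) (by lia)]
      abel
  exact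
    { vertexAlgebra := hB
      L_mem := hL
      F_mem := hF
      J_mem := hJ
      G_mem := hG
      L_even := hL0.isEven
      F_even := hF0.isEven
      J_odd := hJ1.isOdd
      G_odd := hG1.isOdd
      L_virasoro :=
        { circ_zero := hA.circ_eq hLA hLA (hA.deriv_mem hLA) (by
            rw [state_deriv]; simpa using LL' 0)
          circ_one := hA.circ_eq hLA hLA (A.smul_mem _ hLA) (by
            rw [mode_smul, LinearMap.smul_apply]
            have := LL' 1
            norm_num at this
            exact this)
          circ_ge := fun n hn => hA.circ_eq_zero hLA hLA (by
            rw [LL', hvac hLA (n - 2) (by lia), smul_zero]) }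
      F_quasiPrimary :=
        { circ_zero := hA.circ_eq hLA hFA (hA.deriv_mem hFA) (by
            rw [state_deriv]
            have := LF' 0
            rw [mode_smul, mode_one, if_neg (by simp)] at this
            simpa using this)
          circ_one := hA.circ_eq hLA hFA hFA (by
            have := LF' 1
            rw [mode_smul, mode_one, if_neg (by simp)] at this
            norm_num at this
            simpa using this)
          -- The anomaly of the ghost number current is minus the coefficient of the third order
          -- pole of `J` with `G`.
          circ_two := ⟨-d, hA.circ_eq hLA hFA (A.smul_mem _ hA.one_mem) (by
            have h := LF' 2
            rw [show ((2 : ℕ) : ℤ) - 2 = 0 by norm_num, show ((2 : ℕ) : ℤ) - 3 = -1 by norm_num,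
              hvac hFA 0 le_rfl, zero_sub, mode_smul, LinearMap.smul_apply, state_one] at h
            rw [mode_smul, LinearMap.smul_apply, state_one, neg_smul]
            exact h)⟩
          circ_ge := fun n hn => hA.circ_eq_zero hLA hFA (by
            rw [LF', hvac hFA (n - 2) (by lia), one' (n - 3) (by lia), sub_zero]) }
      J_primary :=
        { circ_zero := hA.circ_eq hLA hJA (hA.deriv_mem hJA) (by
            rw [state_deriv]; simpa using LJ' 0)
          circ_one := hA.circ_eq hLA hJA (A.smul_mem _ hJA) (by
            rw [one_smul]
            have := LJ' 1
            norm_num at this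
            simpa using this)
          circ_ge := fun n hn => hA.circ_eq_zero hLA hJA (by
            rw [LJ', hvac hJA (n - 2) (by lia)]) }
      G_primary :=
        { circ_zero := hA.circ_eq hLA hGA (hA.deriv_mem hGA) (by
            rw [state_deriv]; simpa using LG' 0)
          circ_one := hA.circ_eq hLA hGA (A.smul_mem _ hGA) (by
            rw [mode_smul, LinearMap.smul_apply]
            have := LG' 1
            norm_num at this
            exact this)
          circ_ge := fun n hn => hA.circ_eq_zero hLA hGA (by
            rw [LG', hvac hGA (n - 2) (by lia), smul_zero]) }
      J_J := fun n => hA.circ_eq_zero hJA hJA (hJJ n)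
      G_G := fun n => hA.circ_eq_zero hGA hGA (hGG n)
      J_G := hA.circ_eq hJA hGA hLA hJG0
      F_J := hA.circ_eq hFA hJA hJA (by simpa using hFJ 0)
      F_G := hA.circ_eq hFA hGA (A.neg_mem hGA) (by
        have := hFG 0
        rw [← neg_one_smul ℂ G, mode_smul]
        simpa using this) }

end IsStateSpace

end QO

/-! ### Orthonormal bases of the Killing form -/

namespace KillingBasis

open Finset

variable {g : Type*} [LieRing g] [LieAlgebra ℂ g] {ι : Type*} [Fintype ι] [DecidableEq ι]
  {ξ : Module.Basis ι ℂ g}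

theorem killing_lie (x y z : g) : killingForm ℂ g ⁅x, y⁆ z = killingForm ℂ g x ⁅y, z⁆ :=
  LieModule.traceForm_apply_lie_apply ℂ g g x y z

theorem killing_comm (x y : g) : killingForm ℂ g x y = killingForm ℂ g y x :=
  LieModule.traceForm_comm ℂ g g x y

theorem killing_lie_left (x y z : g) : killingForm ℂ g ⁅x, y⁆ z = -killingForm ℂ g y ⁅x, z⁆ := by
  rw [← lie_skew, map_neg, LinearMap.neg_apply, killing_lie]

section

variable (hξ : ∀ i j, killingForm ℂ g (ξ i) (ξ j) = if i = j then 1 else 0)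

include hξ

omit [Fintype ι] in
theorem coord_eq (i : ι) : ξ.coord i = killingForm ℂ g (ξ i) := by
  refine ξ.ext fun j => ?_
  rw [hξ, ξ.coord_apply, ξ.repr_self, Finsupp.single_apply]
  simp only [eq_comm]

theorem sum_killing_smul (x : g) : ∑ i, killingForm ℂ g x (ξ i) • ξ i = x := by
  conv_rhs => rw [← ξ.sum_repr x]
  refine sum_congr rfl fun i _ => ?_
  rw [← ξ.coord_apply, coord_eq hξ, killing_comm]

theorem sum_killing_smul_map {V : Type*} [AddCommGroup V] [Module ℂ V] (φ : g →ₗ[ℂ] V) (x : g) :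
    ∑ i, killingForm ℂ g x (ξ i) • φ (ξ i) = φ x := by
  conv_rhs => rw [← sum_killing_smul hξ x, map_sum]
  simp

/-- The tensor `∑ ξᵢ ⊗ ξᵢ` is ad-invariant: in an orthonormal basis the matrix of `ad x` is
antisymmetric. Stated for an arbitrary bilinear `Φ`, it is what moves a bracket from one field of a
product to the other. -/
theorem sum_lie_left {V : Type*} [AddCommGroup V] [Module ℂ V] (Φ : g →ₗ[ℂ] g →ₗ[ℂ] V) (x : g) :
    ∑ i, Φ ⁅x, ξ i⁆ (ξ i) = -∑ i, Φ (ξ i) ⁅x, ξ i⁆ := by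
  have h1 : ∀ i, Φ ⁅x, ξ i⁆ (ξ i) =
      ∑ j, killingForm ℂ g ⁅x, ξ i⁆ (ξ j) • Φ (ξ j) (ξ i) := fun i =>
    (sum_killing_smul_map hξ (Φ.flip (ξ i)) ⁅x, ξ i⁆).symm
  have h2 : ∀ i, Φ (ξ i) ⁅x, ξ i⁆ =
      ∑ j, killingForm ℂ g ⁅x, ξ i⁆ (ξ j) • Φ (ξ i) (ξ j) := fun i =>
    (sum_killing_smul_map hξ (Φ (ξ i)) ⁅x, ξ i⁆).symm
  simp only [h1, h2]
  rw [sum_comm, ← sum_neg_distrib]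
  refine sum_congr rfl fun i _ => ?_
  rw [← sum_neg_distrib]
  refine sum_congr rfl fun j _ => ?_
  rw [killing_lie_left, killing_comm, neg_smul]

theorem killing_eq_sum (x y : g) :
    killingForm ℂ g x y = ∑ i, killingForm ℂ g ⁅x, ⁅y, ξ i⁆⁆ (ξ i) := by
  rw [killingForm_apply_apply, LinearMap.trace_eq_matrix_trace ℂ ξ, Matrix.trace]
  refine sum_congr rfl fun i _ => ?_
  rw [Matrix.diag_apply, LinearMap.toMatrix_apply, ← ξ.coord_apply, coord_eq hξ, killing_comm]
  rfl

/-- Pairing the Casimir element's action on `x` with `y` gives, by invariance, the trace of `ad x ∘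
ad y` in an orthonormal basis, which is the Killing form of `x` and `y` again. Nondegeneracy gives
the eigenvalue `1`. -/
theorem casimir (x : g) : ∑ i, ⁅ξ i, ⁅ξ i, x⁆⁆ = x := by
  have h : ∀ y, killingForm ℂ g (∑ i, ⁅ξ i, ⁅ξ i, x⁆⁆) y = killingForm ℂ g x y := by
    intro y
    rw [killing_eq_sum hξ x y, map_sum, LinearMap.sum_apply]
    refine sum_congr rfl fun i _ => ?_
    rw [killing_lie_left, killing_lie_left x, ← lie_skew (ξ i) x, ← lie_skew (ξ i) y,
      killing_comm ⁅y, ξ i⁆]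
    simp only [map_neg, LinearMap.neg_apply, neg_neg]
  rw [← sum_killing_smul hξ (∑ i, ⁅ξ i, ⁅ξ i, x⁆⁆)]
  simp only [h]
  exact sum_killing_smul hξ x

theorem casimir' (x : g) : ∑ i, ⁅ξ i, ⁅x, ξ i⁆⁆ = -x := by
  conv_rhs => rw [← casimir hξ x, ← sum_neg_distrib]
  refine sum_congr rfl fun i _ => ?_
  rw [← lie_skew x, lie_neg]

end

end KillingBasis

/-! ### Affine currents bilinear in free fields -/

namespace QO

open Finset KillingBasis

section

variable {V : Type*} [AddCommGroup V] [Module ℂ V]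

/-- The modes of index `n` as a linear map. -/
def modeL (n : ℤ) : QO V →ₗ[ℂ] Module.End ℂ V where
  toFun a := mode a n
  map_add' a b := mode_add a b n
  map_smul' r a := mode_smul r a n

/-- The bilinear map `(x, y) ↦ a^x(m) b^y(n) v`. -/
def modeBil {g : Type*} [AddCommGroup g] [Module ℂ g] (a b : g →ₗ[ℂ] QO V) (m n : ℤ) (v : V) :
    g →ₗ[ℂ] g →ₗ[ℂ] V :=
  LinearMap.mk₂ ℂ (fun x y => mode (a x) m (mode (b y) n v))
    (by intros; simp [mode_add]) (by intros; simp [mode_smul]) (by intros; simp [mode_add])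
    (by intros; simp [mode_smul])

end

namespace IsStateSpace

variable {V : Type*} [AddCommGroup V] [Module ℂ V] [SuperSpace V]
  {A : Submodule ℂ (QO V)} {vac : V} (hA : IsStateSpace A vac)
  {g : Type*} [LieRing g] [LieAlgebra ℂ g] {ι : Type*} [Fintype ι] [DecidableEq ι]
  {ξ : Module.Basis ι ℂ g}

/-- A dual pair of free fields `B^x(z) C^y(w) ∼ κ(x, y) (z-w)^{-1}` of parity `p`, with the sign
`ε = (-1)^p`. -/
structure FreePair (A : Submodule ℂ (QO V)) (ε : ℂ) (p : ℕ) (B C : g →ₗ[ℂ] QO V) : Prop where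
  memB : ∀ x, B x ∈ A
  memC : ∀ x, C x ∈ A
  homB : ∀ x, IsHom p (B x)
  homC : ∀ x, IsHom p (C x)
  sign : (-1 : ℂ) ^ p = ε
  sign' : (-1 : ℂ) ^ (p * p) = ε
  BB : ∀ x y m n v, mode (B x) m (mode (B y) n v) = ε • mode (B y) n (mode (B x) m v)
  CC : ∀ x y m n v, mode (C x) m (mode (C y) n v) = ε • mode (C y) n (mode (C x) m v)
  BC : ∀ x y m n v, mode (B x) m (mode (C y) n v) = ε • mode (C y) n (mode (B x) m v) +
    if m + n = -1 then killingForm ℂ g x y • v else 0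

variable {ε : ℂ} {p : ℕ} {B C Θ : g →ₗ[ℂ] QO V}

omit [DecidableEq ι] [Fintype ι] in
theorem FreePair.sq (h : FreePair A ε p B C) : ε * ε = 1 := by
  rw [← h.sign, sign_mul_self]

include hA in
theorem vac_eq_zero {a : QO V} (ha : a ∈ A) {n : ℤ} (hn : 0 ≤ n) : mode a n vac = 0 := by
  lift n to ℕ using hn
  exact hA.vacuum a ha n

theorem FreePair.CB (h : FreePair A ε p B C) (x y : g) (m n : ℤ) (v : V) :
    mode (C x) m (mode (B y) n v) = ε • mode (B y) n (mode (C x) m v) -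
      if m + n = -1 then (ε * killingForm ℂ g x y) • v else 0 := by
  rw [h.BC y x n m v, smul_add, smul_smul, h.sq, one_smul, add_comm n m]
  split_ifs
  · rw [smul_smul, killing_comm]
    abel
  · simp

section

variable (hξ : ∀ i j, killingForm ℂ g (ξ i) (ξ j) = if i = j then 1 else 0)
  (h : FreePair A ε p B C) (hΘA : ∀ x, Θ x ∈ A) (hΘ0 : ∀ x, IsHom 0 (Θ x))
  (hΘ : ∀ x, mode (Θ x) (-1) vac =
    -ε • ∑ i, mode (B ⁅x, ξ i⁆) (-1) (mode (C (ξ i)) (-1) vac))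

include hA hξ h hΘA hΘ0 hΘ

/-- Only the state of `Θ x` is known explicitly, so the free field is applied to it: one contraction
survives and leaves a multiple of `B ⁅x, y⁆`. The commutator formula is then read backwards. The
factor `-ε` in `Θ` normalises the action to the adjoint one. -/
theorem bilinear_current_left (x y : g) (m n : ℤ) (v : V) :
    mode (Θ x) m (mode (B y) n v) = mode (B y) n (mode (Θ x) m v) + mode (B ⁅x, y⁆) (m + n) v := by
  have key : ∀ j : ℕ, mode (B y) j (mode (Θ x) (-1) vac) =
      if j = 0 then -mode (B ⁅x, y⁆) (-1) vac else 0 := by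
    intro j
    have h1 : ∀ i, mode (B y) j (mode (B ⁅x, ξ i⁆) (-1) (mode (C (ξ i)) (-1) vac)) =
        if j = 0 then ε • killingForm ℂ g y (ξ i) • mode (B ⁅x, ξ i⁆) (-1) vac else 0 := by
      intro i
      rw [h.BB, h.BC, hA.vac_eq_zero (h.memB y) (by lia), map_zero, smul_zero, zero_add]
      by_cases hj : j = 0
      · rw [if_pos hj, if_pos (by lia), map_smul]
      · rw [if_neg hj, if_neg (by lia), map_zero, smul_zero]
    rw [hΘ, map_smul, map_sum, sum_congr rfl fun i _ => h1 i]
    split_ifs with hj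
    · rw [← smul_sum, smul_smul, neg_mul, h.sq]
      have h2 := sum_killing_smul_map hξ
        (((modeL (-1) ∘ₗ B) ∘ₗ (LieAlgebra.ad ℂ g x : Module.End ℂ g)).flip vac) y
      change ∑ i, killingForm ℂ g y (ξ i) • mode (B ⁅x, ξ i⁆) (-1) vac =
        mode (B ⁅x, y⁆) (-1) vac at h2
      rw [h2, neg_smul, one_smul]
    · simp
  have h3 := hA.comm_one (h.memB y) (hΘA x) (h.homB y) (hΘ0 x) (A.neg_mem (h.memB ⁅x, y⁆))
    (by rw [mode_neg]; simpa using key 0) (fun j hj => by rw [key, if_neg (by lia)]) n m v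
  rw [h3, mode_neg, add_comm n m]
  simp

/-- As for `B`, except that the contraction is with `B ⁅x, ξᵢ⁆`, and invariance of the Killing form
moves the bracket onto `C`. -/
theorem bilinear_current_right (x y : g) (m n : ℤ) (v : V) :
    mode (Θ x) m (mode (C y) n v) = mode (C y) n (mode (Θ x) m v) + mode (C ⁅x, y⁆) (m + n) v := by
  have key : ∀ j : ℕ, mode (C y) j (mode (Θ x) (-1) vac) =
      if j = 0 then -mode (C ⁅x, y⁆) (-1) vac else 0 := by
    intro j
    have h1 : ∀ i, mode (C y) j (mode (B ⁅x, ξ i⁆) (-1) (mode (C (ξ i)) (-1) vac)) =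
        if j = 0 then (ε * killingForm ℂ g ⁅x, y⁆ (ξ i)) • mode (C (ξ i)) (-1) vac else 0 := by
      intro i
      rw [h.CB, h.CC, hA.vac_eq_zero (h.memC y) (by lia), map_zero, smul_zero, map_zero, smul_zero,
        zero_sub]
      by_cases hj : j = 0
      · rw [if_pos hj, if_pos (by lia), killing_comm y, killing_lie_left x, killing_comm (ξ i),
          mul_neg, neg_smul, neg_neg]
      · rw [if_neg hj, if_neg (by lia), neg_zero]
    rw [hΘ, map_smul, map_sum, sum_congr rfl fun i _ => h1 i]
    split_ifs with hj
    · simp only [← smul_smul]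
      rw [← smul_sum, smul_smul, neg_mul, h.sq]
      have h2 := sum_killing_smul_map hξ ((modeL (-1) ∘ₗ C).flip vac) ⁅x, y⁆
      change ∑ i, killingForm ℂ g ⁅x, y⁆ (ξ i) • mode (C (ξ i)) (-1) vac =
        mode (C ⁅x, y⁆) (-1) vac at h2
      rw [h2, neg_smul, one_smul]
    · simp
  have h3 := hA.comm_one (h.memC y) (hΘA x) (h.homC y) (hΘ0 x) (A.neg_mem (h.memC ⁅x, y⁆))
    (by rw [mode_neg]; simpa using key 0) (fun j hj => by rw [key, if_neg (by lia)]) n m v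
  rw [h3, mode_neg, add_comm n m]
  simp

/-- The currents `Θ^x = -ε ∑ᵢ :B^{[x, ξᵢ]} C^{ξᵢ}:` generate an affine Lie algebra at level `-ε`
with respect to the Killing form. -/
theorem bilinear_current_comm (x y : g) (m n : ℤ) (v : V) :
    mode (Θ x) m (mode (Θ y) n v) = mode (Θ y) n (mode (Θ x) m v) + mode (Θ ⁅x, y⁆) (m + n) v +
      if m + n = 0 then (m * (-ε * killingForm ℂ g x y)) • v else 0 := by
  have hB := hA.bilinear_current_left hξ h hΘA hΘ0 hΘ
  have hC := hA.bilinear_current_right hξ h hΘA hΘ0 hΘ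
  have key : ∀ j : ℕ, mode (Θ x) j (mode (Θ y) (-1) vac) =
      -ε • ∑ i, (mode (B ⁅x, ⁅y, ξ i⁆⁆) (j - 1) (mode (C (ξ i)) (-1) vac) +
        mode (B ⁅y, ξ i⁆) (-1) (mode (C ⁅x, ξ i⁆) (j - 1) vac)) := by
    intro j
    rw [hΘ, map_smul, map_sum]
    congr 1
    refine sum_congr rfl fun i _ => ?_
    rw [hB, hC, hA.vac_eq_zero (hΘA x) (by lia), map_zero, zero_add, add_comm]
    rfl
  -- Moving `ad x` from `C` to `B` by invariance turns the two terms into `ad x ∘ ad y - ad y ∘ ad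
  -- x`, which the Jacobi identity evaluates.
  have key0 : mode (Θ x) 0 (mode (Θ y) (-1) vac) = mode (Θ ⁅x, y⁆) (-1) vac := by
    have := key 0
    rw [Nat.cast_zero, zero_sub] at this
    rw [this, hΘ]
    congr 1
    have h2 := sum_lie_left hξ (modeBil (B ∘ₗ (LieAlgebra.ad ℂ g y : Module.End ℂ g)) C
      (-1) (-1) vac) x
    change ∑ i, mode (B ⁅y, ⁅x, ξ i⁆⁆) (-1) (mode (C (ξ i)) (-1) vac) =
      -∑ i, mode (B ⁅y, ξ i⁆) (-1) (mode (C ⁅x, ξ i⁆) (-1) vac) at h2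
    rw [sum_add_distrib, ← neg_eq_iff_eq_neg.2 h2, ← sub_eq_add_neg, ← sum_sub_distrib]
    refine sum_congr rfl fun i _ => ?_
    rw [← LinearMap.sub_apply, ← mode_sub, ← map_sub]
    congr 4
    rw [lie_lie]
  -- The double contraction occurs only at `j = 1` and is the trace of `ad x ∘ ad y`; this is where
  -- the level comes from.
  have keyj : ∀ j : ℕ, 1 ≤ j → mode (Θ x) j (mode (Θ y) (-1) vac) =
      if j = 1 then (-ε * killingForm ℂ g x y) • vac else 0 := by
    intro j hj
    have h1 : ∀ i, mode (B ⁅x, ⁅y, ξ i⁆⁆) (j - 1) (mode (C (ξ i)) (-1) vac) +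
        mode (B ⁅y, ξ i⁆) (-1) (mode (C ⁅x, ξ i⁆) (j - 1) vac) =
          if j = 1 then killingForm ℂ g ⁅x, ⁅y, ξ i⁆⁆ (ξ i) • vac else 0 := by
      intro i
      rw [hA.vac_eq_zero (h.memC ⁅x, ξ i⁆) (by lia), map_zero, add_zero, h.BC,
        hA.vac_eq_zero (h.memB ⁅x, ⁅y, ξ i⁆⁆) (by lia), map_zero, smul_zero, zero_add]
      exact if_congr (by lia) rfl rfl
    rw [key, sum_congr rfl fun i _ => h1 i]
    split_ifs
    · rw [← sum_smul, ← killing_eq_sum hξ, smul_smul]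
    · simp
  have h4 := hA.comm_two (hΘA x) (hΘA y) (hΘ0 x) (hΘ0 y) (hΘA ⁅x, y⁆)
    (A.smul_mem (-ε * killingForm ℂ g x y) hA.one_mem) key0
    (by
      rw [mode_smul, LinearMap.smul_apply, state_one]
      simpa using keyj 1 le_rfl)
    (fun j hj => by rw [keyj j (by lia), if_neg (by lia)]) m n v
  rw [h4, mode_smul, mode_one]
  by_cases hmn : m + n = 0
  · rw [if_pos (by lia), if_pos hmn]
    simp only [LinearMap.smul_apply, LinearMap.id_apply, mul_zero, pow_zero, one_smul, smul_smul]
    abel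
  · rw [if_neg (by lia), if_neg hmn]
    simp

end

end IsStateSpace

end QO

/-! ### Ghost systems and the BRST vector -/

namespace QO

open Finset KillingBasis IsStateSpace

/-- Relabelling the indices cyclically does not change the sum, so three times the sum is zero. -/
theorem sum_eq_zero_of_cyclic {ι V : Type*} [Fintype ι] [AddCommGroup V] [Module ℂ V]
    (f : ι → ι → ι → V) (h : ∀ i j k, f i j k + f j k i + f k i j = 0) :
    ∑ i, ∑ j, ∑ k, f i j k = 0 := by
  have h1 : ∑ i, ∑ j, ∑ k, f j k i = ∑ i, ∑ j, ∑ k, f i j k := by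
    rw [sum_comm]
    exact sum_congr rfl fun j _ => sum_comm
  have h2 : ∑ i, ∑ j, ∑ k, f k i j = ∑ i, ∑ j, ∑ k, f i j k := by
    exact (sum_congr rfl fun i _ => sum_comm).trans sum_comm
  have h3 : ∑ i, ∑ j, ∑ k, (f i j k + f j k i + f k i j) = 0 :=
    sum_eq_zero fun i _ => sum_eq_zero fun j _ => sum_eq_zero fun k _ => h i j k
  simp only [sum_add_distrib] at h3
  rw [h1, h2] at h3
  have h4 : (3 : ℂ) • ∑ i, ∑ j, ∑ k, f i j k = 0 := by
    rw [← h3]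
    module
  exact (smul_eq_zero.1 h4).resolve_left three_ne_zero

variable {V : Type*} [AddCommGroup V] [Module ℂ V] [SuperSpace V]
  {A : Submodule ℂ (QO V)} {vac : V}
  {g : Type*} [LieRing g] [LieAlgebra ℂ g] {ι : Type*} [Fintype ι] [DecidableEq ι]
  {ξ : Module.Basis ι ℂ g} {B C S W : g →ₗ[ℂ] QO V}

/-- The bilinear map `(x, y) ↦ a^x(m) φ(y)`. -/
def modeComp (a : g →ₗ[ℂ] QO V) (m : ℤ) (φ : g →ₗ[ℂ] V) : g →ₗ[ℂ] g →ₗ[ℂ] V :=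
  LinearMap.mk₂ ℂ (fun x y => mode (a x) m (φ y))
    (by intros; simp [mode_add]) (by intros; simp [mode_smul]) (by intros; simp)
    (by intros; simp)

/-- The linear map `x ↦ a^x(m) v`. -/
def modeApply (a : g →ₗ[ℂ] QO V) (m : ℤ) (v : V) : g →ₗ[ℂ] V := (modeL m ∘ₗ a).flip v

/-- An odd dual pair `B`, `C`, even currents `S` at level `-1` which commute with the pair, and the
total currents `W`, at level `0`. -/
structure GhostSystem (A : Submodule ℂ (QO V)) (vac : V) (ξ : Module.Basis ι ℂ g)
    (B C S W : g →ₗ[ℂ] QO V) : Prop where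
  pair : FreePair A (-1) 1 B C
  memS : ∀ x, S x ∈ A
  memW : ∀ x, W x ∈ A
  homS : ∀ x, IsHom 0 (S x)
  homW : ∀ x, IsHom 0 (W x)
  SS : ∀ x y m n v, mode (S x) m (mode (S y) n v) = mode (S y) n (mode (S x) m v) +
    mode (S ⁅x, y⁆) (m + n) v - if m + n = 0 then (m * killingForm ℂ g x y) • v else 0
  WS : ∀ x y m n v, mode (W x) m (mode (S y) n v) = mode (S y) n (mode (W x) m v) +
    mode (S ⁅x, y⁆) (m + n) v - if m + n = 0 then (m * killingForm ℂ g x y) • v else 0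
  WW : ∀ x y m n v, mode (W x) m (mode (W y) n v) = mode (W y) n (mode (W x) m v) +
    mode (W ⁅x, y⁆) (m + n) v
  WB : ∀ x y m n v, mode (W x) m (mode (B y) n v) = mode (B y) n (mode (W x) m v) +
    mode (B ⁅x, y⁆) (m + n) v
  WC : ∀ x y m n v, mode (W x) m (mode (C y) n v) = mode (C y) n (mode (W x) m v) +
    mode (C ⁅x, y⁆) (m + n) v
  SB : ∀ x y m n v, mode (S x) m (mode (B y) n v) = mode (B y) n (mode (S x) m v)
  SC : ∀ x y m n v, mode (S x) m (mode (C y) n v) = mode (C y) n (mode (S x) m v)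
  state : ∀ x, mode (W x) (-1) vac = mode (S x) (-1) vac +
    ∑ i, mode (B ⁅x, ξ i⁆) (-1) (mode (C (ξ i)) (-1) vac)

namespace GhostSystem

omit [DecidableEq ι] in
theorem CC (D : GhostSystem A vac ξ B C S W) (x y : g) (m n : ℤ) (v : V) :
    mode (C x) m (mode (C y) n v) = -mode (C y) n (mode (C x) m v) := by
  rw [D.pair.CC, neg_smul, one_smul]

omit [DecidableEq ι] in
theorem BC (D : GhostSystem A vac ξ B C S W) (x y : g) (m n : ℤ) (v : V) :
    mode (B x) m (mode (C y) n v) = -mode (C y) n (mode (B x) m v) +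
      if m + n = -1 then killingForm ℂ g x y • v else 0 := by
  rw [D.pair.BC, neg_smul, one_smul]

omit [DecidableEq ι] in
theorem CB (D : GhostSystem A vac ξ B C S W) (x y : g) (m n : ℤ) (v : V) :
    mode (C x) m (mode (B y) n v) = -mode (B y) n (mode (C x) m v) +
      if m + n = -1 then killingForm ℂ g x y • v else 0 := by
  rw [D.pair.CB, neg_smul, one_smul, sub_eq_add_neg]
  split_ifs
  · simp
  · simp

omit [DecidableEq ι] in
theorem SW (D : GhostSystem A vac ξ B C S W) (x y : g) (m n : ℤ) (v : V) :
    mode (S x) m (mode (W y) n v) = mode (W y) n (mode (S x) m v) +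
      mode (S ⁅x, y⁆) (m + n) v - if m + n = 0 then (m * killingForm ℂ g x y) • v else 0 := by
  rw [D.WS y x n m v, ← lie_skew y x, map_neg, mode_neg, add_comm n m, killing_comm y x]
  split_ifs with h
  · rw [show (n : ℂ) = -m by
      have : n = -m := by lia
      rw [this]
      push_cast
      ring]
    simp
    abel
  · simp

section

variable (hA : IsStateSpace A vac)
  (hξ : ∀ i j, killingForm ℂ g (ξ i) (ξ j) = if i = j then 1 else 0)
  (D : GhostSystem A vac ξ B C S W)

-- Two signs cancel: one from moving the bracket to the other factor, one from anticommuting `B`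
-- past `C`. Hence the bilinear expression for the ghost current is symmetric in the pair.
include hξ in
theorem sum_CB (hD : GhostSystem A vac ξ B C S W) (x : g) :
    ∑ i, mode (C ⁅x, ξ i⁆) (-1) (mode (B (ξ i)) (-1) vac) =
      ∑ i, mode (B ⁅x, ξ i⁆) (-1) (mode (C (ξ i)) (-1) vac) := by
  have h := sum_lie_left hξ (modeComp C (-1) (modeApply B (-1) vac)) x
  change ∑ i, mode (C ⁅x, ξ i⁆) (-1) (mode (B (ξ i)) (-1) vac) =
    -∑ i, mode (C (ξ i)) (-1) (mode (B ⁅x, ξ i⁆) (-1) vac) at h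
  rw [h, ← sum_neg_distrib]
  refine sum_congr rfl fun i _ => ?_
  rw [hD.CB, if_neg (by norm_num), add_zero, neg_neg]

include hξ in
/-- The ghost system is symmetric in `B` and `C`. -/
theorem swap (D : GhostSystem A vac ξ B C S W) : GhostSystem A vac ξ C B S W where
  pair :=
    { memB := D.pair.memC
      memC := D.pair.memB
      homB := D.pair.homC
      homC := D.pair.homB
      sign := D.pair.sign
      sign' := D.pair.sign'
      BB := D.pair.CC
      CC := D.pair.BB
      BC := fun x y m n v => by rw [D.CB, neg_smul, one_smul] }
  memS := D.memS
  memW := D.memW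
  homS := D.homS
  homW := D.homW
  SS := D.SS
  WS := D.WS
  WW := D.WW
  WB := D.WC
  WC := D.WB
  SB := D.SC
  SC := D.SB
  state := fun x => by rw [D.state, sum_CB hξ D]

/-- The vector `∑ᵢ (S^{ξᵢ} + W^{ξᵢ}) C^{ξᵢ}`. -/
def brst (vac : V) (ξ : Module.Basis ι ℂ g) (C S W : g →ₗ[ℂ] QO V) : V :=
  ∑ i, (mode (S (ξ i)) (-1) (mode (C (ξ i)) (-1) vac) +
    mode (W (ξ i)) (-1) (mode (C (ξ i)) (-1) vac))

-- At `j = 0` this is ad-invariance of `∑ ξᵢ ⊗ ξᵢ`. At `j = 1` the central term of `W` with `S`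
-- contributes `-C x`, while `W` rotating `C` twice contributes `∑ ⁅⁅x, ξᵢ⁆, ξᵢ⁆`, which the Casimir
-- identity evaluates to `x`; the two cancel. Higher modes find nothing to contract.
include hA hξ D in
theorem W_brst (x : g) (j : ℕ) : mode (W x) j (brst vac ξ C S W) = 0 := by
  have h1 : ∀ i, mode (W x) j (mode (S (ξ i)) (-1) (mode (C (ξ i)) (-1) vac) +
      mode (W (ξ i)) (-1) (mode (C (ξ i)) (-1) vac)) =
      (mode (S (ξ i)) (-1) (mode (C ⁅x, ξ i⁆) (j - 1) vac) +
        mode (W (ξ i)) (-1) (mode (C ⁅x, ξ i⁆) (j - 1) vac)) +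
      ((mode (S ⁅x, ξ i⁆) (j - 1) (mode (C (ξ i)) (-1) vac) +
        mode (W ⁅x, ξ i⁆) (j - 1) (mode (C (ξ i)) (-1) vac)) -
        if j = 1 then killingForm ℂ g x (ξ i) • mode (C (ξ i)) (-1) vac else 0) := by
    intro i
    rw [map_add, D.WS, D.WW, D.WC, hA.vac_eq_zero (D.memW x) (by lia), map_zero, zero_add]
    by_cases hj : j = 1
    · subst hj
      simp
      abel
    · rw [if_neg hj, if_neg (by lia)]
      simp only [sub_zero]
      rw [show (j : ℤ) + -1 = j - 1 by ring]
      abel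
  rw [brst, map_sum, sum_congr rfl fun i _ => h1 i, sum_add_distrib]
  rcases Nat.lt_trichotomy j 1 with hj | rfl | hj
  · obtain rfl : j = 0 := by lia
    have h2 := sum_lie_left hξ (modeComp (S + W) (-1) (modeApply C (-1) vac)) x
    change ∑ i, mode (S ⁅x, ξ i⁆ + W ⁅x, ξ i⁆) (-1) (mode (C (ξ i)) (-1) vac) =
      -∑ i, mode (S (ξ i) + W (ξ i)) (-1) (mode (C ⁅x, ξ i⁆) (-1) vac) at h2
    simp only [mode_add, LinearMap.add_apply] at h2
    simp only [Nat.cast_zero, zero_sub, if_neg zero_ne_one, sub_zero]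
    rw [h2, add_neg_cancel]
  · simp only [Nat.cast_one, sub_self, if_true]
    have h2 : ∀ i, mode (C ⁅x, ξ i⁆) 0 vac = 0 := fun i =>
      hA.vac_eq_zero (D.pair.memC _) le_rfl
    have h3 : ∀ i, mode (S ⁅x, ξ i⁆) 0 (mode (C (ξ i)) (-1) vac) = 0 := fun i => by
      rw [D.SC, hA.vac_eq_zero (D.memS _) le_rfl, map_zero]
    have h4 : ∀ i, mode (W ⁅x, ξ i⁆) 0 (mode (C (ξ i)) (-1) vac) =
        mode (C ⁅⁅x, ξ i⁆, ξ i⁆) (-1) vac := fun i => by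
      rw [D.WC, hA.vac_eq_zero (D.memW _) le_rfl, map_zero, zero_add, zero_add]
    simp only [h2, h3, h4, map_zero, add_zero, zero_add, sum_const_zero, sum_sub_distrib]
    have h5 := sum_killing_smul_map hξ (modeApply C (-1) vac) x
    change ∑ i, killingForm ℂ g x (ξ i) • mode (C (ξ i)) (-1) vac = mode (C x) (-1) vac at h5
    have h6 : ∑ i, mode (C ⁅⁅x, ξ i⁆, ξ i⁆) (-1) vac = mode (C x) (-1) vac := by
      change ∑ i, modeApply C (-1) vac ⁅⁅x, ξ i⁆, ξ i⁆ = modeApply C (-1) vac x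
      have h7 : ∑ i, ⁅⁅x, ξ i⁆, ξ i⁆ = x := by
        rw [sum_congr rfl fun i _ => (lie_skew ⁅x, ξ i⁆ (ξ i)).symm, sum_neg_distrib,
          casimir' hξ, neg_neg]
      rw [← map_sum, h7]
    rw [h5, h6, sub_self]
  · have h2 : ∀ i, mode (C ⁅x, ξ i⁆) (j - 1) vac = 0 := fun i =>
      hA.vac_eq_zero (D.pair.memC _) (by lia)
    have h3 : ∀ i, mode (S ⁅x, ξ i⁆) (j - 1) (mode (C (ξ i)) (-1) vac) = 0 := fun i => by
      rw [D.SC, hA.vac_eq_zero (D.memS ⁅x, ξ i⁆) (by lia), map_zero]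
    have h4 : ∀ i, mode (W ⁅x, ξ i⁆) (j - 1) (mode (C (ξ i)) (-1) vac) = 0 := fun i => by
      rw [D.WC, hA.vac_eq_zero (D.memW ⁅x, ξ i⁆) (by lia), map_zero, zero_add,
        hA.vac_eq_zero (D.pair.memC ⁅⁅x, ξ i⁆, ξ i⁆) (by lia)]
    simp only [h2, h3, h4, map_zero, if_neg hj.ne']
    simp

/-- The field `∑ᵢ :S^{[x, ξᵢ]} C^{ξᵢ}:`. -/
def rotS (ξ : Module.Basis ι ℂ g) (C S : g →ₗ[ℂ] QO V) (x : g) : QO V :=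
  ∑ i, circ (-1) (S ⁅x, ξ i⁆) (C (ξ i))

/-- The field `∑ᵢ :C^{[x, ξᵢ]} C^{ξᵢ}:`. -/
def rotC (ξ : Module.Basis ι ℂ g) (C : g →ₗ[ℂ] QO V) (x : g) : QO V :=
  ∑ i, circ (-1) (C ⁅x, ξ i⁆) (C (ξ i))

include hA D

omit [DecidableEq ι] in
theorem rotS_mem (x : g) : rotS ξ C S x ∈ A :=
  sum_mem fun _ _ => hA.circ_mem _ (D.memS _) _ (D.pair.memC _) _

omit [DecidableEq ι] in
theorem rotC_mem (x : g) : rotC ξ C x ∈ A :=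
  sum_mem fun _ _ => hA.circ_mem _ (D.pair.memC _) _ (D.pair.memC _) _

omit hA [DecidableEq ι] in
theorem isHom_rotS (x : g) : IsHom 1 (rotS ξ C S x) :=
  IsHom.sum fun i _ => (D.homS ⁅x, ξ i⁆).circ (D.pair.homC (ξ i)) (-1)

omit [DecidableEq ι] in
theorem rotS_state (x : g) : mode (rotS ξ C S x) (-1) vac =
    ∑ i, mode (S ⁅x, ξ i⁆) (-1) (mode (C (ξ i)) (-1) vac) := by
  rw [rotS, mode_sum, LinearMap.sum_apply]
  exact sum_congr rfl fun i _ => hA.state_circ (D.memS _) (D.pair.memC _) _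

omit [DecidableEq ι] in
theorem rotC_state (x : g) : mode (rotC ξ C x) (-1) vac =
    ∑ i, mode (C ⁅x, ξ i⁆) (-1) (mode (C (ξ i)) (-1) vac) := by
  rw [rotC, mode_sum, LinearMap.sum_apply]
  exact sum_congr rfl fun i _ => hA.state_circ (D.pair.memC _) (D.pair.memC _) _

omit [DecidableEq ι] in
theorem C_rotS (x y : g) (m n : ℤ) (v : V) : mode (C y) m (mode (rotS ξ C S x) n v) =
    -mode (rotS ξ C S x) n (mode (C y) m v) := by
  have h := hA.comm_zero (D.pair.memC y) (rotS_mem hA D x) (D.pair.homC y) (isHom_rotS D x)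
    (fun j => by
      rw [rotS_state hA D, map_sum]
      refine sum_eq_zero fun i _ => ?_
      rw [← D.SC, D.CC, hA.vac_eq_zero (D.pair.memC y) (by lia)]
      simp) m n v
  simpa using h

include hξ

theorem B_rotS (x y : g) (m n : ℤ) (v : V) : mode (B y) m (mode (rotS ξ C S x) n v) =
    -mode (rotS ξ C S x) n (mode (B y) m v) + mode (S ⁅x, y⁆) (m + n) v := by
  have key : ∀ j : ℕ, mode (B y) j (mode (rotS ξ C S x) (-1) vac) =
      if j = 0 then mode (S ⁅x, y⁆) (-1) vac else 0 := by
    intro j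
    have h1 : ∀ i, mode (B y) j (mode (S ⁅x, ξ i⁆) (-1) (mode (C (ξ i)) (-1) vac)) =
        if j = 0 then killingForm ℂ g y (ξ i) • mode (S ⁅x, ξ i⁆) (-1) vac else 0 := by
      intro i
      rw [← D.SB, D.BC, hA.vac_eq_zero (D.pair.memB y) (by lia), map_zero, neg_zero, zero_add]
      by_cases hj : j = 0
      · rw [if_pos hj, if_pos (by lia), map_smul]
      · rw [if_neg hj, if_neg (by lia), map_zero]
    rw [rotS_state hA D, map_sum, sum_congr rfl fun i _ => h1 i]
    split_ifs
    · exact sum_killing_smul_map hξ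
        (modeApply S (-1) vac ∘ₗ (LieAlgebra.ad ℂ g x : Module.End ℂ g)) y
    · simp
  have h := hA.comm_one (D.pair.memB y) (rotS_mem hA D x) (D.pair.homB y) (isHom_rotS D x)
    (D.memS ⁅x, y⁆) (by simpa using key 0) (fun j hj => by rw [key, if_neg (by lia)]) m n v
  simpa using h

variable {K : QO V} (hK : K ∈ A) (hK1 : IsHom 1 K)
  (hKs : mode K (-1) vac = brst vac ξ C S W)

include hK hK1 hKs

theorem W_K (x : g) (m n : ℤ) (v : V) :
    mode (W x) m (mode K n v) = mode K n (mode (W x) m v) := by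
  have h := hA.comm_zero (D.memW x) hK (D.homW x) hK1
    (fun j => by rw [hKs, W_brst hA hξ D]) m n v
  simpa using h

/-- The currents `S` alone do not leave `K` invariant. Both halves of `K` contribute equally, since
`S` has the same bracket and central term with `W` as with `S`; this explains the factors `2`. -/
theorem S_K (x : g) (m n : ℤ) (v : V) :
    mode (S x) m (mode K n v) = mode K n (mode (S x) m v) +
      ((2 : ℂ) • mode (rotS ξ C S x) (m + n) v - (2 * m : ℂ) • mode (C x) (m + n - 1) v) := by
  have key : ∀ j : ℕ, mode (S x) j (brst vac ξ C S W) =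
      (2 : ℂ) • ∑ i, (mode (S ⁅x, ξ i⁆) (j - 1) (mode (C (ξ i)) (-1) vac)) -
        if j = 1 then (2 : ℂ) • mode (C x) (-1) vac else 0 := by
    intro j
    have h1 : ∀ i, mode (S x) j (mode (S (ξ i)) (-1) (mode (C (ξ i)) (-1) vac) +
        mode (W (ξ i)) (-1) (mode (C (ξ i)) (-1) vac)) =
        (2 : ℂ) • (mode (S ⁅x, ξ i⁆) (j - 1) (mode (C (ξ i)) (-1) vac)) -
          if j = 1 then (2 : ℂ) • killingForm ℂ g x (ξ i) • mode (C (ξ i)) (-1) vac else 0 := by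
      intro i
      rw [map_add, D.SS, D.SW, D.SC, hA.vac_eq_zero (D.memS x) (by lia)]
      simp only [map_zero, zero_add]
      by_cases hj : j = 1
      · subst hj
        simp
        module
      · rw [if_neg hj, if_neg (by lia), show (j : ℤ) + -1 = j - 1 by ring]
        module
    rw [brst, map_sum, sum_congr rfl fun i _ => h1 i, sum_sub_distrib, smul_sum]
    congr 1
    split_ifs
    · rw [← smul_sum]
      congr 1
      exact sum_killing_smul_map hξ (modeApply C (-1) vac) x
    · simp
  have key' : ∀ j : ℕ, 1 ≤ j → mode (S x) j (brst vac ξ C S W) =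
      -if j = 1 then (2 : ℂ) • mode (C x) (-1) vac else 0 := by
    intro j hj
    rw [key, sum_eq_zero, smul_zero, zero_sub]
    intro i _
    rw [D.SC, hA.vac_eq_zero (D.memS ⁅x, ξ i⁆) (by lia), map_zero]
  have h := hA.comm_two (D.memS x) hK (D.homS x) hK1
    (A.smul_mem 2 (rotS_mem hA D x)) (A.smul_mem (-2) (D.pair.memC x))
    (by
      rw [hKs, mode_smul, LinearMap.smul_apply, rotS_state hA D]
      simpa using key 0)
    (by
      rw [hKs, mode_smul, LinearMap.smul_apply]
      have := key' 1 le_rfl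
      rw [if_pos rfl] at this
      rw [neg_smul]
      exact_mod_cast this)
    (fun j hj => by rw [hKs, key' j (by lia), if_neg (by lia), neg_zero]) m n v
  rw [h]
  simp only [mode_smul, LinearMap.smul_apply, zero_mul, pow_zero, one_smul]
  module

-- Computed by applying `C x` to the state of `K`: `S` and the ghosts `C` do not contract with `C
-- x`, so only its rotation by `W` contributes. The result is the Chevalley-Eilenberg differential
-- of a ghost.
omit hξ [DecidableEq ι] in
theorem K_C (x : g) (n : ℕ) :
    mode K n (mode (C x) (-1) vac) = if n = 0 then mode (rotC ξ C x) (-1) vac else 0 := by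
  have key : ∀ j : ℕ, mode (C x) j (brst vac ξ C S W) =
      if j = 0 then mode (rotC ξ C x) (-1) vac else 0 := by
    intro j
    have h1 : ∀ i, mode (C x) j (mode (S (ξ i)) (-1) (mode (C (ξ i)) (-1) vac) +
        mode (W (ξ i)) (-1) (mode (C (ξ i)) (-1) vac)) =
        mode (C ⁅x, ξ i⁆) (j - 1) (mode (C (ξ i)) (-1) vac) := by
      intro i
      have h2 := D.WC (ξ i) x (-1) j (mode (C (ξ i)) (-1) vac)
      have h3 : mode (C x) j (mode (C (ξ i)) (-1) vac) = 0 := by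
        rw [D.CC, hA.vac_eq_zero (D.pair.memC x) (by lia), map_zero, neg_zero]
      rw [h3, map_zero] at h2
      rw [map_add, ← D.SC, h3, map_zero, zero_add, eq_neg_of_add_eq_zero_left h2.symm,
        ← lie_skew (ξ i) x, map_neg, mode_neg, LinearMap.neg_apply, neg_neg,
        show -1 + (j : ℤ) = j - 1 by ring]
    rw [brst, map_sum, sum_congr rfl fun i _ => h1 i]
    split_ifs with hj
    · subst hj
      rw [rotC_state hA D]
      simp
    · refine sum_eq_zero fun i _ => ?_
      rw [D.CC, hA.vac_eq_zero (D.pair.memC ⁅x, ξ i⁆) (by lia), map_zero, neg_zero]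
  have h := hA.comm_one (D.pair.memC x) hK (D.pair.homC x) hK1 (rotC_mem hA D x)
    (by rw [hKs]; simpa using key 0) (fun j hj => by rw [hKs, key, if_neg (by lia)]) (-1) n vac
  rw [hA.vac_eq_zero hK (by lia), map_zero] at h
  have h4 : mode K n (mode (C x) (-1) vac) = mode (rotC ξ C x) (-1 + n) vac := by
    rw [mul_one, pow_one, neg_smul, one_smul] at h
    exact (neg_add_eq_zero.1 h.symm)
  rw [h4]
  split_ifs with hn
  · simp [hn]
  · exact hA.vac_eq_zero (rotC_mem hA D x) (by lia)

/-- Contracting `B x` with `C` gives `S x + W x`, and the rotation of `B x` by `W` gives the ghost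
part of `W x`; together they make `2 W x`. The possible double contraction is `κ(⁅x, ξᵢ⁆, ξᵢ) = 0`.
-/
theorem K_B (x : g) (n : ℕ) :
    mode K n (mode (B x) (-1) vac) = if n = 0 then (2 : ℂ) • mode (W x) (-1) vac else 0 := by
  have key : ∀ j : ℕ, mode (B x) j (brst vac ξ C S W) =
      if j = 0 then (2 : ℂ) • mode (W x) (-1) vac else 0 := by
    intro j
    have h1 : ∀ i, mode (B x) j (mode (S (ξ i)) (-1) (mode (C (ξ i)) (-1) vac) +
        mode (W (ξ i)) (-1) (mode (C (ξ i)) (-1) vac)) =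
        if j = 0 then killingForm ℂ g x (ξ i) • mode (S (ξ i)) (-1) vac +
          killingForm ℂ g x (ξ i) • mode (W (ξ i)) (-1) vac +
            mode (B ⁅x, ξ i⁆) (-1) (mode (C (ξ i)) (-1) vac) else 0 := by
      intro i
      have h2 := D.WB (ξ i) x (-1) j (mode (C (ξ i)) (-1) vac)
      have h3 : mode (B x) j (mode (C (ξ i)) (-1) vac) =
          if j = 0 then killingForm ℂ g x (ξ i) • vac else 0 := by
        rw [D.BC, hA.vac_eq_zero (D.pair.memB x) (by lia), map_zero, neg_zero, zero_add]
        exact if_congr (by lia) rfl rfl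
      rw [← lie_skew (ξ i) x, map_neg, mode_neg, LinearMap.neg_apply, ← sub_eq_add_neg,
        eq_sub_iff_add_eq] at h2
      rw [map_add, ← D.SB, ← h2, h3]
      by_cases hj : j = 0
      · subst hj
        simp
        abel
      · rw [if_neg hj, if_neg hj, map_zero, map_zero, zero_add, zero_add, D.BC,
          hA.vac_eq_zero (D.pair.memB ⁅x, ξ i⁆) (by lia), map_zero, neg_zero, zero_add]
        split_ifs
        · rw [killing_lie, lie_self, map_zero, zero_smul]
        · rfl
    rw [brst, map_sum, sum_congr rfl fun i _ => h1 i]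
    split_ifs with hj
    · rw [sum_add_distrib, sum_add_distrib]
      have h4 := sum_killing_smul_map hξ (modeApply S (-1) vac) x
      have h5 := sum_killing_smul_map hξ (modeApply W (-1) vac) x
      change ∑ i, killingForm ℂ g x (ξ i) • mode (S (ξ i)) (-1) vac = mode (S x) (-1) vac at h4
      change ∑ i, killingForm ℂ g x (ξ i) • mode (W (ξ i)) (-1) vac = mode (W x) (-1) vac at h5
      rw [h4, h5, D.state]
      module
    · simp
  have h := hA.comm_one (D.pair.memB x) hK (D.pair.homB x) hK1 (A.smul_mem 2 (D.memW x))
    (by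
      rw [hKs, mode_smul, LinearMap.smul_apply]
      simpa using key 0) (fun j hj => by rw [hKs, key, if_neg (by lia)]) (-1) n vac
  rw [hA.vac_eq_zero hK (by lia), map_zero] at h
  have h4 : mode K n (mode (B x) (-1) vac) = (2 : ℂ) • mode (W x) (-1 + n) vac := by
    rw [mul_one, pow_one, neg_smul, one_smul, mode_smul] at h
    exact (neg_add_eq_zero.1 h.symm)
  rw [h4]
  split_ifs with hn
  · simp [hn]
  · rw [hA.vac_eq_zero (D.memW x) (by lia), smul_zero]

end

end GhostSystem

end QO

/-! ### Operator products of the BRST field -/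

namespace QO

open Finset KillingBasis IsStateSpace

namespace GhostSystem

variable {V : Type*} [AddCommGroup V] [Module ℂ V] [SuperSpace V]
  {A : Submodule ℂ (QO V)} {vac : V}
  {g : Type*} [LieRing g] [LieAlgebra ℂ g] {ι : Type*} [Fintype ι] [DecidableEq ι]
  {ξ : Module.Basis ι ℂ g} {B C S W : g →ₗ[ℂ] QO V}
  (hA : IsStateSpace A vac)
  (hξ : ∀ i j, killingForm ℂ g (ξ i) (ξ j) = if i = j then 1 else 0)
  (D : GhostSystem A vac ξ B C S W)

include hA hξ D

section

variable {K : QO V} (hK : K ∈ A) (hK1 : IsHom 1 K)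
  (hKs : mode K (-1) vac = brst vac ξ C S W)

include hK hK1 hKs

/-- `K` commutes with `W` and passes `S` at the cost of the terms of `S_K` with `m = -1`. The free
field `X` is left open so that `X = C` gives `J` with itself and `X = B` gives `J` with `G`. -/
theorem K_brst (X : g →ₗ[ℂ] QO V) (n : ℤ) : mode K n (brst vac ξ X S W) =
    ∑ i, (mode (S (ξ i)) (-1) (mode K n (mode (X (ξ i)) (-1) vac)) -
      (2 : ℂ) • mode (rotS ξ C S (ξ i)) (n - 1) (mode (X (ξ i)) (-1) vac) -
      (2 : ℂ) • mode (C (ξ i)) (n - 2) (mode (X (ξ i)) (-1) vac) +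
      mode (W (ξ i)) (-1) (mode K n (mode (X (ξ i)) (-1) vac))) := by
  rw [brst, map_sum]
  refine sum_congr rfl fun i _ => ?_
  rw [map_add, ← D.W_K hA hξ hK hK1 hKs, D.S_K hA hξ hK hK1 hKs,
    show -1 + n = n - 1 by ring, show n - 1 - 1 = n - 2 by ring]
  push_cast
  module

-- For fixed `j`, ad-invariance under `ξⱼ` moves the bracket from `C` to `S`.
omit hA D hK hK1 hKs [SuperSpace V] in
theorem sum_C_rotS : ∑ i, ∑ j, mode (S (ξ i)) (-1) (mode (C ⁅ξ i, ξ j⁆) (-1)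
      (mode (C (ξ j)) (-1) vac)) =
    -∑ i, ∑ j, mode (S ⁅ξ i, ξ j⁆) (-1) (mode (C (ξ i)) (-1) (mode (C (ξ j)) (-1) vac)) := by
  rw [sum_comm, sum_comm (f := fun i j => mode (S ⁅ξ i, ξ j⁆) (-1) _), ← sum_neg_distrib]
  refine sum_congr rfl fun j _ => ?_
  have h := sum_lie_left hξ (modeBil S C (-1) (-1) (mode (C (ξ j)) (-1) vac)) (ξ j)
  change ∑ i, mode (S ⁅ξ j, ξ i⁆) (-1) (mode (C (ξ i)) (-1) (mode (C (ξ j)) (-1) vac)) =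
    -∑ i, mode (S (ξ i)) (-1) (mode (C ⁅ξ j, ξ i⁆) (-1) (mode (C (ξ j)) (-1) vac)) at h
  rw [← sum_neg_distrib] at h ⊢
  have h2 : ∀ i, ⁅ξ i, ξ j⁆ = -⁅ξ j, ξ i⁆ := fun i => (lie_skew _ _).symm
  simp only [h2, map_neg, mode_neg, LinearMap.neg_apply, neg_neg]
  rw [h, sum_neg_distrib]

-- Three anticommuting ghosts are unchanged by a cyclic permutation, so the cyclic sum falls on the
-- argument of `B`, where it is the Jacobi identity.
omit hA hξ hK hK1 hKs [DecidableEq ι] in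
theorem sum_C_C_E : ∑ i, ∑ j, ∑ l, mode (C (ξ i)) (-1) (mode (C (ξ j)) (-1)
    (mode (B ⁅⁅ξ i, ξ j⁆, ξ l⁆) (-1) (mode (C (ξ l)) (-1) vac))) = 0 := by
  have h : ∀ x y z : g, ∀ v, mode (C x) (-1) (mode (C y) (-1) (mode (B z) (-1) v)) =
      mode (B z) (-1) (mode (C x) (-1) (mode (C y) (-1) v)) := by
    intro x y z v
    rw [D.CB y, if_neg (by norm_num), add_zero, map_neg, D.CB x, if_neg (by norm_num), add_zero,
      neg_neg]
  simp only [h]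
  refine sum_eq_zero_of_cyclic _ fun i j k => ?_
  have h1 : mode (C (ξ j)) (-1) (mode (C (ξ k)) (-1) (mode (C (ξ i)) (-1) vac)) =
      mode (C (ξ i)) (-1) (mode (C (ξ j)) (-1) (mode (C (ξ k)) (-1) vac)) := by
    rw [D.CC (ξ k), map_neg, D.CC (ξ j) (ξ i), neg_neg]
  have h2 : mode (C (ξ k)) (-1) (mode (C (ξ i)) (-1) (mode (C (ξ j)) (-1) vac)) =
      mode (C (ξ i)) (-1) (mode (C (ξ j)) (-1) (mode (C (ξ k)) (-1) vac)) := by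
    rw [D.CC (ξ k) (ξ i), D.CC (ξ k), map_neg, neg_neg]
  rw [h1, h2, ← LinearMap.add_apply, ← LinearMap.add_apply, ← mode_add, ← mode_add, ← map_add,
    ← map_add]
  have h3 : ⁅⁅ξ i, ξ j⁆, ξ k⁆ + ⁅⁅ξ j, ξ k⁆, ξ i⁆ + ⁅⁅ξ k, ξ i⁆, ξ j⁆ = 0 := by
    have := lie_jacobi (ξ k) (ξ i) (ξ j)
    rw [← lie_skew ⁅ξ i, ξ j⁆, ← lie_skew ⁅ξ j, ξ k⁆, ← lie_skew ⁅ξ k, ξ i⁆, ← neg_eq_zero, ← this]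
    abel
  rw [h3, map_zero, mode_zero]
  rfl

-- `W` is moved to the vacuum through both ghosts. Each rotation of a ghost produces, by the Casimir
-- identity, one copy of `∑ C(-2) C(-1)`. In the remaining term `W` is split into its `S` part and
-- its ghost part, and the latter vanishes by `sum_C_C_E`.
omit hK hK1 hKs in
theorem sum_W_rotC : ∑ i, mode (W (ξ i)) (-1) (mode (rotC ξ C (ξ i)) (-1) vac) =
    (2 : ℂ) • ∑ i, mode (C (ξ i)) (-2) (mode (C (ξ i)) (-1) vac) -
    ∑ i, ∑ j, mode (S ⁅ξ i, ξ j⁆) (-1) (mode (C (ξ i)) (-1) (mode (C (ξ j)) (-1) vac)) := by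
  have h0 : ∀ i, mode (W (ξ i)) (-1) (mode (rotC ξ C (ξ i)) (-1) vac) =
      ∑ j, (mode (C ⁅ξ i, ξ j⁆) (-1) (mode (C (ξ j)) (-1) (mode (W (ξ i)) (-1) vac)) +
        mode (C ⁅ξ i, ξ j⁆) (-1) (mode (C ⁅ξ i, ξ j⁆) (-2) vac) +
        mode (C ⁅ξ i, ⁅ξ i, ξ j⁆⁆) (-2) (mode (C (ξ j)) (-1) vac)) := by
    intro i
    rw [rotC_state hA D, map_sum]
    refine sum_congr rfl fun j _ => ?_
    rw [D.WC, D.WC, map_add]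
    rfl
  have h1 : ∑ i, ∑ j, mode (C ⁅ξ i, ⁅ξ i, ξ j⁆⁆) (-2) (mode (C (ξ j)) (-1) vac) =
      ∑ i, mode (C (ξ i)) (-2) (mode (C (ξ i)) (-1) vac) := by
    rw [sum_comm]
    refine sum_congr rfl fun j _ => ?_
    change ∑ i, modeApply C (-2) (mode (C (ξ j)) (-1) vac) ⁅ξ i, ⁅ξ i, ξ j⁆⁆ = _
    rw [← map_sum, casimir hξ]
    rfl
  have h2 : ∑ i, ∑ j, mode (C ⁅ξ i, ξ j⁆) (-1) (mode (C ⁅ξ i, ξ j⁆) (-2) vac) =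
      ∑ i, mode (C (ξ i)) (-2) (mode (C (ξ i)) (-1) vac) := by
    have h3 : ∀ i, ∑ j, mode (C ⁅ξ i, ξ j⁆) (-1) (mode (C ⁅ξ i, ξ j⁆) (-2) vac) =
        ∑ j, mode (C ⁅ξ i, ⁅ξ i, ξ j⁆⁆) (-2) (mode (C (ξ j)) (-1) vac) := by
      intro i
      have h := sum_lie_left hξ (modeComp C (-1) (modeApply C (-2) vac ∘ₗ
        (LieAlgebra.ad ℂ g (ξ i) : Module.End ℂ g))) (ξ i)
      change ∑ j, mode (C ⁅ξ i, ξ j⁆) (-1) (mode (C ⁅ξ i, ξ j⁆) (-2) vac) =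
        -∑ j, mode (C (ξ j)) (-1) (mode (C ⁅ξ i, ⁅ξ i, ξ j⁆⁆) (-2) vac) at h
      rw [h, ← sum_neg_distrib]
      refine sum_congr rfl fun j _ => ?_
      rw [D.CC, neg_neg]
    rw [sum_congr rfl fun i _ => h3 i, h1]
  have h4 : ∑ i, ∑ j, mode (C ⁅ξ i, ξ j⁆) (-1) (mode (C (ξ j)) (-1)
        (mode (W (ξ i)) (-1) vac)) =
      -∑ i, ∑ j, mode (C (ξ i)) (-1) (mode (C (ξ j)) (-1) (mode (W ⁅ξ i, ξ j⁆) (-1) vac)) := by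
    rw [sum_comm, sum_comm (f := fun i j => mode (C (ξ i)) (-1) _), ← sum_neg_distrib]
    refine sum_congr rfl fun j _ => ?_
    have h := sum_lie_left hξ
      (modeComp C (-1) (mode (C (ξ j)) (-1) ∘ₗ modeApply W (-1) vac)) (ξ j)
    change ∑ i, mode (C ⁅ξ j, ξ i⁆) (-1) (mode (C (ξ j)) (-1) (mode (W (ξ i)) (-1) vac)) =
      -∑ i, mode (C (ξ i)) (-1) (mode (C (ξ j)) (-1) (mode (W ⁅ξ j, ξ i⁆) (-1) vac)) at h
    have h5 : ∀ i, ⁅ξ i, ξ j⁆ = -⁅ξ j, ξ i⁆ := fun i => (lie_skew _ _).symm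
    simp only [h5, map_neg, mode_neg, LinearMap.neg_apply, sum_neg_distrib, neg_neg]
    rw [h, neg_neg]
  have h6 : ∑ i, ∑ j, mode (C (ξ i)) (-1) (mode (C (ξ j)) (-1) (mode (W ⁅ξ i, ξ j⁆) (-1) vac)) =
      ∑ i, ∑ j, mode (S ⁅ξ i, ξ j⁆) (-1) (mode (C (ξ i)) (-1) (mode (C (ξ j)) (-1) vac)) := by
    have h7 := sum_C_C_E D
    simp only [D.state, map_add, map_sum, sum_add_distrib]
    rw [h7, add_zero]
    exact sum_congr rfl fun i _ => sum_congr rfl fun j _ => by rw [D.SC, D.SC]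
  rw [sum_congr rfl fun i _ => h0 i]
  simp only [sum_add_distrib]
  rw [h1, h2, h4, h6]
  module

/-- The operator product of `∑ᵢ :(S^{ξᵢ} + W^{ξᵢ}) C^{ξᵢ}:` with itself is trivial. -/
theorem K_brst_self (n : ℕ) : mode K n (brst vac ξ C S W) = 0 := by
  rw [D.K_brst hA hξ hK hK1 hKs]
  simp only [D.K_C hA hK hK1 hKs]
  have hr : ∀ i, mode (rotS ξ C S (ξ i)) (n - 1) (mode (C (ξ i)) (-1) vac) =
      -mode (C (ξ i)) (-1) (mode (rotS ξ C S (ξ i)) (n - 1) vac) := fun i => by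
    rw [D.C_rotS hA, neg_neg]
  by_cases hn : n = 0
  · subst hn
    simp only [hr]
    simp only [if_true, Nat.cast_zero, zero_sub, sum_add_distrib, sum_sub_distrib, ← smul_sum,
      sum_neg_distrib]
    rw [D.sum_W_rotC hA hξ]
    have h1 : ∑ i, mode (S (ξ i)) (-1) (mode (rotC ξ C (ξ i)) (-1) vac) =
        -∑ i, ∑ j, mode (S ⁅ξ i, ξ j⁆) (-1) (mode (C (ξ i)) (-1) (mode (C (ξ j)) (-1) vac)) := by
      rw [← sum_C_rotS hξ]
      exact sum_congr rfl fun i _ => by rw [rotC_state hA D, map_sum]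
    have h2 : ∑ i, mode (C (ξ i)) (-1) (mode (rotS ξ C S (ξ i)) (-1) vac) =
        ∑ i, ∑ j, mode (S ⁅ξ i, ξ j⁆) (-1) (mode (C (ξ i)) (-1) (mode (C (ξ j)) (-1) vac)) := by
      refine sum_congr rfl fun i _ => ?_
      rw [rotS_state hA D, map_sum]
      exact sum_congr rfl fun j _ => by rw [← D.SC]
    -- The terms of type `S C C` now have coefficients `-1`, `2`, `-1`, and those of type `C(-2)
    -- C(-1)` have `-2` and `2`.
    rw [h1, h2]
    module
  · refine sum_eq_zero fun i _ => ?_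
    have h3 : mode (C (ξ i)) (n - 2) (mode (C (ξ i)) (-1) vac) = 0 := by
      by_cases h1 : n = 1
      · subst h1
        -- At `n = 1` this is the square of the odd mode `C(-1)`.
        exact eq_zero_of_eq_neg (D.CC _ _ _ _ _)
      · rw [D.CC, hA.vac_eq_zero (D.pair.memC (ξ i)) (by lia), map_zero, neg_zero]
    rw [if_neg hn, hr, hA.vac_eq_zero (rotS_mem hA D (ξ i)) (by lia), h3]
    simp

/-- Here `L`, `F` and the anomaly arise, up to the normalisation of `J` and `G`. At `n = 0` the
mixed term of `S` with the ghost part of `W` cancels against the `rotS` term, leaving the two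
Sugawara sums and the ghost term. For `n ≥ 1` only the term with `C(n-2)` remains. -/
theorem K_brst_swap (n : ℕ) : mode K n (brst vac ξ B S W) =
    if n = 0 then (2 : ℂ) • (∑ i, mode (S (ξ i)) (-1) (mode (S (ξ i)) (-1) vac) +
      ∑ i, mode (W (ξ i)) (-1) (mode (W (ξ i)) (-1) vac) +
      ∑ i, mode (B (ξ i)) (-1) (mode (C (ξ i)) (-2) vac))
    else if n = 1 then (2 : ℂ) • ∑ i, mode (B (ξ i)) (-1) (mode (C (ξ i)) (-1) vac)
    else if n = 2 then (-2 * Fintype.card ι : ℂ) • vac else 0 := by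
  rw [D.K_brst hA hξ hK hK1 hKs]
  simp only [D.K_B hA hξ hK hK1 hKs]
  have hr : ∀ i, mode (rotS ξ C S (ξ i)) (n - 1) (mode (B (ξ i)) (-1) vac) =
      -mode (B (ξ i)) (-1) (mode (rotS ξ C S (ξ i)) (n - 1) vac) := fun i => by
    rw [D.B_rotS hA hξ, lie_self, map_zero, mode_zero]
    simp
  have hr' : n ≠ 0 → ∀ i, mode (rotS ξ C S (ξ i)) (n - 1) (mode (B (ξ i)) (-1) vac) = 0 :=
    fun hn i => by rw [hr, hA.vac_eq_zero (rotS_mem hA D (ξ i)) (by lia), map_zero, neg_zero]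
  by_cases hn : n = 0
  · subst hn
    simp only [hr]
    simp only [if_true, Nat.cast_zero, zero_sub, map_smul, sum_add_distrib, sum_sub_distrib,
      ← smul_sum, sum_neg_distrib]
    have h1 : ∑ i, mode (C (ξ i)) (-2) (mode (B (ξ i)) (-1) vac) =
        -∑ i, mode (B (ξ i)) (-1) (mode (C (ξ i)) (-2) vac) := by
      rw [← sum_neg_distrib]
      exact sum_congr rfl fun i _ => by rw [D.CB, if_neg (by norm_num), add_zero]
    have h2 : ∑ i, mode (B (ξ i)) (-1) (mode (rotS ξ C S (ξ i)) (-1) vac) =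
        -∑ i, ∑ j, mode (S (ξ i)) (-1) (mode (B ⁅ξ i, ξ j⁆) (-1) (mode (C (ξ j)) (-1) vac)) := by
      have h3 : ∀ i, mode (B (ξ i)) (-1) (mode (rotS ξ C S (ξ i)) (-1) vac) =
          ∑ j, mode (S ⁅ξ i, ξ j⁆) (-1) (mode (B (ξ i)) (-1) (mode (C (ξ j)) (-1) vac)) := by
        intro i
        rw [rotS_state hA D, map_sum]
        exact sum_congr rfl fun j _ => by rw [← D.SB]
      rw [sum_congr rfl fun i _ => h3 i, sum_comm,
        sum_comm (f := fun i j => mode (S (ξ i)) (-1) _), ← sum_neg_distrib]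
      refine sum_congr rfl fun j _ => ?_
      have h := sum_lie_left hξ (modeBil S B (-1) (-1) (mode (C (ξ j)) (-1) vac)) (ξ j)
      change ∑ i, mode (S ⁅ξ j, ξ i⁆) (-1) (mode (B (ξ i)) (-1) (mode (C (ξ j)) (-1) vac)) =
        -∑ i, mode (S (ξ i)) (-1) (mode (B ⁅ξ j, ξ i⁆) (-1) (mode (C (ξ j)) (-1) vac)) at h
      have h4 : ∀ i, ⁅ξ i, ξ j⁆ = -⁅ξ j, ξ i⁆ := fun i => (lie_skew _ _).symm
      simp only [h4, map_neg, mode_neg, LinearMap.neg_apply, sum_neg_distrib]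
      rw [h]
    have h5 : ∑ i, mode (S (ξ i)) (-1) (mode (W (ξ i)) (-1) vac) =
        ∑ i, mode (S (ξ i)) (-1) (mode (S (ξ i)) (-1) vac) +
        ∑ i, ∑ j, mode (S (ξ i)) (-1) (mode (B ⁅ξ i, ξ j⁆) (-1) (mode (C (ξ j)) (-1) vac)) := by
      simp only [D.state, map_add, map_sum, sum_add_distrib]
    rw [h1, h2, h5]
    module
  · simp only [if_neg hn, hr' hn, map_zero, smul_zero, sub_zero, add_zero, zero_sub]
    by_cases h1 : n = 1
    · subst h1
      rw [if_pos rfl, smul_sum]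
      refine sum_congr rfl fun i _ => ?_
      rw [D.CB, if_neg (by norm_num), add_zero, smul_neg, neg_neg]
      rfl
    · rw [if_neg h1]
      -- For `n = 2` each basis vector contributes one contraction of norm `1`, so the sum counts
      -- the dimension of `g`.
      have h2 : ∀ i, mode (C (ξ i)) (n - 2) (mode (B (ξ i)) (-1) vac) =
          if n = 2 then vac else 0 := by
        intro i
        rw [D.CB, hA.vac_eq_zero (D.pair.memC (ξ i)) (by lia), map_zero, neg_zero, zero_add, hξ,
          if_pos rfl, one_smul]
        exact if_congr (by lia) rfl rfl
      simp only [h2]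
      split_ifs
      · rw [sum_const, card_univ, ← Nat.cast_smul_eq_nsmul ℂ]
        module
      · simp

end

/-- Ad-invariance at `j = 0`; the only other contraction, at `j = 1`, has value `κ(⁅x, ξᵢ⁆, ξᵢ) =
0`. -/
theorem W_number (x : g) (j : ℕ) :
    mode (W x) j (∑ i, mode (B (ξ i)) (-1) (mode (C (ξ i)) (-1) vac)) = 0 := by
  have h1 : ∀ i, mode (W x) j (mode (B (ξ i)) (-1) (mode (C (ξ i)) (-1) vac)) =
      mode (B (ξ i)) (-1) (mode (C ⁅x, ξ i⁆) (j - 1) vac) +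
        mode (B ⁅x, ξ i⁆) (j - 1) (mode (C (ξ i)) (-1) vac) := by
    intro i
    rw [D.WB, D.WC, hA.vac_eq_zero (D.memW x) (by lia), map_zero, zero_add]
    rfl
  rw [map_sum, sum_congr rfl fun i _ => h1 i, sum_add_distrib]
  by_cases hj : j = 0
  · subst hj
    have h2 := sum_lie_left hξ (modeComp B (-1) (modeApply C (-1) vac)) x
    change ∑ i, mode (B ⁅x, ξ i⁆) (-1) (mode (C (ξ i)) (-1) vac) =
      -∑ i, mode (B (ξ i)) (-1) (mode (C ⁅x, ξ i⁆) (-1) vac) at h2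
    rw [Nat.cast_zero, zero_sub, h2, add_neg_cancel]
  · rw [sum_eq_zero, sum_eq_zero, add_zero]
    · intro i _
      rw [D.BC, hA.vac_eq_zero (D.pair.memB ⁅x, ξ i⁆) (by lia), map_zero, neg_zero, zero_add]
      split_ifs
      · rw [killing_lie, lie_self, map_zero, zero_smul]
      · rfl
    · intro i _
      rw [hA.vac_eq_zero (D.pair.memC ⁅x, ξ i⁆) (by lia), map_zero]

/-- The ghost number current acts on `∑ᵢ :(S^{ξᵢ} + W^{ξᵢ}) C^{ξᵢ}:` with charge `1`. -/
theorem F_brst {F : QO V} (hF : F ∈ A) (hF0 : IsHom 0 F)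
    (hFs : mode F (-1) vac = -∑ i, mode (B (ξ i)) (-1) (mode (C (ξ i)) (-1) vac)) (n : ℕ) :
    mode F n (brst vac ξ C S W) = if n = 0 then brst vac ξ C S W else 0 := by
  -- `F` commutes with all the currents, so in each term of the vector it only sees the factor `C`,
  -- which has ghost number `1`.
  have hS : ∀ x m n v, mode (S x) m (mode F n v) = mode F n (mode (S x) m v) := by
    intro x m n v
    have h := hA.comm_zero (D.memS x) hF (D.homS x) hF0 (fun j => by
      rw [hFs, map_neg, map_sum, sum_eq_zero, neg_zero]
      intro i _
      rw [D.SB, D.SC, hA.vac_eq_zero (D.memS x) (by lia)]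
      simp) m n v
    simpa using h
  have hW : ∀ x m n v, mode (W x) m (mode F n v) = mode F n (mode (W x) m v) := by
    intro x m n v
    have h := hA.comm_zero (D.memW x) hF (D.homW x) hF0 (fun j => by
      rw [hFs, map_neg, D.W_number hA hξ, neg_zero]) m n v
    simpa using h
  have hC : ∀ x n, mode F n (mode (C x) (-1) vac) =
      mode (C x) (-1) (mode F n vac) + mode (C x) (n - 1) vac := by
    intro x n
    have key : ∀ j : ℕ, mode (C x) j (mode F (-1) vac) =
        if j = 0 then -mode (C x) (-1) vac else 0 := by
      intro j
      have h1 : ∀ i, mode (C x) j (mode (B (ξ i)) (-1) (mode (C (ξ i)) (-1) vac)) =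
          if j = 0 then killingForm ℂ g x (ξ i) • mode (C (ξ i)) (-1) vac else 0 := by
        intro i
        rw [D.CB, D.CC, hA.vac_eq_zero (D.pair.memC x) (by lia)]
        simp only [map_zero, neg_zero, zero_add]
        exact if_congr (by lia) rfl rfl
      rw [hFs, map_neg, map_sum, sum_congr rfl fun i _ => h1 i]
      split_ifs
      · rw [neg_inj]
        exact sum_killing_smul_map hξ (modeApply C (-1) vac) x
      · simp
    have h := hA.comm_one (D.pair.memC x) hF (D.pair.homC x) hF0 (A.neg_mem (D.pair.memC x))
      (by rw [mode_neg]; simpa using key 0) (fun j hj => by rw [key, if_neg (by lia)]) (-1) n vac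
    rw [h, mode_neg, show -1 + n = n - 1 by ring]
    simp
  have hC' : ∀ x, mode F n (mode (C x) (-1) vac) = if n = 0 then mode (C x) (-1) vac else 0 := by
    intro x
    rw [hC, hA.vac_eq_zero hF (by lia), map_zero, zero_add]
    split_ifs with hn
    · simp [hn]
    · exact hA.vac_eq_zero (D.pair.memC x) (by lia)
  rw [brst, map_sum]
  simp only [map_add, ← hS, ← hW, hC']
  split_ifs
  · rfl
  · simp

end GhostSystem

end QO

/-! ### From ghost systems to topological vertex algebras -/

namespace QO

open Finset IsStateSpace GhostSystem

variable {V : Type*} [AddCommGroup V] [Module ℂ V] [SuperSpace V]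
  {A : Submodule ℂ (QO V)} {vac : V}
  {g : Type*} [LieRing g] [LieAlgebra ℂ g] {ι : Type*} [Fintype ι]
  {ξ : Module.Basis ι ℂ g} {B C S E : g →ₗ[ℂ] QO V}

omit [SuperSpace V] in
theorem brst_add : brst vac ξ C S (E + S) =
    ∑ i, mode ((2 : ℂ) • S (ξ i) + E (ξ i)) (-1) (mode (C (ξ i)) (-1) vac) := by
  refine sum_congr rfl fun i _ => ?_
  simp only [LinearMap.add_apply, mode_add, mode_smul, LinearMap.smul_apply]
  module

theorem state_brst (hA : IsStateSpace A vac) (hSA : ∀ x, S x ∈ A) (hEA : ∀ x, E x ∈ A)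
    (hCA : ∀ x, C x ∈ A) :
    mode ((2 : ℂ) • ∑ i, wick (S (ξ i) + (1 / 2 : ℂ) • E (ξ i)) (C (ξ i))) (-1) vac =
      brst vac ξ C S (E + S) := by
  rw [mode_smul, LinearMap.smul_apply, mode_sum, LinearMap.sum_apply, brst_add, smul_sum]
  refine sum_congr rfl fun i _ => ?_
  rw [wick, hA.state_circ (add_mem (hSA _) (A.smul_mem _ (hEA _))) (hCA _),
    ← LinearMap.smul_apply, ← mode_smul, smul_add, smul_smul,
    show (2 : ℂ) * (1 / 2) = 1 by norm_num, one_smul]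

theorem state_virasoro {W : g →ₗ[ℂ] QO V} (hA : IsStateSpace A vac) (hSA : ∀ x, S x ∈ A)
    (hWA : ∀ x, W x ∈ A) (hBA : ∀ x, B x ∈ A) (hCA : ∀ x, C x ∈ A) :
    mode (-(∑ i, wick (S (ξ i)) (S (ξ i))) - (∑ i, wick (W (ξ i)) (W (ξ i))) -
      ∑ i, wick (B (ξ i)) (deriv (C (ξ i)))) (-1) vac =
    -∑ i, mode (S (ξ i)) (-1) (mode (S (ξ i)) (-1) vac) -
      ∑ i, mode (W (ξ i)) (-1) (mode (W (ξ i)) (-1) vac) -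
      ∑ i, mode (B (ξ i)) (-1) (mode (C (ξ i)) (-2) vac) := by
  rw [mode_sub, mode_sub, mode_neg]
  simp only [LinearMap.sub_apply, LinearMap.neg_apply, mode_sum, LinearMap.sum_apply, wick,
    hA.state_circ (hSA _) (hSA _), hA.state_circ (hWA _) (hWA _),
    hA.state_circ (hBA _) (hA.deriv_mem (hCA _)), state_deriv]

/-- A ghost system from commuting currents `S` and `E` at opposite levels, where
`E^x = ∑ᵢ :B^{[x, ξᵢ]} C^{ξᵢ}:`. -/
theorem GhostSystem.of_currents (hp : FreePair A (-1) 1 B C) (hSA : ∀ x, S x ∈ A)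
    (hEA : ∀ x, E x ∈ A) (hS0 : ∀ x, IsHom 0 (S x)) (hE0 : ∀ x, IsHom 0 (E x))
    (hSS : ∀ x y m n v, mode (S x) m (mode (S y) n v) = mode (S y) n (mode (S x) m v) +
      mode (S ⁅x, y⁆) (m + n) v + if m + n = 0 then (m * (-1 * killingForm ℂ g x y)) • v else 0)
    (hEE : ∀ x y m n v, mode (E x) m (mode (E y) n v) = mode (E y) n (mode (E x) m v) +
      mode (E ⁅x, y⁆) (m + n) v + if m + n = 0 then (m * (- -1 * killingForm ℂ g x y)) • v else 0)
    (hES : ∀ x y m n v, mode (E x) m (mode (S y) n v) = mode (S y) n (mode (E x) m v))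
    (hEB : ∀ x y m n v, mode (E x) m (mode (B y) n v) = mode (B y) n (mode (E x) m v) +
      mode (B ⁅x, y⁆) (m + n) v)
    (hEC : ∀ x y m n v, mode (E x) m (mode (C y) n v) = mode (C y) n (mode (E x) m v) +
      mode (C ⁅x, y⁆) (m + n) v)
    (hSB : ∀ x y m n v, mode (S x) m (mode (B y) n v) = mode (B y) n (mode (S x) m v))
    (hSC : ∀ x y m n v, mode (S x) m (mode (C y) n v) = mode (C y) n (mode (S x) m v))
    (hE : ∀ x, mode (E x) (-1) vac =
      ∑ i, mode (B ⁅x, ξ i⁆) (-1) (mode (C (ξ i)) (-1) vac)) :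
    GhostSystem A vac ξ B C S (E + S) where
  pair := hp
  memS := hSA
  memW x := add_mem (hEA x) (hSA x)
  homS := hS0
  homW x := (hE0 x).add (hS0 x)
  SS x y m n v := by
    rw [hSS]
    split_ifs
    · module
    · simp
  WS x y m n v := by
    simp only [LinearMap.add_apply, mode_add, map_add]
    rw [hES x y, hSS x y]
    split_ifs
    · module
    · simp
      abel
  WW x y m n v := by
    simp only [LinearMap.add_apply, mode_add, map_add]
    -- The cross terms commute and the central terms of levels `-1` and `1` cancel.
    rw [hES x y, hSS x y, hEE x y, ← hES y x]
    split_ifs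
    · module
    · simp
      abel
  WB x y m n v := by
    simp only [LinearMap.add_apply, mode_add, map_add]
    rw [hEB, hSB]
    abel
  WC x y m n v := by
    simp only [LinearMap.add_apply, mode_add, map_add]
    rw [hEC, hSC]
    abel
  SB := hSB
  SC := hSC
  state x := by rw [LinearMap.add_apply, mode_add, LinearMap.add_apply, hE, add_comm]

/-- The invariants of the total currents of a ghost system form a topological vertex algebra. -/
theorem GhostSystem.isTVA [DecidableEq ι] (hA : IsStateSpace A vac)
    (hξ : ∀ i j, killingForm ℂ g (ξ i) (ξ j) = if i = j then 1 else 0) {W : g →ₗ[ℂ] QO V}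
    (D : GhostSystem A vac ξ B C S W) {I : Submodule ℂ (QO V)}
    (hI : ∀ a, a ∈ I ↔ a ∈ A ∧ ∀ (x : g) (n : ℕ), circ n (W x) a = 0)
    {L F J G : QO V} (hL : L ∈ A) (hF : F ∈ A) (hJ : J ∈ A) (hG : G ∈ A) (hL0 : IsHom 0 L)
    (hF0 : IsHom 0 F) (hJ1 : IsHom 1 J) (hG1 : IsHom 1 G)
    (sL : mode L (-1) vac = -∑ i, mode (S (ξ i)) (-1) (mode (S (ξ i)) (-1) vac) -
      ∑ i, mode (W (ξ i)) (-1) (mode (W (ξ i)) (-1) vac) -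
      ∑ i, mode (B (ξ i)) (-1) (mode (C (ξ i)) (-2) vac))
    (sF : mode F (-1) vac = -∑ i, mode (B (ξ i)) (-1) (mode (C (ξ i)) (-1) vac))
    (sJ : mode ((2 : ℂ) • J) (-1) vac = brst vac ξ C S W)
    (sG : mode (-G) (-1) vac = brst vac ξ B S W) :
    (∀ x, Commutes (W x) L ∧ Commutes (W x) J ∧ Commutes (W x) G ∧ Commutes (W x) F) ∧
      IsTVA I L F J G := by
  -- Exchanging `B` and `C` exchanges `2J` with `-G`; every statement on `G` alone is the one on `J`
  -- for the system `D'`.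
  have D' := D.swap hξ
  have hKA : (2 : ℂ) • J ∈ A := A.smul_mem 2 hJ
  have hK1 := hJ1.smul 2
  have hHA : -G ∈ A := A.neg_mem hG
  have hH1 := hG1.neg
  have hJ' : ∀ n v, mode J n v = (1 / 2 : ℂ) • mode ((2 : ℂ) • J) n v := by
    intro n v
    rw [mode_smul, LinearMap.smul_apply, smul_smul]
    norm_num
  have hG' : ∀ n v, mode G n v = -mode (-G) n v := by
    intro n v
    rw [mode_neg, LinearMap.neg_apply, neg_neg]
  have hJG : ∀ n : ℕ, mode J n (mode G (-1) vac) =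
      if n = 0 then mode L (-1) vac
      else if n = 1 then mode F (-1) vac
      else if n = 2 then (Fintype.card ι : ℂ) • vac else 0 := by
    intro n
    rw [hJ', hG', sG, map_neg, D.K_brst_swap hA hξ hKA hK1 sJ, sL, sF]
    split_ifs
    · module
    · module
    · module
    · simp
  have hB := hA.isVertexAlgebra_commutant D.memW D.homW hI
  have mJ : J ∈ I := (hI J).2 ⟨hJ, fun x n => hA.circ_eq_zero (D.memW x) hJ (by
    rw [hJ', sJ, map_smul, D.W_brst hA hξ, smul_zero])⟩
  have mG : G ∈ I := (hI G).2 ⟨hG, fun x n => hA.circ_eq_zero (D.memW x) hG (by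
    rw [hG', sG, map_neg, D'.W_brst hA hξ, neg_zero])⟩
  have mF : F ∈ I := (hI F).2 ⟨hF, fun x n => hA.circ_eq_zero (D.memW x) hF (by
    rw [sF, map_neg, D.W_number hA hξ, neg_zero])⟩
  -- The invariants are closed under circle products, and `L = J ∘₀ G`; no direct computation with
  -- `L` is needed.
  have mL : L ∈ I := by
    rw [← hA.circ_eq (n := 0) hJ hG hL (hJG 0)]
    exact hB.circ_mem _ mJ _ mG 0
  have com : ∀ (x : g) (a : QO V), a ∈ I → Commutes (W x) a := fun x a ha =>
    hA.commutes_of_even (D.memW x) ((hI a).1 ha).1 (D.homW x) (((hI a).1 ha).2 x)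
  refine ⟨fun x => ⟨com x _ mL, com x _ mJ, com x _ mG, com x _ mF⟩,
    hA.isTVA_of_ope hB (fun a ha => ((hI a).1 ha).1) mL mF mJ mG hL0 hF0 hJ1 hG1
      (Fintype.card ι) ?_ ?_ ?_ ?_ (hJG 0) (hJG 1) (hJG 2) ?_⟩
  · intro n
    rw [hJ' (-1), sJ, map_smul, hJ', D.K_brst_self hA hξ hKA hK1 sJ, smul_zero, smul_zero]
  · intro n
    rw [hG' (-1), sG, map_neg, hG', D'.K_brst_self hA hξ hHA hH1 sG, neg_zero, neg_zero]
  · intro n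
    rw [hJ', sJ, map_smul, D.F_brst hA hξ hF hF0 sF]
    split_ifs
    · rfl
    · exact smul_zero _
  · intro n
    -- Since `B` and `C` anticommute at these modes, the ghost number current of the exchanged
    -- system is `-F`; this gives `G` charge `-1`.
    have h := D'.F_brst hA hξ (A.neg_mem hF) hF0.neg (by
      rw [mode_neg, LinearMap.neg_apply, sF, neg_inj, ← sum_neg_distrib]
      refine sum_congr rfl fun i _ => ?_
      rw [D.CB, if_neg (by norm_num), add_zero]) n
    rw [mode_neg, LinearMap.neg_apply] at h
    rw [hG', sG, map_neg, ← neg_neg (mode F n _), h]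
    split_ifs
    · rw [neg_neg]
    · rw [neg_neg]
  · intro n hn
    rw [hJG, if_neg (by lia), if_neg (by lia), if_neg (by lia)]

end QO

/-! ### The semi-infinite Weil algebra as a ghost system -/

namespace Weil

open Finset QO QO.IsStateSpace QO.GhostSystem KillingBasis

variable {g : Type*} [LieRing g] [LieAlgebra ℂ g]

variable (g) in
/-- The fields `b^x` as a linear map. -/
def bL : g →ₗ[ℂ] QO (Fock g) := fieldEL ∘ₗ LinearMap.inl ℂ g (Module.Dual ℂ g)

variable (g) in
/-- The fields `c^{κ(x, ·)}` as a linear map. -/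
def cL : g →ₗ[ℂ] QO (Fock g) :=
  (fieldEL ∘ₗ LinearMap.inr ℂ g (Module.Dual ℂ g)) ∘ₗ killingForm ℂ g

variable (g) in
/-- The fields `β^x` as a linear map. -/
def βL : g →ₗ[ℂ] QO (Fock g) := fieldSL ∘ₗ LinearMap.inl ℂ g (Module.Dual ℂ g)

variable (g) in
/-- The fields `γ^{κ(x, ·)}` as a linear map. -/
def γL : g →ₗ[ℂ] QO (Fock g) :=
  (fieldSL ∘ₗ LinearMap.inr ℂ g (Module.Dual ℂ g)) ∘ₗ killingForm ℂ g

theorem b_mem (x : g) : b x ∈ W g := subset_generated _ (Or.inl (Or.inl (Or.inl ⟨x, rfl⟩)))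

theorem c_mem (φ : Module.Dual ℂ g) : c φ ∈ W g :=
  subset_generated _ (Or.inl (Or.inl (Or.inr ⟨φ, rfl⟩)))

theorem β_mem (x : g) : β x ∈ W g := subset_generated _ (Or.inl (Or.inr ⟨x, rfl⟩))

theorem γ_mem (φ : Module.Dual ℂ g) : γ φ ∈ W g := subset_generated _ (Or.inr ⟨φ, rfl⟩)

theorem freePair_bc : FreePair (W g) (-1) 1 (bL g) (cL g) where
  memB x := b_mem x
  memC x := c_mem _
  homB x := isHom_fieldE _
  homC x := isHom_fieldE _
  sign := by norm_num
  sign' := by norm_num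
  BB x y m n v := by
    have h := mode_fieldE_fieldE (x, 0) (y, 0) m n v
    rw [neg_one_smul]
    exact eq_neg_of_add_eq_zero_left (h.trans (by simp))
  CC x y m n v := by
    have h := mode_fieldE_fieldE (0, killingForm ℂ g x) (0, killingForm ℂ g y) m n v
    rw [neg_one_smul]
    exact eq_neg_of_add_eq_zero_left (h.trans (by simp))
  BC x y m n v := by
    have h := mode_fieldE_fieldE (x, 0) (0, killingForm ℂ g y) m n v
    simp only [LinearMap.zero_apply, add_zero] at h
    rw [neg_one_smul, killing_comm x y, ← h]
    change mode (fieldE (x, 0)) m (mode (fieldE (0, killingForm ℂ g y)) n v) =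
      -mode (fieldE (0, killingForm ℂ g y)) n (mode (fieldE (x, 0)) m v) + _
    abel

theorem freePair_βγ : FreePair (W g) 1 0 (βL g) (γL g) where
  memB x := β_mem x
  memC x := γ_mem _
  homB x := isHom_fieldS _
  homC x := isHom_fieldS _
  sign := by norm_num
  sign' := by norm_num
  BB x y m n v := by
    have h := mode_fieldS_fieldS (x, 0) (y, 0) m n v
    rw [one_smul]
    exact sub_eq_zero.1 (h.trans (by simp))
  CC x y m n v := by
    have h := mode_fieldS_fieldS (0, killingForm ℂ g x) (0, killingForm ℂ g y) m n v
    rw [one_smul]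
    exact sub_eq_zero.1 (h.trans (by simp))
  BC x y m n v := by
    have h := mode_fieldS_fieldS (x, 0) (0, killingForm ℂ g y) m n v
    simp only [LinearMap.zero_apply, sub_zero] at h
    rw [one_smul, killing_comm x y, ← h]
    change mode (fieldS (x, 0)) m (mode (fieldS (0, killingForm ℂ g y)) n v) =
      mode (fieldS (0, killingForm ℂ g y)) n (mode (fieldS (x, 0)) m v) + _
    abel

variable {ι : Type*} [Fintype ι] (ξ : Module.Basis ι ℂ g)

/-- `Θ_E` as a linear map. -/
def ThetaEL : g →ₗ[ℂ] QO (Fock g) where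
  toFun := ThetaE ξ
  map_add' x y := by
    simp only [ThetaE, wick, ← sum_add_distrib, ← circ_add_left]
    exact sum_congr rfl fun i _ => by rw [add_lie]; exact congrArg₂ _ (map_add (bL g) _ _) rfl
  map_smul' r x := by
    simp only [ThetaE, wick, smul_sum, ← circ_smul_left, RingHom.id_apply]
    exact sum_congr rfl fun i _ => by rw [smul_lie]; exact congrArg₂ _ (map_smul (bL g) _ _) rfl

/-- `Θ_S` as a linear map. -/
def ThetaSL : g →ₗ[ℂ] QO (Fock g) where
  toFun := ThetaS ξ
  map_add' x y := by
    simp only [ThetaS, wick, ← neg_add, ← sum_add_distrib, ← circ_add_left, neg_inj]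
    exact sum_congr rfl fun i _ => by rw [add_lie]; exact congrArg₂ _ (map_add (βL g) _ _) rfl
  map_smul' r x := by
    simp only [ThetaS, wick, smul_neg, smul_sum, ← circ_smul_left, RingHom.id_apply, neg_inj]
    exact sum_congr rfl fun i _ => by rw [smul_lie]; exact congrArg₂ _ (map_smul (βL g) _ _) rfl

theorem ThetaE_mem (x : g) : ThetaE ξ x ∈ W g :=
  sum_mem fun _ _ => isStateSpace_W.circ_mem _ (b_mem _) _ (c_mem _) _

theorem ThetaS_mem (x : g) : ThetaS ξ x ∈ W g :=
  neg_mem (sum_mem fun _ _ => isStateSpace_W.circ_mem _ (β_mem _) _ (γ_mem _) _)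

theorem ThetaW_mem (x : g) : ThetaW ξ x ∈ W g := add_mem (ThetaE_mem ξ x) (ThetaS_mem ξ x)

theorem isHom_ThetaE (x : g) : IsHom 0 (ThetaE ξ x) :=
  IsHom.of_add_self (k := 1) (IsHom.sum fun _ _ => (isHom_fieldE _).circ (isHom_fieldE _) _)

theorem isHom_ThetaS (x : g) : IsHom 0 (ThetaS ξ x) :=
  (IsHom.sum fun _ _ => (isHom_fieldS _).circ (isHom_fieldS _) _).neg

theorem isHom_ThetaW (x : g) : IsHom 0 (ThetaW ξ x) := (isHom_ThetaE ξ x).add (isHom_ThetaS ξ x)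

theorem L_mem_W : L ξ ∈ W g := by
  refine sub_mem (sub_mem (neg_mem (sum_mem fun i _ => ?_)) (sum_mem fun i _ => ?_))
    (sum_mem fun i _ => ?_)
  · exact isStateSpace_W.circ_mem _ (ThetaS_mem ξ _) _ (ThetaS_mem ξ _) _
  · exact isStateSpace_W.circ_mem _ (ThetaW_mem ξ _) _ (ThetaW_mem ξ _) _
  · exact isStateSpace_W.circ_mem _ (b_mem _) _ (isStateSpace_W.deriv_mem (c_mem _)) _

theorem J_mem_W : J ξ ∈ W g := sum_mem fun _ _ => isStateSpace_W.circ_mem _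
  (add_mem (ThetaS_mem ξ _) (Submodule.smul_mem _ _ (ThetaE_mem ξ _))) _ (c_mem _) _

theorem G_mem_W : G ξ ∈ W g := neg_mem (sum_mem fun _ _ => isStateSpace_W.circ_mem _
  (add_mem (Submodule.smul_mem _ _ (ThetaS_mem ξ _)) (ThetaE_mem ξ _)) _ (b_mem _) _)

theorem F_mem_W : F ξ ∈ W g :=
  neg_mem (sum_mem fun _ _ => isStateSpace_W.circ_mem _ (b_mem _) _ (c_mem _) _)

theorem isHom_L : IsHom 0 (L ξ) :=
  ((IsHom.sum fun _ _ => (isHom_ThetaS ξ _).circ (isHom_ThetaS ξ _) _).neg.sub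
    (IsHom.sum fun _ _ => (isHom_ThetaW ξ _).circ (isHom_ThetaW ξ _) _)).sub
    (IsHom.of_add_self (k := 1)
      (IsHom.sum fun _ _ => (isHom_fieldE _).circ (isHom_fieldE _).deriv _))

theorem isHom_J : IsHom 1 (J ξ) := IsHom.sum fun _ _ =>
  ((isHom_ThetaS ξ _).add ((isHom_ThetaE ξ _).smul _)).circ (isHom_fieldE _) _

theorem isHom_G : IsHom 1 (G ξ) := IsHom.neg (IsHom.sum fun _ _ =>
  (((isHom_ThetaS ξ _).smul _).add (isHom_ThetaE ξ _)).circ (isHom_fieldE _) _)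

theorem isHom_F : IsHom 0 (F ξ) := IsHom.neg (IsHom.of_add_self (k := 1)
  (IsHom.sum fun _ _ => (isHom_fieldE _).circ (isHom_fieldE _) _))

variable [DecidableEq ι] (hξ : ∀ i j, killingForm ℂ g (ξ i) (ξ j) = if i = j then 1 else 0)

include hξ

-- For an orthonormal basis the dual basis is `κ(ξᵢ, ·)`. This is the point at which fields indexed
-- by `g*` become fields indexed by `g`.
omit [Fintype ι] in
theorem c_coord (i : ι) : c (ξ.coord i) = cL g (ξ i) := by
  rw [coord_eq hξ]
  rfl

omit [Fintype ι] in
theorem γ_coord (i : ι) : γ (ξ.coord i) = γL g (ξ i) := by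
  rw [coord_eq hξ]
  rfl

theorem ThetaE_state (x : g) : mode (ThetaEL ξ x) (-1) (vac g) =
    ∑ i, mode (bL g ⁅x, ξ i⁆) (-1) (mode (cL g (ξ i)) (-1) (vac g)) := by
  change mode (∑ i, circ (-1) (b ⁅x, ξ i⁆) (c (ξ.coord i))) (-1) (vac g) = _
  rw [mode_sum, LinearMap.sum_apply]
  refine sum_congr rfl fun i _ => ?_
  rw [isStateSpace_W.state_circ (b_mem _) (c_mem _), c_coord ξ hξ]
  rfl

theorem ThetaS_state (x : g) : mode (ThetaSL ξ x) (-1) (vac g) =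
    -∑ i, mode (βL g ⁅x, ξ i⁆) (-1) (mode (γL g (ξ i)) (-1) (vac g)) := by
  change mode (-∑ i, circ (-1) (β ⁅x, ξ i⁆) (γ (ξ.coord i))) (-1) (vac g) = _
  rw [mode_neg, LinearMap.neg_apply, mode_sum, LinearMap.sum_apply, neg_inj]
  refine sum_congr rfl fun i _ => ?_
  rw [isStateSpace_W.state_circ (β_mem _) (γ_mem _), γ_coord ξ hξ]
  rfl

theorem ThetaE_fieldS (x : g) (u : g × Module.Dual ℂ g) (hu : fieldS u ∈ W g) (m n : ℤ)
    (v : Fock g) : mode (ThetaEL ξ x) m (mode (fieldS u) n v) =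
      mode (fieldS u) n (mode (ThetaEL ξ x) m v) := by
  have h := isStateSpace_W.comm_zero hu (ThetaE_mem ξ x) (isHom_fieldS u) (isHom_ThetaE ξ x)
    (fun j => by
      change mode (fieldS u) j (mode (ThetaEL ξ x) (-1) (vac g)) = 0
      rw [ThetaE_state ξ hξ, map_sum]
      refine sum_eq_zero fun i _ => ?_
      change mode (fieldS u) j (mode (fieldE _) (-1) (mode (fieldE _) (-1) (vac g))) = 0
      rw [← mode_fieldE_fieldS, ← mode_fieldE_fieldS, mode_fieldS_vac, map_zero, map_zero]) n m v
  rw [mul_zero, pow_zero, one_smul] at h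
  exact h.symm

theorem ThetaS_fieldE (x : g) (u : g × Module.Dual ℂ g) (hu : fieldE u ∈ W g) (m n : ℤ)
    (v : Fock g) : mode (ThetaSL ξ x) m (mode (fieldE u) n v) =
      mode (fieldE u) n (mode (ThetaSL ξ x) m v) := by
  have h := isStateSpace_W.comm_zero hu (ThetaS_mem ξ x) (isHom_fieldE u) (isHom_ThetaS ξ x)
    (fun j => by
      change mode (fieldE u) j (mode (ThetaSL ξ x) (-1) (vac g)) = 0
      rw [ThetaS_state ξ hξ, map_neg, map_sum, neg_eq_zero]
      refine sum_eq_zero fun i _ => ?_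
      change mode (fieldE u) j (mode (fieldS _) (-1) (mode (fieldS _) (-1) (vac g))) = 0
      rw [mode_fieldE_fieldS, mode_fieldE_fieldS, mode_fieldE_vac, map_zero, map_zero]) n m v
  rw [mul_zero, pow_zero, one_smul] at h
  exact h.symm

theorem ThetaE_ThetaS (x y : g) (m n : ℤ) (v : Fock g) :
    mode (ThetaEL ξ x) m (mode (ThetaSL ξ y) n v) =
      mode (ThetaSL ξ y) n (mode (ThetaEL ξ x) m v) := by
  have h := isStateSpace_W.comm_zero (ThetaE_mem ξ x) (ThetaS_mem ξ y) (isHom_ThetaE ξ x)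
    (isHom_ThetaS ξ y) (fun j => by
      change mode (ThetaEL ξ x) j (mode (ThetaSL ξ y) (-1) (vac g)) = 0
      rw [ThetaS_state ξ hξ, map_neg, map_sum, neg_eq_zero]
      refine sum_eq_zero fun i _ => ?_
      change mode (ThetaEL ξ x) j (mode (fieldS (_, 0)) (-1) (mode (fieldS (0, _)) (-1) (vac g))) =
        0
      rw [ThetaE_fieldS ξ hξ _ _ (β_mem _), ThetaE_fieldS ξ hξ _ _ (γ_mem _),
        isStateSpace_W.vac_eq_zero (a := ThetaEL ξ x) (ThetaE_mem ξ x) (by lia),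
        map_zero, map_zero]) m n v
  rw [mul_zero, pow_zero, one_smul] at h
  exact h

/-- `Θ_E` and `Θ_S` are instances of one bilinear current `-ε ∑ :B C:`, with `ε = -1` for the odd
pair and `ε = 1` for the even one. The signs in their definitions are the ones required, and their
levels `-ε` are opposite. -/
theorem ghostSystem : GhostSystem (W g) (vac g) ξ (bL g) (cL g) (ThetaSL ξ)
    (ThetaEL ξ + ThetaSL ξ) := by
  have hE : ∀ x, mode (ThetaEL ξ x) (-1) (vac g) =
      -(-1 : ℂ) • ∑ i, mode (bL g ⁅x, ξ i⁆) (-1) (mode (cL g (ξ i)) (-1) (vac g)) := fun x => by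
    rw [ThetaE_state ξ hξ, neg_neg, one_smul]
  have hS : ∀ x, mode (ThetaSL ξ x) (-1) (vac g) =
      -(1 : ℂ) • ∑ i, mode (βL g ⁅x, ξ i⁆) (-1) (mode (γL g (ξ i)) (-1) (vac g)) := fun x => by
    rw [ThetaS_state ξ hξ]
    exact (neg_one_smul ℂ _).symm
  exact GhostSystem.of_currents freePair_bc (ThetaS_mem ξ) (ThetaE_mem ξ) (isHom_ThetaS ξ)
    (isHom_ThetaE ξ)
    (isStateSpace_W.bilinear_current_comm hξ freePair_βγ (ThetaS_mem ξ) (isHom_ThetaS ξ) hS)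
    (isStateSpace_W.bilinear_current_comm hξ freePair_bc (ThetaE_mem ξ) (isHom_ThetaE ξ) hE)
    (ThetaE_ThetaS ξ hξ)
    (isStateSpace_W.bilinear_current_left hξ freePair_bc (ThetaE_mem ξ) (isHom_ThetaE ξ) hE)
    (isStateSpace_W.bilinear_current_right hξ freePair_bc (ThetaE_mem ξ) (isHom_ThetaE ξ) hE)
    (fun x y => ThetaS_fieldE ξ hξ x _ (b_mem y)) (fun x y => ThetaS_fieldE ξ hξ x _ (c_mem _))
    (ThetaE_state ξ hξ)

theorem J_state : mode ((2 : ℂ) • J ξ) (-1) (vac g) =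
    brst (vac g) ξ (cL g) (ThetaSL ξ) (ThetaEL ξ + ThetaSL ξ) := by
  have h := state_brst (ξ := ξ) (C := cL g) (S := ThetaSL ξ) (E := ThetaEL ξ) isStateSpace_W (ThetaS_mem ξ) (ThetaE_mem ξ)
    fun _ => c_mem _
  simp only [← c_coord ξ hξ] at h
  exact h

omit [DecidableEq ι] hξ in
theorem G_state : mode (-G ξ) (-1) (vac g) =
    brst (vac g) ξ (bL g) (ThetaSL ξ) (ThetaEL ξ + ThetaSL ξ) := by
  rw [G, neg_neg, mode_sum, LinearMap.sum_apply, brst_add]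
  refine sum_congr rfl fun i _ => ?_
  rw [wick, isStateSpace_W.state_circ (add_mem (Submodule.smul_mem _ _ (ThetaS_mem ξ _))
    (ThetaE_mem ξ _)) (b_mem _)]
  rfl

theorem F_state : mode (F ξ) (-1) (vac g) =
    -∑ i, mode (bL g (ξ i)) (-1) (mode (cL g (ξ i)) (-1) (vac g)) := by
  rw [F, mode_neg, LinearMap.neg_apply, mode_sum, LinearMap.sum_apply, neg_inj]
  refine sum_congr rfl fun i _ => ?_
  rw [wick, isStateSpace_W.state_circ (b_mem _) (c_mem _), c_coord ξ hξ]
  rfl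

theorem L_state : mode (L ξ) (-1) (vac g) =
    -∑ i, mode (ThetaSL ξ (ξ i)) (-1) (mode (ThetaSL ξ (ξ i)) (-1) (vac g)) -
      ∑ i, mode ((ThetaEL ξ + ThetaSL ξ) (ξ i)) (-1)
        (mode ((ThetaEL ξ + ThetaSL ξ) (ξ i)) (-1) (vac g)) -
      ∑ i, mode (bL g (ξ i)) (-1) (mode (cL g (ξ i)) (-2) (vac g)) := by
  have h := state_virasoro (ξ := ξ) (B := bL g) (C := cL g) (S := ThetaSL ξ) isStateSpace_W (ThetaS_mem ξ)
    (W := ThetaEL ξ + ThetaSL ξ) (ThetaW_mem ξ) b_mem fun _ => c_mem _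
  simp only [← c_coord ξ hξ] at h ⊢
  exact h

end Weil

end

theorem theorem5p1 {g : Type*} [LieRing g] [LieAlgebra ℂ g] {ι : Type*} [Fintype ι]
    [DecidableEq ι] (ξ : Module.Basis ι ℂ g)
    (hξ : ∀ i j, killingForm ℂ g (ξ i) (ξ j) = if i = j then 1 else 0) :
    (∀ x : g,
      QO.Commutes (Weil.ThetaW ξ x) (Weil.L ξ) ∧ QO.Commutes (Weil.ThetaW ξ x) (Weil.J ξ) ∧
      QO.Commutes (Weil.ThetaW ξ x) (Weil.G ξ) ∧ QO.Commutes (Weil.ThetaW ξ x) (Weil.F ξ)) ∧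
    QO.IsTVA (Weil.invariants ξ) (Weil.L ξ) (Weil.F ξ) (Weil.J ξ) (Weil.G ξ) := by
  exact (Weil.ghostSystem ξ hξ).isTVA Weil.isStateSpace_W hξ (fun a => Iff.rfl) (Weil.L_mem_W ξ)
    (Weil.F_mem_W ξ) (Weil.J_mem_W ξ) (Weil.G_mem_W ξ) (Weil.isHom_L ξ) (Weil.isHom_F ξ)
    (Weil.isHom_J ξ) (Weil.isHom_G ξ) (Weil.L_state ξ hξ) (Weil.F_state ξ hξ) (Weil.J_state ξ hξ)
    (Weil.G_state ξ)
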